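/- Let $d\ge 1$ and let $P:\mathbb R^d\to\mathbb R$ be measurable. For $\lambda\in\mathbb R$ and $\sigma>0$ consider the Cauchy problem $$ i\partial_t u+P(D)u=\lambda|u|^{2\sigma}u,\qquad u|_{t=0}=u_0,\qquad D=-i\nabla_x, \tag{1}$$ whose solutions $u\in C([0,T];H^s(\mathbb R^d))$ are understood in the sense of Duhamel's formula, with $|u|^{2\sigma}u\in L^1([0,T];H^s(\mathbb R^d))$: $$u(t)=e^{itP(D)}u_0-i\lambda\int_0^t e^{i(t-\tau)P(D)}\big(|u|^{2\sigma}u\big)(\tau)\,d\tau ,\qquad 0\le t\le T.$$ Put $S(t)=e^{-itP(D)}$. A pair $(p,q)\in[2,\infty]^2$, $(p,q)\ne(2,\infty)$, is called admissible if $\frac2p=d\left(\frac12-\frac1q\right)$. Problem (1) is called well posed in $H^s(\mathbb R^d)$ if for every bounded set $B\subset H^s(\mathbb R^d)$ there exist $T>0$ and a Banach space $X_T$ continuously embedded into $C([0,T];H^s(\mathbb R^d))$ such that for every $u_0\in B$, (1) has a unique solution $u\in X_T$, and the map $u_0\mapsto u$ is uniformly continuous from $(B,\|\cdot\|_{H^s})$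 to $C([0,T];H^s(\mathbb R^d))$. Suppose that there exist an admissible pair $(p,q)$, a real number $k<\frac2p=\frac d2-\frac dq$, $T_0>0$ and $C>0$ such that $$\|S(\cdot)u_0\|_{L^p([0,T_0];L^q(\mathbb R^d))}\le C\|u_0\|_{H^k(\mathbb R^d)},\qquad \forall u_0\in H^k(\mathbb R^d).$$ Then for all $\lambda\in\mathbb R$ and all $s,\sigma$ with $$ s\ge 0,\qquad k+\frac dq<s<\frac d2,\qquad 0<\sigma<\frac p2, $$ and such that the nonlinearity is smooth enough, namely $\sigma$ is an integer or there is an integer $r$ with $s\le r<2\sigma+1$ (so that $z\mapsto|z|^{2\sigma}z$ is of class $C^r$ with $r\ge s$), the Cauchy problem (1) is well posed in $H^s(\mathbb R^d)$. -/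

import Mathlib

open MeasureTheory Set FourierTransform TemperedDistribution
open scoped SchwartzMap ENNReal

noncomputable section

/-- Euclidean space `ℝ^d`. -/
abbrev Rd (d : ℕ) : Type := EuclideanSpace ℝ (Fin d)

/-- The Hilbert space `L²(ℝ^d; ℂ)`. -/
abbrev L2 (d : ℕ) : Type := Lp ℂ 2 (volume : Measure (Rd d))

/-! ### The Sobolev space `H^s(ℝ^d)`, `s ∈ ℝ` -/

/-- The tempered distributions `u` with `(1 + |D|²)^{s/2} u ∈ L²`, as a linear subspace. -/
def sobolevSubmodule (d : ℕ) (s : ℝ) : Submodule ℂ 𝓢'(Rd d, ℂ) where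
  carrier := {u | MemSobolev s 2 u}
  add_mem' hu hv := MemSobolev.add hu hv
  zero_mem' := memSobolev_fun_zero (Rd d) ℂ s 2
  smul_mem' c _ hu := MemSobolev.smul c hu

/-- The Sobolev space `H^s(ℝ^d)` of tempered distributions. It is a type of its own, because it
carries the Sobolev norm and not the topology induced by the tempered distributions. -/
def Hs (d : ℕ) (s : ℝ) : Type := sobolevSubmodule d s

namespace Hs

variable {d : ℕ} {s : ℝ}

instance : AddCommGroup (Hs d s) := inferInstanceAs (AddCommGroup (sobolevSubmodule d s))

instance : Module ℂ (Hs d s) := inferInstanceAs (Module ℂ (sobolevSubmodule d s))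

/-- The tempered distribution underlying an element of `H^s`. -/
def toDistribution : Hs d s →ₗ[ℂ] 𝓢'(Rd d, ℂ) := (sobolevSubmodule d s).subtype

/-- The map `f ↦ (1 + |D|²)^{-s/2} f` from `L²` to `H^s`. -/
def ofL2 (d : ℕ) (s : ℝ) : L2 d →ₗ[ℂ] Hs d s :=
  LinearMap.codRestrict (sobolevSubmodule d s)
    ((besselPotential (Rd d) ℂ (-s)).toLinearMap ∘ₗ
      (Lp.toTemperedDistributionCLM ℂ (volume : Measure (Rd d)) 2).toLinearMap)
    (fun f => ⟨f, by simp⟩)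

theorem ofL2_bijective (d : ℕ) (s : ℝ) : Function.Bijective (ofL2 d s) := by
  constructor
  · intro f g h
    have h1 : besselPotential (Rd d) ℂ (-s) (f : 𝓢'(Rd d, ℂ)) =
        besselPotential (Rd d) ℂ (-s) (g : 𝓢'(Rd d, ℂ)) := congrArg Subtype.val h
    have h2 := congrArg (besselPotential (Rd d) ℂ s) h1
    simp only [besselPotential_besselPotential_apply, neg_add_cancel, besselPotential_zero,
      ContinuousLinearMap.id_apply] at h2
    exact LinearMap.ker_eq_bot.mp
      (Lp.ker_toTemperedDistributionCLM_eq_bot (F := ℂ) (μ := (volume : Measure (Rd d)))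
        (p := 2)) h2
  · rintro ⟨u, f, hf⟩
    refine ⟨f, Subtype.ext ?_⟩
    change besselPotential (Rd d) ℂ (-s) (f : 𝓢'(Rd d, ℂ)) = u
    rw [← hf]
    simp

/-- The isomorphism `u ↦ (1 + |D|²)^{s/2} u` from `H^s` onto `L²`. -/
def bessel (d : ℕ) (s : ℝ) : Hs d s ≃ₗ[ℂ] L2 d :=
  (LinearEquiv.ofBijective (ofL2 d s) (ofL2_bijective d s)).symm

/-- The norm of `H^s` is `‖u‖ = ‖(1 + |D|²)^{s/2} u‖` in `L²`. -/
instance : NormedAddCommGroup (Hs d s) :=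
  NormedAddCommGroup.induced (Hs d s) (L2 d) (bessel d s) (bessel d s).injective

instance : NormedSpace ℂ (Hs d s) := NormedSpace.induced ℂ (Hs d s) (L2 d) (bessel d s)

theorem norm_eq (u : Hs d s) : ‖u‖ = ‖bessel d s u‖ := rfl

/-- `bessel` as a linear isometry. -/
def besselIso (d : ℕ) (s : ℝ) : Hs d s ≃ₗᵢ[ℂ] L2 d := ⟨bessel d s, fun _ => rfl⟩

instance : CompleteSpace (Hs d s) :=
  (besselIso d s).toIsometryEquiv.completeSpace

theorem toDistribution_bessel (u : Hs d s) :
    besselPotential (Rd d) ℂ s u.toDistribution = (bessel d s u : 𝓢'(Rd d, ℂ)) := by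
  obtain ⟨f, rfl⟩ := (bessel d s).symm.surjective u
  rw [LinearEquiv.apply_symm_apply]
  change besselPotential (Rd d) ℂ s (besselPotential (Rd d) ℂ (-s) (f : 𝓢'(Rd d, ℂ))) = _
  simp

end Hs

/-! ### The propagator `S(t) = e^{-itP(D)}` -/

/-- The symbol of `e^{-itP(D)}`. Mathlib's Fourier transform is `∫ e^{-2πi x·η} u(x) dx`, so that
`D = -i∇` is multiplication by `2πη`. -/
def phase {d : ℕ} (P : Rd d → ℝ) (t : ℝ) (η : Rd d) : ℂ :=
  Complex.exp (-(Complex.I * t * P ((2 * Real.pi) • η)))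

theorem phase_memLp {d : ℕ} {P : Rd d → ℝ} (hP : Measurable P) (t : ℝ) :
    MemLp (phase P t) ∞ (volume : Measure (Rd d)) := by
  refine memLp_top_of_bound (C := 1) ?_ (Filter.Eventually.of_forall fun η => ?_)
  · have h : Measurable (phase P t) := by
      unfold phase
      fun_prop
    exact h.aestronglyMeasurable
  · rw [phase, Complex.norm_exp]
    simp

/-- `S(t) = e^{-itP(D)}` on `L²`: multiplication by the symbol on the Fourier side. -/
def propagatorL2 {d : ℕ} {P : Rd d → ℝ} (hP : Measurable P) (t : ℝ) (f : L2 d) : L2 d :=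
  𝓕⁻ ((phase_memLp hP t).toLp • 𝓕 f : L2 d)

/-- `S(t) = e^{-itP(D)}` on `H^s`; Fourier multipliers commute with `(1 + |D|²)^{s/2}`. -/
def propagator {d : ℕ} {P : Rd d → ℝ} (hP : Measurable P) {s : ℝ} (t : ℝ) (u : Hs d s) :
    Hs d s :=
  (Hs.bessel d s).symm (propagatorL2 hP t (Hs.bessel d s u))

/-! ### Distributions that are functions, Lebesgue norms -/

/-- The tempered distribution `u` is (given by integration against) the function `f`. -/
def IsFunction {d : ℕ} (u : 𝓢'(Rd d, ℂ)) (f : Rd d → ℂ) : Prop :=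
  ∀ φ : 𝓢(Rd d, ℂ), Integrable (fun x => φ x * f x) ∧ u φ = ∫ x, φ x * f x

/-- The `L^q(ℝ^d)` norm of a tempered distribution: the norm of the function that represents it,
and `∞` if there is none. -/
def lqNorm {d : ℕ} (q : ℝ≥0∞) (u : 𝓢'(Rd d, ℂ)) : ℝ≥0∞ :=
  ⨅ (f : Rd d → ℂ) (_ : IsFunction u f), eLpNorm f q volume

/-- A pair `(p, q) ≠ (2, ∞)` with `p, q ∈ [2, ∞]` and `2/p = d (1/2 - 1/q)`. -/
def Admissible (d : ℕ) (p q : ℝ≥0∞) : Prop :=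
  (p, q) ≠ (2, ∞) ∧ 2 ≤ p ∧ 2 ≤ q ∧ 2 * (p⁻¹).toReal = d * (1 / 2 - (q⁻¹).toReal)

/-- The Strichartz estimate `‖S(·)u₀‖_{L^p([0,T₀]; L^q)} ≤ C ‖u₀‖_{H^k}` for all `u₀ ∈ H^k`. -/
def StrichartzEstimate {d : ℕ} {P : Rd d → ℝ} (hP : Measurable P) (p q : ℝ≥0∞)
    (k T₀ C : ℝ) : Prop :=
  ∀ u₀ : Hs d k,
    eLpNorm (fun t : ℝ => lqNorm q (propagator hP t u₀).toDistribution) p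
      (volume.restrict (Icc 0 T₀)) ≤ ENNReal.ofReal (C * ‖u₀‖)

/-! ### The Cauchy problem `i∂ₜu + P(D)u = lam |u|^{2σ} u`, `u(0) = u₀` -/

/-- `u ∈ C([0,T]; H^s)` solves the Cauchy problem in the sense of Duhamel's formula
`u(t) = e^{itP(D)} u₀ - i lam ∫₀ᵗ e^{i(t-τ)P(D)} (|u|^{2σ}u)(τ) dτ`,
where the nonlinear term `G = |u|^{2σ}u` belongs to `L¹([0,T]; H^s)`.
Since `S(t) = e^{-itP(D)}`, the group `e^{itP(D)}` is `S(-t)`. -/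
def IsSolution {d : ℕ} {P : Rd d → ℝ} (hP : Measurable P) (lam σ : ℝ) {s T : ℝ}
    (u₀ : Hs d s) (u : C(Icc (0 : ℝ) T, Hs d s)) : Prop :=
  ∃ G : ℝ → Hs d s,
    IntegrableOn G (Icc 0 T) ∧
    (∀ᵐ τ : ℝ, ∀ hτ : τ ∈ Icc (0 : ℝ) T, ∃ f : Rd d → ℂ,
      IsFunction (u ⟨τ, hτ⟩).toDistribution f ∧
      IsFunction (G τ).toDistribution (fun x => ((‖f x‖ ^ (2 * σ) : ℝ) : ℂ) * f x)) ∧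
    ∀ t : Icc (0 : ℝ) T,
      u t = propagator hP (-(t : ℝ)) u₀ -
        (Complex.I * lam) • ∫ τ in (0 : ℝ)..t, propagator hP (-((t : ℝ) - τ)) (G τ)

/-- The Cauchy problem is well posed in `H^s`: for every bounded `B ⊆ H^s` there are `T > 0` and a
Banach space `X`, continuously embedded into `C([0,T]; H^s)`, such that for every `u₀ ∈ B` there
is a unique solution `Φ u₀` in `X`, and `Φ` is uniformly continuous from `B`, with the `H^s` norm,
to `C([0,T]; H^s)`. -/
def WellPosed {d : ℕ} {P : Rd d → ℝ} (hP : Measurable P) (lam σ s : ℝ) : Prop :=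
  ∀ B : Set (Hs d s), Bornology.IsBounded B →
    ∃ T : ℝ, 0 < T ∧
    ∃ (X : Type) (_ : NormedAddCommGroup X) (_ : NormedSpace ℂ X) (_ : CompleteSpace X)
      (ι : X →L[ℂ] C(Icc (0 : ℝ) T, Hs d s)) (Φ : Hs d s → X),
      Function.Injective ι ∧
      (∀ u₀ ∈ B, IsSolution hP lam σ u₀ (ι (Φ u₀)) ∧
        ∀ v : X, IsSolution hP lam σ u₀ (ι v) → v = Φ u₀) ∧
      UniformContinuousOn (fun u₀ => ι (Φ u₀)) B

end

/-! Write b = 2σ. The argument trades derivatives for the uniform norm. On the frequency block |η| ∼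
2^n, Bernstein's inequality bounds the L^∞ norm by 2^{nd/q} times the L^q norm, and the Strichartz
estimate costs 2^{nk} in the L² norm. The blocks of S(t)f therefore sum geometrically, and S maps
H^a into L^p([0,T₀]; L^∞) as soon as a > k + d/q (`StrichartzEstimate.lowFreq_top_le`,
`StrichartzEstimate.lintegral_top_le`). As s > k + d/q, this holds with a = μs for some μ < 1, and
Minkowski's inequality extends it to Duhamel integrals with forcing in L¹([0,T]; H^s)
(`duhamel_lintegral_top_le`).

For functions bounded by M, the nonlinearity F(z) = |z|^b z satisfies ‖F(u) - F(v)‖_{H^s} ≤ C (M^b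
‖u - v‖_{H^s} + ‖u - v‖_∞^θ M^{b-θ} (‖u‖_{H^s} + ‖v‖_{H^s}))
(`exists_sobolevNorm_powNonlin_sub_le`). By homogeneity M = 1 suffices. In integer order r this
follows from the formula of Faà di Bruno and the Gagliardo–Nirenberg inequalities, applied to low
frequency parts, which are smooth. For s < r it follows by nonlinear interpolation: F(u) - F(v) is
compared with its analogue for the low frequency parts at every dyadic scale
(`sobolevNorm_sq_le_tsum`).

The unknown of the fixed point problem is the forcing H in L¹([0,T]; H^s), not u; it has to satisfy
H = -iλ F(u), where u is the solution of the linear equation with data u₀ and forcing H. Hölder's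
inequality in time gives a factor T^{1-b/p₁} with b < p₁, small for small T. The derivatives of F
are only Hölder continuous, so the map is not Lipschitz in L¹H^s. It does contract in the weak norm
of L¹L², and it contracts in L¹H^s up to the power θ of the L^{p₁}L^∞ norm of a difference. As μ <
1, interpolation of H^{μs} between L² and H^s bounds that norm by a positive power of the weak norm.
This suffices for the convergence of the iterates (`exists_fixedPoint_of_weak_contraction`) and
yields an explicit modulus of continuity in the data
(`IsSubcritical.norm_sub_le_of_nextForcing_eq`).

Uniqueness needs no auxiliary space. A solution in C([0,T]; H^s) has by definition its nonlinear
term in L¹H^s, hence lies in L^{p₁}L^∞, and Gronwall's inequality in L² applies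
(`IsSubcritical.nextForcing_unique`). So X can be C([0,T]; H^s) itself. -/

open Filter
open scoped Topology LineDeriv

noncomputable section

variable {d : ℕ}

/-! ### Distributions represented by functions -/

namespace IsFunction

variable {d : ℕ}

/-- Testing against a bump function equal to 1 near x turns integrability of φ f into integrability
of f on a ball. -/
theorem locallyIntegrable {u : 𝓢'(Rd d, ℂ)} {f : Rd d → ℂ} (h : IsFunction u f) :
    LocallyIntegrable f := by
  intro x
  obtain ⟨b, hb⟩ : ∃ b : ContDiffBump x, b.rIn = 1 := ⟨⟨1, 2, by norm_num, by norm_num⟩, rfl⟩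
  have hg₁ : HasCompactSupport (Complex.ofRealCLM ∘ b) := b.hasCompactSupport.comp_left rfl
  have hg₂ : ContDiff ℝ (⊤ : ℕ∞) (Complex.ofRealCLM ∘ b) :=
    Complex.ofRealCLM.contDiff.comp b.contDiff
  have hi := (h (hg₁.toSchwartzMap hg₂)).1
  refine ⟨Metric.closedBall x 1, Metric.closedBall_mem_nhds x one_pos, ?_⟩
  refine (hi.integrableOn (s := Metric.closedBall x 1)).congr ?_
  filter_upwards [ae_restrict_mem Metric.isClosed_closedBall.measurableSet] with y hy
  have : b y = 1 := b.one_of_mem_closedBall (by rwa [hb])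
  simp [this]

/-- Test functions determine a locally integrable function almost everywhere. Hence the infimum in
`lqNorm` runs over a single class of functions. -/
theorem ae_eq {u : 𝓢'(Rd d, ℂ)} {f g : Rd d → ℂ} (hf : IsFunction u f) (hg : IsFunction u g) :
    f =ᵐ[volume] g := by
  refine ae_eq_of_integral_contDiff_smul_eq hf.locallyIntegrable hg.locallyIntegrable ?_
  intro b hb hc
  have hg₁ : HasCompactSupport (Complex.ofRealCLM ∘ b) := hc.comp_left rfl
  have hg₂ : ContDiff ℝ (⊤ : ℕ∞) (Complex.ofRealCLM ∘ b) := Complex.ofRealCLM.contDiff.comp hb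
  have h1 := (hf (hg₁.toSchwartzMap hg₂)).2
  have h2 := (hg (hg₁.toSchwartzMap hg₂)).2
  rw [h1] at h2
  simpa using h2

theorem congr_ae {u : 𝓢'(Rd d, ℂ)} {f g : Rd d → ℂ} (hf : IsFunction u f)
    (h : f =ᵐ[volume] g) : IsFunction u g := by
  intro φ
  have h' : (fun x => φ x * f x) =ᵐ[volume] fun x => φ x * g x := by
    filter_upwards [h] with x hx
    rw [hx]
  exact ⟨(hf φ).1.congr h', by rw [(hf φ).2, integral_congr_ae h']⟩

theorem of_L2 (f : L2 d) : IsFunction (f : 𝓢'(Rd d, ℂ)) f := by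
  intro φ
  refine ⟨?_, by simp⟩
  exact (φ.memLp 2 volume).integrable_mul (Lp.memLp f)

theorem ext {u v : 𝓢'(Rd d, ℂ)} {f : Rd d → ℂ} (hu : IsFunction u f) (hv : IsFunction v f) :
    u = v := by
  ext φ
  rw [(hu φ).2, (hv φ).2]

theorem smulLeft {u : 𝓢'(Rd d, ℂ)} {f : Rd d → ℂ} (hu : IsFunction u f) {g : Rd d → ℂ}
    (hg : g.HasTemperateGrowth) : IsFunction (smulLeftCLM ℂ g u) (fun x => g x * f x) := by
  intro φ
  have h := hu (SchwartzMap.smulLeftCLM ℂ g φ)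
  have e : (fun x => (SchwartzMap.smulLeftCLM ℂ g φ) x * f x) = fun x => φ x * (g x * f x) := by
    ext x
    rw [SchwartzMap.smulLeftCLM_apply_apply hg]
    simp only [smul_eq_mul]
    ring
  rw [e] at h
  simpa using h

end IsFunction

variable {d : ℕ}

theorem L2.toDistribution_injective {f g : L2 d} (h : (f : 𝓢'(Rd d, ℂ)) = g) : f = g :=
  Lp.ext ((IsFunction.of_L2 f).ae_eq (h ▸ IsFunction.of_L2 g))

theorem isFunction_L2_iff {f : L2 d} {g : Rd d → ℂ} :
    IsFunction (f : 𝓢'(Rd d, ℂ)) g ↔ f =ᵐ[volume] g :=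
  ⟨fun h => (IsFunction.of_L2 f).ae_eq h, fun h => (IsFunction.of_L2 f).congr_ae h⟩

theorem lqNorm_L2 (q : ℝ≥0∞) (f : L2 d) : lqNorm q (f : 𝓢'(Rd d, ℂ)) = eLpNorm f q volume := by
  refine le_antisymm (iInf₂_le _ (IsFunction.of_L2 f)) (le_iInf₂ fun g hg => ?_)
  exact (eLpNorm_congr_ae (isFunction_L2_iff.1 hg)).le

/-! ### Weighted Fourier norms -/

/-- The weight `(1 + |η|²)^{a/2}`. -/
def sobolevWeight (a : ℝ) (η : Rd d) : ℝ := (1 + ‖η‖ ^ 2) ^ (a / 2)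

theorem sobolevWeight_pos (a : ℝ) (η : Rd d) : 0 < sobolevWeight a η := by
  unfold sobolevWeight; positivity

theorem sobolevWeight_zero (η : Rd d) : sobolevWeight 0 η = 1 := by simp [sobolevWeight]

theorem sobolevWeight_add (a b : ℝ) (η : Rd d) :
    sobolevWeight (a + b) η = sobolevWeight a η * sobolevWeight b η := by
  unfold sobolevWeight
  rw [← Real.rpow_add (by positivity)]
  ring_nf

theorem sobolevWeight_mono {a b : ℝ} (h : a ≤ b) (η : Rd d) :
    sobolevWeight a η ≤ sobolevWeight b η := by
  unfold sobolevWeight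
  exact Real.rpow_le_rpow_of_exponent_le (by nlinarith [sq_nonneg ‖η‖]) (by linarith)

theorem continuous_sobolevWeight (a : ℝ) : Continuous (sobolevWeight (d := d) a) := by
  unfold sobolevWeight
  exact Continuous.rpow_const (by fun_prop) fun η => Or.inl (by positivity)

theorem hasTemperateGrowth_sobolevWeight (a : ℝ) :
    (fun η : Rd d => (sobolevWeight a η : ℂ)).HasTemperateGrowth := by
  unfold sobolevWeight; fun_prop

/-- The `H^a` norm of an `L²` function, as an extended nonnegative number. -/
def sobolevNorm (a : ℝ) (f : L2 d) : ℝ≥0∞ :=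
  eLpNorm (fun η => (sobolevWeight a η : ℂ) * (𝓕 f : L2 d) η) 2 volume

theorem aestronglyMeasurable_weight_mul (a : ℝ) (f : L2 d) :
    AEStronglyMeasurable (fun η => (sobolevWeight a η : ℂ) * f η) volume :=
  (Complex.continuous_ofReal.comp (continuous_sobolevWeight a)).aestronglyMeasurable.mul
    (Lp.aestronglyMeasurable f)

theorem sobolevNorm_zero (f : L2 d) : sobolevNorm 0 f = ‖f‖ₑ := by
  unfold sobolevNorm
  simp only [sobolevWeight_zero, Complex.ofReal_one, one_mul]
  rw [← Lp.enorm_def, ← ofReal_norm, ← ofReal_norm, Lp.norm_fourier_eq]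

theorem sobolevNorm_sq (a : ℝ) (f : L2 d) :
    sobolevNorm a f ^ 2 =
      ∫⁻ η, ENNReal.ofReal (sobolevWeight a η) ^ 2 * ‖(𝓕 f : L2 d) η‖ₑ ^ 2 := by
  unfold sobolevNorm
  have := eLpNorm_nnreal_pow_eq_lintegral (p := 2) (f := fun η =>
    (sobolevWeight a η : ℂ) * (𝓕 f : L2 d) η) (μ := volume) (by norm_num)
  simp only [NNReal.coe_ofNat, ENNReal.coe_ofNat, ENNReal.rpow_ofNat] at this
  rw [this]
  refine lintegral_congr fun η => ?_
  rw [enorm_mul, mul_pow, ← ofReal_norm, Complex.norm_real, Real.norm_of_nonneg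
    (sobolevWeight_pos a η).le]

/-- Only the modulus of the Fourier transform enters, so unimodular multipliers such as the
propagator preserve every Sobolev norm. -/
theorem sobolevNorm_congr_norm (a : ℝ) {f g : L2 d}
    (h : ∀ᵐ η, ‖(𝓕 f : L2 d) η‖ = ‖(𝓕 g : L2 d) η‖) : sobolevNorm a f = sobolevNorm a g := by
  refine eLpNorm_congr_norm_ae ?_
  filter_upwards [h] with η hη
  rw [norm_mul, norm_mul, hη]

theorem sobolevNorm_mono {a b : ℝ} (h : a ≤ b) (f : L2 d) : sobolevNorm a f ≤ sobolevNorm b f := by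
  refine eLpNorm_mono fun η => ?_
  rw [norm_mul, norm_mul, Complex.norm_real, Complex.norm_real,
    Real.norm_of_nonneg (sobolevWeight_pos a η).le, Real.norm_of_nonneg (sobolevWeight_pos b η).le]
  exact mul_le_mul_of_nonneg_right (sobolevWeight_mono h η) (norm_nonneg _)

theorem sobolevNorm_smul (a : ℝ) (c : ℂ) (f : L2 d) :
    sobolevNorm a (c • f) = ‖c‖ₑ * sobolevNorm a f := by
  unfold sobolevNorm
  rw [← eLpNorm_const_smul]
  refine eLpNorm_congr_ae ?_
  rw [FourierTransform.fourier_smul]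
  filter_upwards [Lp.coeFn_smul c (𝓕 f : L2 d)] with η hη
  simp only [hη, Pi.smul_apply, smul_eq_mul]
  ring

theorem sobolevNorm_zero_right (a : ℝ) : sobolevNorm a (0 : L2 d) = 0 := by
  have := sobolevNorm_smul a 0 (0 : L2 d)
  simpa using this

/-- This is the bridge between the definition of H^s by distributions and weighted L² norms: on the
Fourier side the Bessel potential is multiplication by a weight of temperate growth. -/
theorem besselPotential_L2_iff {a : ℝ} {f g : L2 d} :
    besselPotential (Rd d) ℂ a (f : 𝓢'(Rd d, ℂ)) = g ↔
      (𝓕 g : L2 d) =ᵐ[volume] fun η => (sobolevWeight a η : ℂ) * (𝓕 f : L2 d) η := by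
  have key : IsFunction (𝓕 (besselPotential (Rd d) ℂ a (f : 𝓢'(Rd d, ℂ))))
      (fun η => (sobolevWeight a η : ℂ) * (𝓕 f : L2 d) η) := by
    rw [fourier_besselPotential_eq_smulLeftCLM_fourier_apply, Lp.fourier_toTemperedDistribution_eq]
    exact (IsFunction.of_L2 _).smulLeft (hasTemperateGrowth_sobolevWeight a)
  constructor
  · intro h
    rw [h, Lp.fourier_toTemperedDistribution_eq] at key
    exact isFunction_L2_iff.1 key
  · intro h
    have h2 : IsFunction (𝓕 (g : 𝓢'(Rd d, ℂ)))
      (fun η => (sobolevWeight a η : ℂ) * (𝓕 f : L2 d) η) := by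
      rw [Lp.fourier_toTemperedDistribution_eq]
      exact isFunction_L2_iff.2 h
    have := congrArg (fun w : 𝓢'(Rd d, ℂ) => 𝓕⁻ w) (key.ext h2)
    simpa only [fourierInv_fourier_eq] using this

/-! ### The propagator -/

section propagator

variable {P : Rd d → ℝ} (hP : Measurable P)

theorem norm_phase (t : ℝ) (η : Rd d) : ‖phase P t η‖ = 1 := by
  rw [phase, Complex.norm_exp]; simp

theorem phase_add (t t' : ℝ) (η : Rd d) : phase P (t + t') η = phase P t η * phase P t' η := by
  unfold phase
  rw [← Complex.exp_add]
  push_cast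
  ring_nf

theorem fourier_propagatorL2 (t : ℝ) (f : L2 d) :
    (𝓕 (propagatorL2 hP t f) : L2 d) =ᵐ[volume] fun η => phase P t η * (𝓕 f : L2 d) η := by
  unfold propagatorL2
  rw [fourier_fourierInv_eq]
  filter_upwards [Lp.coeFn_lpSMul (r := 2) (phase_memLp hP t).toLp (𝓕 f : L2 d),
    (phase_memLp hP t).coeFn_toLp] with η h1 h2
  simp [h1, h2]

theorem L2.ext_fourier {f g : L2 d} (h : (𝓕 f : L2 d) =ᵐ[volume] (𝓕 g : L2 d)) : f = g :=
  (Lp.fourierTransformₗᵢ (Rd d) ℂ).injective (Lp.ext h)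

theorem propagatorL2_add (t : ℝ) (f g : L2 d) :
    propagatorL2 hP t (f + g) = propagatorL2 hP t f + propagatorL2 hP t g := by
  refine L2.ext_fourier ?_
  rw [FourierTransform.fourier_add]
  filter_upwards [fourier_propagatorL2 hP t (f + g), fourier_propagatorL2 hP t f,
    fourier_propagatorL2 hP t g, Lp.coeFn_add (𝓕 f : L2 d) (𝓕 g : L2 d),
    Lp.coeFn_add (𝓕 (propagatorL2 hP t f) : L2 d) (𝓕 (propagatorL2 hP t g) : L2 d)]
    with η h1 h2 h3 h4 h5
  rw [h1, h5, FourierTransform.fourier_add, h4, Pi.add_apply, Pi.add_apply, h2, h3]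
  ring

theorem propagatorL2_smul (t : ℝ) (c : ℂ) (f : L2 d) :
    propagatorL2 hP t (c • f) = c • propagatorL2 hP t f := by
  refine L2.ext_fourier ?_
  rw [FourierTransform.fourier_smul]
  filter_upwards [fourier_propagatorL2 hP t (c • f), fourier_propagatorL2 hP t f,
    Lp.coeFn_smul c (𝓕 f : L2 d), Lp.coeFn_smul c (𝓕 (propagatorL2 hP t f) : L2 d)]
    with η h1 h2 h3 h4
  rw [h1, h4, FourierTransform.fourier_smul, h3, Pi.smul_apply, Pi.smul_apply, h2]
  simp only [smul_eq_mul]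
  ring

theorem propagatorL2_propagatorL2 (t t' : ℝ) (f : L2 d) :
    propagatorL2 hP t (propagatorL2 hP t' f) = propagatorL2 hP (t + t') f := by
  refine L2.ext_fourier ?_
  filter_upwards [fourier_propagatorL2 hP t (propagatorL2 hP t' f), fourier_propagatorL2 hP t' f,
    fourier_propagatorL2 hP (t + t') f] with η h1 h2 h3
  rw [h1, h2, h3, phase_add, mul_assoc]

theorem sobolevNorm_propagatorL2 (a t : ℝ) (f : L2 d) :
    sobolevNorm a (propagatorL2 hP t f) = sobolevNorm a f := by
  refine sobolevNorm_congr_norm a ?_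
  filter_upwards [fourier_propagatorL2 hP t f] with η h
  rw [h, norm_mul, norm_phase, one_mul]

theorem norm_propagatorL2 (t : ℝ) (f : L2 d) : ‖propagatorL2 hP t f‖ = ‖f‖ := by
  have := sobolevNorm_propagatorL2 hP 0 t f
  rwa [sobolevNorm_zero, sobolevNorm_zero, ← ofReal_norm, ← ofReal_norm,
    ENNReal.ofReal_eq_ofReal_iff (norm_nonneg _) (norm_nonneg _)] at this

/-- `S(t)` on `L²` as a linear isometry. -/
def propagatorL2ₗᵢ (t : ℝ) : L2 d →ₗᵢ[ℂ] L2 d where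
  toFun := propagatorL2 hP t
  map_add' := propagatorL2_add hP t
  map_smul' := propagatorL2_smul hP t
  norm_map' := norm_propagatorL2 hP t

/-- By Plancherel it is enough to argue on the Fourier side, where the phases converge pointwise in
η and 4|𝓕f|² dominates. Regularity of P plays no role. -/
theorem continuous_propagatorL2_apply (f : L2 d) : Continuous fun t => propagatorL2 hP t f := by
  have hmeas : ∀ t, AEStronglyMeasurable (fun η => phase P t η * (𝓕 f : L2 d) η) volume := fun t =>
    (phase_memLp hP t).1.mul (Lp.aestronglyMeasurable _)
  have hmem : ∀ t, MemLp (fun η => phase P t η * (𝓕 f : L2 d) η) 2 volume := fun t => by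
    refine (Lp.memLp (𝓕 f : L2 d)).of_le (hmeas t) ?_
    filter_upwards with η
    rw [norm_mul, norm_phase, one_mul]
  have e : (fun t => propagatorL2 hP t f) = fun t => 𝓕⁻ ((hmem t).toLp) := by
    ext1 t
    refine L2.ext_fourier ?_
    rw [fourier_fourierInv_eq]
    exact (fourier_propagatorL2 hP t f).trans (hmem t).coeFn_toLp.symm
  rw [e]
  refine (Lp.fourierTransformₗᵢ (Rd d) ℂ).symm.continuous.comp ?_
  rw [continuous_iff_continuousAt]
  intro t₀
  have h2 : Fact ((1 : ℝ≥0∞) ≤ 2) := ⟨by norm_num⟩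
  refine tendsto_iff_norm_sub_tendsto_zero.2 ?_
  have e2 : ∀ t, ‖(hmem t).toLp - (hmem t₀).toLp‖ =
      (∫ η, ‖phase P t η * (𝓕 f : L2 d) η - phase P t₀ η * (𝓕 f : L2 d) η‖ ^ 2) ^ (1 / 2 : ℝ) := by
    intro t
    rw [← MemLp.toLp_sub, Lp.norm_toLp, MemLp.eLpNorm_eq_integral_rpow_norm (by norm_num)
      (by norm_num) ((hmem t).sub (hmem t₀)), ENNReal.toReal_ofReal (by positivity)]
    simp
  simp_rw [e2]
  have : (0 : ℝ) = (∫ η : Rd d, (0 : ℝ)) ^ (1 / 2 : ℝ) := by simp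
  rw [this]
  refine Filter.Tendsto.rpow_const ?_ (Or.inr (by norm_num))
  refine tendsto_integral_filter_of_dominated_convergence
    (fun η => 4 * ‖(𝓕 f : L2 d) η‖ ^ 2) ?_ ?_ ?_ ?_
  · exact Filter.Eventually.of_forall fun t => (((hmeas t).sub (hmeas t₀)).norm.pow 2)
  · refine Filter.Eventually.of_forall fun t => Filter.Eventually.of_forall fun η => ?_
    rw [Real.norm_of_nonneg (by positivity)]
    have : ‖phase P t η * (𝓕 f : L2 d) η - phase P t₀ η * (𝓕 f : L2 d) η‖ ≤
        2 * ‖(𝓕 f : L2 d) η‖ := by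
      refine (norm_sub_le _ _).trans ?_
      rw [norm_mul, norm_mul, norm_phase, norm_phase]
      linarith
    calc _ ≤ (2 * ‖(𝓕 f : L2 d) η‖) ^ 2 := by gcongr
      _ = _ := by ring
  · exact ((Lp.memLp (𝓕 f : L2 d)).integrable_norm_pow (p := 2) (by norm_num)).const_mul 4
  · refine Filter.Eventually.of_forall fun η => ?_
    have hc : Continuous fun t : ℝ =>
        ‖phase P t η * (𝓕 f : L2 d) η - phase P t₀ η * (𝓕 f : L2 d) η‖ ^ 2 := by
      unfold phase; fun_prop
    simpa using hc.tendsto t₀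

theorem continuous_propagatorL2 :
    Continuous fun x : ℝ × L2 d => propagatorL2 hP x.1 x.2 := by
  rw [continuous_iff_continuousAt]
  rintro ⟨t₀, f₀⟩
  refine tendsto_iff_norm_sub_tendsto_zero.2 ?_
  have h1 : Filter.Tendsto (fun x : ℝ × L2 d => ‖x.2 - f₀‖ +
      ‖propagatorL2 hP x.1 f₀ - propagatorL2 hP t₀ f₀‖) (nhds (t₀, f₀)) (nhds 0) := by
    have hc : Continuous (fun x : ℝ × L2 d => ‖x.2 - f₀‖ +
      ‖propagatorL2 hP x.1 f₀ - propagatorL2 hP t₀ f₀‖) := by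
      have := (continuous_propagatorL2_apply hP f₀).comp (continuous_fst (X := ℝ) (Y := L2 d))
      exact ((continuous_snd.sub continuous_const).norm).add ((this.sub continuous_const).norm)
    simpa using hc.tendsto (t₀, f₀)
  refine squeeze_zero (fun _ => norm_nonneg _) (fun x => ?_) h1
  have : propagatorL2 hP x.1 x.2 - propagatorL2 hP t₀ f₀ =
    propagatorL2 hP x.1 (x.2 - f₀) + (propagatorL2 hP x.1 f₀ - propagatorL2 hP t₀ f₀) := by
    have := (propagatorL2ₗᵢ hP x.1).map_sub x.2 f₀
    change propagatorL2 hP x.1 (x.2 - f₀) = propagatorL2 hP x.1 x.2 - propagatorL2 hP x.1 f₀ at this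
    rw [this]; abel
  rw [this]
  exact (norm_add_le _ _).trans (by rw [norm_propagatorL2])

end propagator

/-! ### `H^s` and the weighted Fourier norms -/

namespace Hs

variable {d : ℕ} {s : ℝ} {P : Rd d → ℝ} (hP : Measurable P)

theorem toDistribution_injective : Function.Injective (toDistribution (d := d) (s := s)) :=
  Subtype.val_injective

theorem bessel_eq_iff {u : Hs d s} {f g : L2 d} (hf : u.toDistribution = f) :
    bessel d s u = g ↔
      (𝓕 g : L2 d) =ᵐ[volume] fun η => (sobolevWeight s η : ℂ) * (𝓕 f : L2 d) η := by
  rw [← besselPotential_L2_iff, ← hf, toDistribution_bessel]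
  exact ⟨fun h => by rw [h], fun h => L2.toDistribution_injective h⟩

theorem enorm_eq_sobolevNorm {u : Hs d s} {f : L2 d} (hf : u.toDistribution = f) :
    ‖u‖ₑ = sobolevNorm s f := by
  have h := (bessel_eq_iff hf).1 rfl
  rw [← ofReal_norm, norm_eq, ← Lp.norm_fourier_eq, ofReal_norm, Lp.enorm_def]
  exact eLpNorm_congr_ae h

theorem exists_toDistribution_eq {f : L2 d} (hf : sobolevNorm s f ≠ ∞) :
    ∃ u : Hs d s, u.toDistribution = f := by
  have hm : MemLp (fun η => (sobolevWeight s η : ℂ) * (𝓕 f : L2 d) η) 2 volume :=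
    ⟨aestronglyMeasurable_weight_mul s _, lt_top_iff_ne_top.2 hf⟩
  have h : besselPotential (Rd d) ℂ s (f : 𝓢'(Rd d, ℂ)) = (𝓕⁻ hm.toLp : L2 d) := by
    rw [besselPotential_L2_iff, fourier_fourierInv_eq]
    exact hm.coeFn_toLp
  exact ⟨⟨f, _, h⟩, rfl⟩

/-- The propagator on H^s is defined by conjugation with the Bessel potential. Fourier multipliers
commute, so on L² functions the result is the same for every order, including a negative k. -/
theorem toDistribution_propagator {u : Hs d s} {f : L2 d} (hf : u.toDistribution = f) (t : ℝ) :
    (propagator hP t u).toDistribution = propagatorL2 hP t f := by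
  have h1 : bessel d s (propagator hP t u) = propagatorL2 hP t (bessel d s u) := by
    simp [propagator]
  have hu := (bessel_eq_iff hf).1 rfl
  have h2 : besselPotential (Rd d) ℂ s (propagator hP t u).toDistribution =
      besselPotential (Rd d) ℂ s (propagatorL2 hP t f : 𝓢'(Rd d, ℂ)) := by
    rw [toDistribution_bessel, h1]
    symm
    rw [besselPotential_L2_iff]
    filter_upwards [fourier_propagatorL2 hP t f, fourier_propagatorL2 hP t (bessel d s u), hu]
      with η a1 a2 a3
    rw [a1, a2, a3]
    ring
  have := congrArg (besselPotential (Rd d) ℂ (-s)) h2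
  simpa using this

theorem exists_L2 (hs : 0 ≤ s) (u : Hs d s) : ∃ f : L2 d, u.toDistribution = f := by
  have h : MemSobolev 0 2 u.toDistribution := MemSobolev.mono hs u.2
  exact memSobolev_zero_iff.1 h

/-- The `L²` function underlying an element of `H^s`, for `s ≥ 0`. -/
def toL2 (hs : 0 ≤ s) : Hs d s →L[ℂ] L2 d :=
  LinearMap.mkContinuous
    { toFun := fun u => (exists_L2 hs u).choose
      map_add' := fun u v => L2.toDistribution_injective <| by
        rw [← (exists_L2 hs (u + v)).choose_spec, ← Lp.toTemperedDistributionCLM_apply, map_add,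
          map_add, Lp.toTemperedDistributionCLM_apply, Lp.toTemperedDistributionCLM_apply,
          ← (exists_L2 hs u).choose_spec, ← (exists_L2 hs v).choose_spec]
      map_smul' := fun c u => L2.toDistribution_injective <| by
        rw [← (exists_L2 hs (c • u)).choose_spec, ← Lp.toTemperedDistributionCLM_apply,
          map_smul, map_smul, Lp.toTemperedDistributionCLM_apply, RingHom.id_apply,
          ← (exists_L2 hs u).choose_spec] }
    1 fun u => by
      rw [one_mul]
      have h := sobolevNorm_mono hs (exists_L2 hs u).choose
      rw [← enorm_eq_sobolevNorm (exists_L2 hs u).choose_spec, sobolevNorm_zero,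
        ← ofReal_norm, ← ofReal_norm, ENNReal.ofReal_le_ofReal_iff (norm_nonneg _)] at h
      exact h

variable (hs : 0 ≤ s)

theorem toDistribution_eq_toL2 (u : Hs d s) : u.toDistribution = toL2 hs u :=
  (exists_L2 hs u).choose_spec

theorem toL2_eq_iff {u : Hs d s} {f : L2 d} : toL2 hs u = f ↔ u.toDistribution = f := by
  rw [toDistribution_eq_toL2 hs]
  exact ⟨fun h => by rw [h], fun h => L2.toDistribution_injective h⟩

theorem toL2_injective : Function.Injective (toL2 (d := d) hs) := fun u v h =>
  toDistribution_injective (by rw [toDistribution_eq_toL2 hs, toDistribution_eq_toL2 hs, h])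

theorem sobolevNorm_toL2 (u : Hs d s) : sobolevNorm s (toL2 hs u) = ‖u‖ₑ :=
  (enorm_eq_sobolevNorm (toDistribution_eq_toL2 hs u)).symm

theorem norm_toL2_le (u : Hs d s) : ‖toL2 hs u‖ ≤ ‖u‖ := by
  have h := sobolevNorm_mono hs (toL2 hs u)
  rwa [sobolevNorm_toL2, sobolevNorm_zero, ← ofReal_norm, ← ofReal_norm,
    ENNReal.ofReal_le_ofReal_iff (norm_nonneg _)] at h

theorem exists_toL2_eq {f : L2 d} (hf : sobolevNorm s f ≠ ∞) : ∃ u : Hs d s, toL2 hs u = f := by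
  obtain ⟨u, hu⟩ := exists_toDistribution_eq hf
  exact ⟨u, (toL2_eq_iff hs).2 hu⟩

theorem toL2_propagator (t : ℝ) (u : Hs d s) :
    toL2 hs (propagator hP t u) = propagatorL2 hP t (toL2 hs u) :=
  (toL2_eq_iff hs).2 (toDistribution_propagator hP (toDistribution_eq_toL2 hs u) t)

/-- `S(t)` on `H^s` as a linear isometry. -/
def propagatorₗᵢ (s t : ℝ) : Hs d s →ₗᵢ[ℂ] Hs d s :=
  ((besselIso d s).symm.toLinearIsometry.comp (propagatorL2ₗᵢ hP t)).comp
    (besselIso d s).toLinearIsometry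

theorem propagatorₗᵢ_apply (t : ℝ) (u : Hs d s) : propagatorₗᵢ hP s t u = propagator hP t u := rfl

theorem norm_propagator (t : ℝ) (u : Hs d s) : ‖propagator hP t u‖ = ‖u‖ :=
  (propagatorₗᵢ hP s t).norm_map u

theorem propagator_propagator (t t' : ℝ) (u : Hs d s) :
    propagator hP t (propagator hP t' u) = propagator hP (t + t') u := by
  simp [propagator, propagatorL2_propagatorL2]

theorem continuous_propagator :
    Continuous fun x : ℝ × Hs d s => propagator hP x.1 x.2 := by
  have h := (continuous_propagatorL2 hP).comp
    (continuous_fst.prodMk ((besselIso d s).continuous.comp continuous_snd) :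
      Continuous fun x : ℝ × Hs d s => (x.1, besselIso d s x.2))
  exact (besselIso d s).symm.continuous.comp h

instance : SecondCountableTopology (Hs d s) := by
  have : Fact ((2 : ℝ≥0∞) ≠ ∞) := ⟨by norm_num⟩
  exact (besselIso d s).toHomeomorph.isEmbedding.secondCountableTopology

instance : MeasurableSpace (Hs d s) := borel _

instance : BorelSpace (Hs d s) := ⟨rfl⟩

instance : MeasurableSpace (L2 d) := borel _

instance : BorelSpace (L2 d) := ⟨rfl⟩

/-- A continuous injection between Polish spaces is a Borel embedding (Lusin–Souslin). Measurability
with values in H^s can then be checked in L². -/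
theorem measurableEmbedding_toL2 : MeasurableEmbedding (toL2 (d := d) hs) := by
  have : Fact ((2 : ℝ≥0∞) ≠ ∞) := ⟨by norm_num⟩
  exact (toL2 hs).continuous.measurableEmbedding (toL2_injective hs)

/-- An `H^s`-valued function is strongly measurable if it is so as an `L²`-valued function. -/
theorem aestronglyMeasurable_of_toL2 {α : Type*} [MeasurableSpace α] {μ : Measure α}
    {g : α → Hs d s} (h : AEStronglyMeasurable (fun x => toL2 hs (g x)) μ) :
    AEStronglyMeasurable g μ := by
  have h1 : AEMeasurable g μ :=
    (measurableEmbedding_toL2 hs).aemeasurable_comp_iff.1 h.aemeasurable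
  exact h1.aestronglyMeasurable

end Hs

/-! ### The Strichartz estimate for L² data -/

section

variable {d : ℕ} {P : Rd d → ℝ} (hP : Measurable P)

/-- The Strichartz estimate, in terms of `L²` functions. -/
theorem StrichartzEstimate.le_of_L2 {p q : ℝ≥0∞} {k T₀ C : ℝ} (h : StrichartzEstimate hP p q k T₀ C)
    (hC : 0 ≤ C) (f : L2 d) (hf : sobolevNorm k f ≠ ∞) :
    eLpNorm (fun t : ℝ => eLpNorm (propagatorL2 hP t f) q volume) p (volume.restrict (Icc 0 T₀)) ≤
      ENNReal.ofReal C * sobolevNorm k f := by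
  obtain ⟨u, hu⟩ := Hs.exists_toDistribution_eq hf
  have := h u
  simp_rw [Hs.toDistribution_propagator hP hu, lqNorm_L2] at this
  rwa [ENNReal.ofReal_mul hC, ofReal_norm, Hs.enorm_eq_sobolevNorm hu] at this

end

/-! ### Smooth frequency cutoffs -/

section cutoff

variable {d : ℕ}

/-- A smooth bump function equal to `1` on the unit ball and supported in the ball of radius `2`. -/
def unitBump (d : ℕ) : ContDiffBump (0 : Rd d) := ⟨1, 2, one_pos, one_lt_two⟩

/-- The cutoff `χ(2^{-n} η)`. -/
def cutoff (n : ℕ) (η : Rd d) : ℝ := unitBump d (((2 : ℝ) ^ n)⁻¹ • η)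

theorem cutoff_nonneg (n : ℕ) (η : Rd d) : 0 ≤ cutoff n η := (unitBump d).nonneg

theorem cutoff_le_one (n : ℕ) (η : Rd d) : cutoff n η ≤ 1 := (unitBump d).le_one

theorem cutoff_eq_one {n : ℕ} {η : Rd d} (h : ‖η‖ ≤ 2 ^ n) : cutoff n η = 1 := by
  refine (unitBump d).one_of_mem_closedBall ?_
  rw [mem_closedBall_zero_iff, norm_smul, norm_inv, norm_pow, Real.norm_ofNat]
  change _ ≤ (1 : ℝ)
  rw [inv_mul_le_iff₀ (by positivity)]
  linarith

theorem cutoff_eq_zero {n : ℕ} {η : Rd d} (h : 2 ^ (n + 1) ≤ ‖η‖) : cutoff n η = 0 := by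
  refine (unitBump d).zero_of_le_dist ?_
  rw [dist_zero_right, norm_smul, norm_inv, norm_pow, Real.norm_ofNat]
  change (2 : ℝ) ≤ _
  rw [le_inv_mul_iff₀ (by positivity), ← pow_succ]
  exact h

theorem norm_cutoff_le_one (n : ℕ) (η : Rd d) : ‖(cutoff n η : ℂ)‖ ≤ 1 := by
  rw [Complex.norm_real, Real.norm_of_nonneg (cutoff_nonneg n η)]
  exact cutoff_le_one n η

theorem contDiff_cutoff (n : ℕ) : ContDiff ℝ (⊤ : ℕ∞) (cutoff (d := d) n) :=
  (unitBump d).contDiff.comp (contDiff_const_smul _)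

theorem continuous_cutoff (n : ℕ) : Continuous (cutoff (d := d) n) := (contDiff_cutoff n).continuous

theorem hasCompactSupport_cutoff (n : ℕ) : HasCompactSupport (cutoff (d := d) n) := by
  refine HasCompactSupport.of_support_subset_isCompact
    (isCompact_closedBall (0 : Rd d) (2 ^ (n + 1))) ?_
  intro η hη
  rw [mem_closedBall_zero_iff]
  by_contra h
  exact hη (cutoff_eq_zero (not_le.1 h).le)

theorem cutoff_memLp (n : ℕ) : MemLp (fun η : Rd d => (cutoff n η : ℂ)) ∞ volume :=
  memLp_top_of_bound (Complex.continuous_ofReal.comp (continuous_cutoff n)).aestronglyMeasurable 1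
    (Filter.Eventually.of_forall (norm_cutoff_le_one n))

/-- The low frequency part of `f`, with Fourier transform `χ(2^{-n} η) 𝓕f(η)`. -/
def lowFreq (n : ℕ) (f : L2 d) : L2 d := 
  𝓕⁻ ((cutoff_memLp (d := d) n).toLp (fun η => (cutoff n η : ℂ)) • 𝓕 f : L2 d)

theorem fourier_lowFreq (n : ℕ) (f : L2 d) :
    (𝓕 (lowFreq n f) : L2 d) =ᵐ[volume] fun η => (cutoff n η : ℂ) * (𝓕 f : L2 d) η := by
  unfold lowFreq
  rw [fourier_fourierInv_eq]
  filter_upwards [Lp.coeFn_lpSMul (r := 2) ((cutoff_memLp (d := d) n).toLp (fun η => (cutoff n η : ℂ))) (𝓕 f : L2 d),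
    (cutoff_memLp (d := d) n).coeFn_toLp] with η h1 h2
  simp [h1, h2]

theorem fourier_sub_ae (f g : L2 d) : (𝓕 (f - g) : L2 d) =ᵐ[volume]
    fun η => (𝓕 f : L2 d) η - (𝓕 g : L2 d) η := by
  have h : (𝓕 (f - g) : L2 d) = 𝓕 f - 𝓕 g := (Lp.fourierTransformₗᵢ (Rd d) ℂ).map_sub f g
  rw [h]
  exact Lp.coeFn_sub _ _

theorem lowFreq_sub (n : ℕ) (f g : L2 d) : lowFreq n (f - g) = lowFreq n f - lowFreq n g := by
  refine L2.ext_fourier ?_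
  filter_upwards [fourier_lowFreq n (f - g), fourier_lowFreq n f, fourier_lowFreq n g,
    fourier_sub_ae f g, fourier_sub_ae (lowFreq n f) (lowFreq n g)] with η h1 h2 h3 h4 h5
  rw [h1, h5, h4, h2, h3]
  ring

theorem lowFreq_propagatorL2 {P : Rd d → ℝ} (hP : Measurable P) (n : ℕ) (t : ℝ) (f : L2 d) :
    lowFreq n (propagatorL2 hP t f) = propagatorL2 hP t (lowFreq n f) := by
  refine L2.ext_fourier ?_
  filter_upwards [fourier_lowFreq n (propagatorL2 hP t f), fourier_lowFreq n f,
    fourier_propagatorL2 hP t f, fourier_propagatorL2 hP t (lowFreq n f)] with η h1 h2 h3 h4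
  rw [h1, h4, h3, h2]
  ring

/-- The derivative symbol `2πi ⟨η, e⟩`. -/
def derivSymbol (e η : Rd d) : ℂ := 2 * Real.pi * Complex.I * (inner ℝ η e : ℝ)

theorem continuous_derivSymbol (e : Rd d) : Continuous (derivSymbol e) := by
  unfold derivSymbol; fun_prop

/-- The Fourier transform of the `j`-th derivative in the direction `e` of the low frequency part
of `f`. -/
def lowFreqSymbol (n : ℕ) (e : Rd d) (f : L2 d) (j : ℕ) (η : Rd d) : ℂ :=
  derivSymbol e η ^ j * ((cutoff n η : ℂ) * (𝓕 f : L2 d) η)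

/-- The `j`-th derivative in the direction `e` of the smooth function `lowFreq n f`. -/
def lowFreqDeriv (n : ℕ) (e : Rd d) (f : L2 d) (j : ℕ) : Rd d → ℂ :=
  𝓕⁻ (lowFreqSymbol n e f j)

/-- The factor in front of 𝓕f is continuous with compact support, hence lies both in L² and in L^∞.
Membership in L¹ gives a pointwise inversion formula, membership in L² gives Plancherel. -/
theorem memLp_lowFreqSymbol (n : ℕ) (e : Rd d) (f : L2 d) (j : ℕ) {p : ℝ≥0∞}
    (hp : p = 1 ∨ p = 2) : MemLp (lowFreqSymbol n e f j) p volume := by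
  have hc : Continuous fun η : Rd d => derivSymbol e η ^ j * (cutoff n η : ℂ) :=
    ((continuous_derivSymbol e).pow j).mul (Complex.continuous_ofReal.comp (continuous_cutoff n))
  have hs : HasCompactSupport fun η : Rd d => derivSymbol e η ^ j * (cutoff n η : ℂ) :=
    HasCompactSupport.mul_left ((hasCompactSupport_cutoff n).comp_left Complex.ofReal_zero)
  have e1 : lowFreqSymbol n e f j =
      (fun η : Rd d => derivSymbol e η ^ j * (cutoff n η : ℂ)) * ⇑(𝓕 f : L2 d) := by
    ext η
    simp [lowFreqSymbol, mul_assoc]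
  rw [e1]
  rcases hp with rfl | rfl
  · exact MemLp.mul (Lp.memLp (𝓕 f : L2 d)) (hc.memLp_of_hasCompactSupport hs (p := 2))
  · exact MemLp.mul (Lp.memLp (𝓕 f : L2 d)) (hc.memLp_of_hasCompactSupport hs (p := ∞))

theorem integrable_lowFreqSymbol (n : ℕ) (e : Rd d) (f : L2 d) (j : ℕ) :
    Integrable (lowFreqSymbol n e f j) :=
  memLp_one_iff_integrable.1 (memLp_lowFreqSymbol n e f j (Or.inl rfl))

theorem continuous_fourierInv {g : Rd d → ℂ} (hg : Integrable g) : Continuous (𝓕⁻ g) := by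
  rw [Real.fourierInv_eq_fourier_comp_neg]
  exact VectorFourier.fourierIntegral_continuous Real.continuous_fourierChar
    (by exact continuous_inner) hg.comp_neg

theorem norm_fourierInv_le (g : Rd d → ℂ) (x : Rd d) : ‖𝓕⁻ g x‖ ≤ ∫ η, ‖g η‖ := by
  rw [Real.fourierInv_eq]
  refine (norm_integral_le_integral_norm _).trans (le_of_eq ?_)
  simp

/-- The two inverse Fourier transforms on `L¹ ∩ L²` agree. -/
theorem fourierInv_toLp_ae_eq {g : Rd d → ℂ} (h1 : Integrable g) (h2 : MemLp g 2 volume) :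
    (𝓕⁻ h2.toLp : L2 d) =ᵐ[volume] 𝓕⁻ g := by
  refine isFunction_L2_iff.1 fun φ => ⟨?_, ?_⟩
  · refine (φ.integrable (μ := volume)).mul_bdd (c := ∫ η, ‖g η‖)
      (continuous_fourierInv h1).aestronglyMeasurable
      (Filter.Eventually.of_forall (norm_fourierInv_le g))
  · rw [← Lp.fourierInv_toTemperedDistribution_eq, TemperedDistribution.fourierInv_apply,
      Lp.toTemperedDistribution_apply]
    -- The inverse transform is the Fourier integral for the pairing `-innerₗ`, which is symmetric;
    -- Fubini moves it from φ to g.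
    have h3 := VectorFourier.integral_fourierIntegral_smul_eq_flip (L := -innerₗ (Rd d))
      (μ := volume) (ν := volume) (f := φ) (g := g) Real.continuous_fourierChar
      (by
        have : Continuous fun p : Rd d × Rd d => -(inner ℝ p.1 p.2 : ℝ) := by fun_prop
        exact this) φ.integrable h1
    have hflip : (-innerₗ (Rd d)).flip = -innerₗ (Rd d) := by
      ext x y
      simp [real_inner_comm]
    rw [hflip] at h3
    have h4 : ∫ x, (𝓕⁻ φ : 𝓢(Rd d, ℂ)) x • (h2.toLp g) x =∫ x, (𝓕⁻ (φ : Rd d → ℂ)) x • g x := by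
      refine integral_congr_ae ?_
      filter_upwards [h2.coeFn_toLp] with x hx
      rw [hx, SchwartzMap.fourierInv_coe]
    rw [h4]
    exact h3

theorem toLp_lowFreqSymbol_zero (n : ℕ) (e : Rd d) (f : L2 d) :
    (memLp_lowFreqSymbol n e f 0 (Or.inr rfl)).toLp = (𝓕 (lowFreq n f) : L2 d) := by
  refine Lp.ext ((memLp_lowFreqSymbol n e f 0 (Or.inr rfl)).coeFn_toLp.trans ?_)
  filter_upwards [fourier_lowFreq n f] with η h
  simp [h, lowFreqSymbol]

theorem lowFreq_ae_eq (n : ℕ) (e : Rd d) (f : L2 d) :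
    lowFreq n f =ᵐ[volume] lowFreqDeriv n e f 0 := by
  have := fourierInv_toLp_ae_eq (integrable_lowFreqSymbol n e f 0)
    (memLp_lowFreqSymbol n e f 0 (Or.inr rfl))
  rwa [toLp_lowFreqSymbol_zero, fourierInv_fourier_eq] at this

theorem memLp_lowFreqDeriv (n : ℕ) (e : Rd d) (f : L2 d) (j : ℕ) :
    MemLp (lowFreqDeriv n e f j) 2 volume :=
  (Lp.memLp _).ae_eq (fourierInv_toLp_ae_eq (integrable_lowFreqSymbol n e f j)
    (memLp_lowFreqSymbol n e f j (Or.inr rfl)))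

theorem eLpNorm_lowFreqDeriv (n : ℕ) (e : Rd d) (f : L2 d) (j : ℕ) :
    eLpNorm (lowFreqDeriv n e f j) 2 volume = eLpNorm (lowFreqSymbol n e f j) 2 volume := by
  have h := memLp_lowFreqSymbol n e f j (Or.inr rfl)
  rw [lowFreqDeriv, ← eLpNorm_congr_ae (fourierInv_toLp_ae_eq (integrable_lowFreqSymbol n e f j) h),
    ← eLpNorm_congr_ae h.coeFn_toLp, ← Lp.enorm_def, ← Lp.enorm_def, ← ofReal_norm, ← ofReal_norm]
  congr 1
  rw [← Lp.norm_fourier_eq, fourier_fourierInv_eq]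

theorem continuous_lowFreqDeriv (n : ℕ) (e : Rd d) (f : L2 d) (j : ℕ) :
    Continuous (lowFreqDeriv n e f j) := continuous_fourierInv (integrable_lowFreqSymbol n e f j)

theorem norm_lowFreqDeriv_le (n : ℕ) (e : Rd d) (f : L2 d) (j : ℕ) (x : Rd d) :
    ‖lowFreqDeriv n e f j x‖ ≤ ∫ η, ‖lowFreqSymbol n e f j η‖ := norm_fourierInv_le _ x

theorem lowFreqDeriv_sub (n : ℕ) (e : Rd d) (f g : L2 d) (j : ℕ) (x : Rd d) :
    lowFreqDeriv n e (f - g) j x = lowFreqDeriv n e f j x - lowFreqDeriv n e g j x := by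
  unfold lowFreqDeriv
  have h : lowFreqSymbol n e (f - g) j =ᵐ[volume] lowFreqSymbol n e f j - lowFreqSymbol n e g j := by
    filter_upwards [fourier_sub_ae f g] with η h
    simp only [lowFreqSymbol, h, Pi.sub_apply]
    ring
  rw [Real.fourierInv_congr_ae h, Real.fourierInv_eq, Real.fourierInv_eq, Real.fourierInv_eq,
    ← integral_sub]
  · simp [smul_sub]
  · simpa using (Real.fourierIntegral_convergent_iff (-x)).2 (integrable_lowFreqSymbol n e f j)
  · simpa using (Real.fourierIntegral_convergent_iff (-x)).2 (integrable_lowFreqSymbol n e g j)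

theorem integrable_fourierChar_smul {g : Rd d → ℂ} (hg : Integrable g) (y : Rd d) :
    Integrable fun η => Real.fourierChar (inner ℝ η y : ℝ) • g η := by
  have := (Real.fourierIntegral_convergent_iff (-y)).2 hg
  simpa only [inner_neg_right, neg_neg] using this

/-- Differentiation under the integral sign: the character has modulus 1, so the modulus of
`derivSymbol e η * g η` dominates for all t at once. -/
theorem fourierInv_hasLineDerivAt {g : Rd d → ℂ} (e : Rd d) (hg : Integrable g)
    (hg' : Integrable fun η => derivSymbol e η * g η) (x : Rd d) :
    HasLineDerivAt ℝ (𝓕⁻ g) (𝓕⁻ (fun η => derivSymbol e η * g η) x) x e := by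
  unfold HasLineDerivAt
  have h2 : 𝓕⁻ (fun η => derivSymbol e η * g η) x =
      ∫ η, Real.fourierChar (inner ℝ η (x + (0 : ℝ) • e) : ℝ) • (derivSymbol e η * g η) := by
    rw [zero_smul, add_zero]
    exact Real.fourierInv_eq _ _
  have h1 : (fun t : ℝ => 𝓕⁻ g (x + t • e)) = fun t : ℝ =>
      ∫ η, Real.fourierChar (inner ℝ η (x + t • e) : ℝ) • g η :=
    funext fun t => Real.fourierInv_eq _ _
  rw [h1, h2]
  refine (hasDerivAt_integral_of_dominated_loc_of_deriv_le (𝕜 := ℝ) (μ := volume) (x₀ := (0 : ℝ))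
    (F := fun t η => Real.fourierChar (inner ℝ η (x + t • e) : ℝ) • g η)
    (F' := fun t η => Real.fourierChar (inner ℝ η (x + t • e) : ℝ) • (derivSymbol e η * g η))
    (bound := fun η => ‖derivSymbol e η * g η‖) (s := univ) Filter.univ_mem
    (Filter.Eventually.of_forall fun t => (integrable_fourierChar_smul hg _).1)
    (integrable_fourierChar_smul hg _) (integrable_fourierChar_smul hg' _).1 ?_
    hg'.norm ?_).2
  · refine Filter.Eventually.of_forall fun η t _ => ?_
    rw [Circle.norm_smul]
  · refine Filter.Eventually.of_forall fun η t _ => ?_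
    have hin : HasDerivAt (fun t : ℝ => (inner ℝ η (x + t • e) : ℝ)) (inner ℝ η e) t := by
      simp only [inner_add_right, inner_smul_right]
      simpa using ((hasDerivAt_id t).mul_const (inner ℝ η e : ℝ)).const_add (inner ℝ η x : ℝ)
    have := ((Real.hasDerivAt_fourierChar (inner ℝ η (x + t • e))).scomp t hin).mul_const (g η)
    refine this.congr_deriv ?_
    simp only [derivSymbol, Circle.smul_def, smul_eq_mul, Complex.real_smul]
    ring

theorem lowFreqDeriv_hasLineDerivAt (n : ℕ) (e : Rd d) (f : L2 d) (j : ℕ) (x : Rd d) :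
    HasLineDerivAt ℝ (lowFreqDeriv n e f j) (lowFreqDeriv n e f (j + 1) x) x e := by
  have h : lowFreqSymbol n e f (j + 1) = fun η => derivSymbol e η * lowFreqSymbol n e f j η := by
    ext η
    simp only [lowFreqSymbol, pow_succ]
    ring
  have := fourierInv_hasLineDerivAt e (integrable_lowFreqSymbol n e f j)
    (h ▸ integrable_lowFreqSymbol n e f (j + 1)) x
  rwa [← h] at this

/-! ### The convolution kernel of the cutoff -/

/-- The convolution kernel of `lowFreq n`. -/
def cutoffKernel (d n : ℕ) : Rd d → ℂ := 𝓕⁻ fun η : Rd d => (cutoff n η : ℂ)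

theorem exists_schwartz_cutoffKernel (d n : ℕ) : ∃ φ : 𝓢(Rd d, ℂ), cutoffKernel d n = φ := by
  have h₁ : HasCompactSupport (fun η : Rd d => (cutoff n η : ℂ)) :=
    (hasCompactSupport_cutoff n).comp_left Complex.ofReal_zero
  have h₂ : ContDiff ℝ (⊤ : ℕ∞) (fun η : Rd d => (cutoff n η : ℂ)) :=
    Complex.ofRealCLM.contDiff.comp (contDiff_cutoff n)
  exact ⟨𝓕⁻ (h₁.toSchwartzMap h₂), by rw [SchwartzMap.fourierInv_coe]; rfl⟩

theorem memLp_cutoffKernel (d n : ℕ) (p : ℝ≥0∞) : MemLp (cutoffKernel d n) p volume := by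
  obtain ⟨φ, hφ⟩ := exists_schwartz_cutoffKernel d n
  rw [hφ]
  exact φ.memLp p volume

theorem cutoffKernel_eq (d n : ℕ) (x : Rd d) :
    cutoffKernel d n x = (2 : ℂ) ^ (n * d) * cutoffKernel d 0 ((2 : ℝ) ^ n • x) := by
  unfold cutoffKernel
  rw [Real.fourierInv_eq, Real.fourierInv_eq]
  have h := Measure.integral_comp_smul (volume : Measure (Rd d))
    (fun η : Rd d => Real.fourierChar (inner ℝ η ((2 : ℝ) ^ n • x) : ℝ) • (cutoff 0 η : ℂ))
    (((2 : ℝ) ^ n)⁻¹)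
  have e : ∀ η : Rd d, Real.fourierChar (inner ℝ (((2 : ℝ) ^ n)⁻¹ • η) ((2 : ℝ) ^ n • x) : ℝ) •
      (cutoff 0 (((2 : ℝ) ^ n)⁻¹ • η) : ℂ) = Real.fourierChar (inner ℝ η x : ℝ) •
      (cutoff n η : ℂ) := by
    intro η
    congr 2
    · rw [real_inner_smul_left, real_inner_smul_right, ← mul_assoc, inv_mul_cancel₀ (by positivity),
        one_mul]
    · simp [cutoff]
  simp only [e] at h
  rw [h, finrank_euclideanSpace_fin, Complex.real_smul]
  congr 1
  rw [abs_of_nonneg (by positivity), inv_pow, inv_inv, pow_mul]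
  push_cast
  rfl

/-- The value at x is the pairing of 𝓕f with the Schwartz function e^{2πi⟨η,x⟩} χ(2^{-n}η), whose
Fourier transform is y ↦ K(x - y). Moving the transform onto this function avoids Fubini for f,
which is only in L². -/
theorem lowFreqDeriv_zero_eq_convolution (n : ℕ) (e : Rd d) (f : L2 d) (x : Rd d) :
    lowFreqDeriv n e f 0 x = ∫ y, cutoffKernel d n (x - y) * f y := by
  set g : Rd d → ℂ := fun η => Complex.exp (2 * Real.pi * Complex.I * (inner ℝ η x : ℝ)) *
    (cutoff n η : ℂ) with hg
  have h₁ : HasCompactSupport g :=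
    HasCompactSupport.mul_left ((hasCompactSupport_cutoff n).comp_left Complex.ofReal_zero)
  have h₂ : ContDiff ℝ (⊤ : ℕ∞) g := by
    refine ContDiff.mul ?_ (Complex.ofRealCLM.contDiff.comp (contDiff_cutoff n))
    refine ContDiff.cexp (contDiff_const.mul ?_)
    exact Complex.ofRealCLM.contDiff.comp (contDiff_id.inner ℝ contDiff_const)
  have e1 : lowFreqDeriv n e f 0 x = ∫ η, h₁.toSchwartzMap h₂ η * (𝓕 f : L2 d) η := by
    rw [lowFreqDeriv, Real.fourierInv_eq]
    refine integral_congr_ae (Filter.Eventually.of_forall fun η => ?_)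
    simp only [lowFreqSymbol, HasCompactSupport.toSchwartzMap_toFun, hg, Circle.smul_def,
      Real.fourierChar_apply, smul_eq_mul, pow_zero, one_mul]
    push_cast
    ring_nf
  have e2 := (IsFunction.of_L2 (𝓕 f : L2 d) (h₁.toSchwartzMap h₂)).2
  rw [← Lp.fourier_toTemperedDistribution_eq, TemperedDistribution.fourier_apply,
    (IsFunction.of_L2 f _).2] at e2
  rw [e1, ← e2]
  refine integral_congr_ae (Filter.Eventually.of_forall fun y => ?_)
  dsimp only
  congr 1
  rw [SchwartzMap.fourier_coe, Real.fourier_eq, cutoffKernel, Real.fourierInv_eq]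
  refine integral_congr_ae (Filter.Eventually.of_forall fun η => ?_)
  simp only [HasCompactSupport.toSchwartzMap_toFun, hg, Circle.smul_def,
      Real.fourierChar_apply, smul_eq_mul, inner_sub_right]
  rw [← mul_assoc, ← Complex.exp_add]
  push_cast
  ring_nf

/-- Scaling gives the exponent of Bernstein's inequality: for the conjugate exponent q' of q one has
1 - 1/q' = 1/q, so passing from L^q to L^∞ costs d/q derivatives. -/
theorem eLpNorm_cutoffKernel (d n : ℕ) {p : ℝ≥0∞} (hp : p ≠ ∞) :
    eLpNorm (cutoffKernel d n) p volume =
      ENNReal.ofReal (2 ^ (n * d * (1 - p.toReal⁻¹))) * eLpNorm (cutoffKernel d 0) p volume := by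
  have h1 : cutoffKernel d n = (2 : ℂ) ^ (n * d) • fun x => cutoffKernel d 0 ((2 : ℝ) ^ n • x) := by
    ext x
    exact cutoffKernel_eq d n x
  have hc : Continuous (cutoffKernel d 0) := by
    obtain ⟨φ, hφ⟩ := exists_schwartz_cutoffKernel d 0
    rw [hφ]
    exact φ.continuous
  have h2 := eLpNorm_map_measure (p := p) (μ := (volume : Measure (Rd d)))
    (f := fun x : Rd d => (2 : ℝ) ^ n • x) (g := cutoffKernel d 0)
    hc.aestronglyMeasurable (by fun_prop)
  rw [Measure.map_addHaar_smul _ (by positivity), eLpNorm_smul_measure_of_ne_top hp,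
    finrank_euclideanSpace_fin] at h2
  rw [h1, eLpNorm_const_smul]
  change _ * eLpNorm (cutoffKernel d 0 ∘ fun x : Rd d => (2 : ℝ) ^ n • x) p volume = _
  rw [← h2, smul_eq_mul, ← mul_assoc]
  congr 1
  rw [← ofReal_norm, norm_pow, Complex.norm_ofNat, ENNReal.ofReal_rpow_of_pos (by positivity),
    ← ENNReal.ofReal_mul (by positivity)]
  congr 1
  rw [abs_of_pos (by positivity), ← pow_mul, Real.inv_rpow (by positivity),
    ← Real.rpow_natCast 2 (n * d), ← Real.rpow_mul (by norm_num), ← Real.rpow_neg (by norm_num),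
    ← Real.rpow_add (by norm_num)]
  congr 1
  simp
  ring

/-- Bernstein's inequality for the low frequency part. -/
theorem enorm_lowFreqDeriv_zero_le (n : ℕ) (e : Rd d) (f : L2 d) (x : Rd d) {q q' : ℝ≥0∞}
    [ENNReal.HolderConjugate q' q] :
    ‖lowFreqDeriv n e f 0 x‖ₑ ≤ eLpNorm (cutoffKernel d n) q' volume * eLpNorm f q volume := by
  rw [lowFreqDeriv_zero_eq_convolution]
  refine (enorm_integral_le_lintegral_enorm _).trans ?_
  rw [← eLpNorm_one_eq_lintegral_enorm]
  have hmp : MeasurePreserving (fun y : Rd d => x - y) volume volume :=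
    Measure.measurePreserving_sub_left volume x
  have hK := (memLp_cutoffKernel d n q').1
  have h1 : AEStronglyMeasurable (fun y => cutoffKernel d n (x - y)) volume :=
    hK.comp_measurePreserving hmp
  have := eLpNorm_smul_le_mul_eLpNorm (p := q') (q := q) (r := 1) (Lp.aestronglyMeasurable f) h1
  refine this.trans (le_of_eq ?_)
  congr 1
  exact eLpNorm_comp_measurePreserving hK hmp

end cutoff

/-! ### Lebesgue norms on `L²` -/

section lebesgue

variable {d : ℕ}

/-- Fatou's lemma along an almost everywhere convergent subsequence. It makes the L^q norm lower
semicontinuous, hence Borel, on all of L², including where it is infinite. -/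
theorem isClosed_setOf_eLpNorm_le (q c : ℝ≥0∞) :
    IsClosed {f : L2 d | eLpNorm f q volume ≤ c} := by
  refine isClosed_iff_clusterPt.2 fun f hf => ?_
  rw [← mem_closure_iff_clusterPt, mem_closure_iff_seq_limit] at hf
  obtain ⟨u, hu, hlim⟩ := hf
  obtain ⟨ns, -, hns⟩ := (tendstoInMeasure_of_tendsto_Lp hlim).exists_seq_tendsto_ae
  refine (Lp.eLpNorm_lim_le_liminf_eLpNorm
    (fun n => Lp.aestronglyMeasurable (u (ns n))) f hns).trans ?_
  refine liminf_le_of_le (by isBoundedDefault) fun b hb => ?_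
  obtain ⟨n, hn⟩ := hb.exists
  exact hn.trans (hu (ns n))

theorem lowerSemicontinuous_eLpNorm_L2 (q : ℝ≥0∞) :
    LowerSemicontinuous fun f : L2 d => eLpNorm f q volume :=
  lowerSemicontinuous_iff_isClosed_preimage.2 fun c => isClosed_setOf_eLpNorm_le q c

theorem measurable_eLpNorm_L2 (q : ℝ≥0∞) : Measurable fun f : L2 d => eLpNorm f q volume :=
  (lowerSemicontinuous_eLpNorm_L2 q).measurable

theorem eLpNorm_L2_le_liminf (q : ℝ≥0∞) {u : ℕ → L2 d} {f : L2 d} (h : Tendsto u atTop (𝓝 f)) :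
    eLpNorm f q volume ≤ liminf (fun n => eLpNorm (u n) q volume) atTop := by
  have h1 := lowerSemicontinuousAt_iff_le_liminf.1 (lowerSemicontinuous_eLpNorm_L2 q f)
  exact h1.trans (liminf_le_liminf_of_le h)

theorem enorm_sq_eq_lintegral_fourier (f : L2 d) : ‖f‖ₑ ^ 2 = ∫⁻ η, ‖(𝓕 f : L2 d) η‖ₑ ^ 2 := by
  have := sobolevNorm_sq 0 f
  simpa [sobolevNorm_zero, sobolevWeight_zero] using this

theorem tendsto_lowFreq (f : L2 d) : Tendsto (fun n => lowFreq n f) atTop (𝓝 f) := by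
  rw [tendsto_iff_edist_tendsto_0]
  have h1 : ∀ n, edist (lowFreq n f) f =
      (∫⁻ η, ‖((cutoff n η - 1 : ℝ) : ℂ) * (𝓕 f : L2 d) η‖ₑ ^ 2) ^ (1 / 2 : ℝ) := by
    intro n
    have h2 : ∫⁻ η, ‖((cutoff n η - 1 : ℝ) : ℂ) * (𝓕 f : L2 d) η‖ₑ ^ 2 =
        ‖lowFreq n f - f‖ₑ ^ 2 := by
      rw [enorm_sq_eq_lintegral_fourier]
      refine lintegral_congr_ae ?_
      filter_upwards [fourier_sub_ae (lowFreq n f) f, fourier_lowFreq n f] with η h1 h2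
      rw [h1, h2]
      push_cast
      ring_nf
    rw [h2, edist_eq_enorm_sub, ← ENNReal.rpow_natCast, ← ENNReal.rpow_mul]
    norm_num
  simp_rw [h1]
  have h0 : (0 : ℝ≥0∞) = (∫⁻ _ : Rd d, 0) ^ (1 / 2 : ℝ) := by simp
  rw [h0]
  refine Tendsto.ennrpow_const _ ?_
  refine tendsto_lintegral_of_dominated_convergence' (fun η => ‖(𝓕 f : L2 d) η‖ₑ ^ 2) ?_ ?_ ?_ ?_
  · intro n
    refine AEMeasurable.pow_const (AEStronglyMeasurable.enorm ?_) 2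
    exact (Complex.continuous_ofReal.comp
      ((continuous_cutoff n).sub continuous_const)).aestronglyMeasurable.mul
      (Lp.aestronglyMeasurable _)
  · intro n
    refine Eventually.of_forall fun η => ?_
    dsimp only
    gcongr
    rw [enorm_mul, ← ofReal_norm, Complex.norm_real, Real.norm_eq_abs]
    refine mul_le_of_le_one_left' ?_
    rw [ENNReal.ofReal_le_one, abs_le]
    constructor <;> linarith [cutoff_nonneg n η, cutoff_le_one n η]
  · rw [← enorm_sq_eq_lintegral_fourier]
    exact ENNReal.pow_ne_top enorm_ne_top
  · refine Eventually.of_forall fun η => ?_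
    refine tendsto_const_nhds.congr' ?_
    obtain ⟨N, hN⟩ := pow_unbounded_of_one_lt ‖η‖ (one_lt_two : (1 : ℝ) < 2)
    filter_upwards [eventually_ge_atTop N] with n hn
    rw [cutoff_eq_one (hN.le.trans (by gcongr; norm_num))]
    simp

theorem eLpNorm_L2_add_le (q : ℝ≥0∞) (hq : 1 ≤ q) (f g : L2 d) :
    eLpNorm (f + g : L2 d) q volume ≤ eLpNorm f q volume + eLpNorm g q volume := by
  rw [eLpNorm_congr_ae (Lp.coeFn_add f g)]
  exact eLpNorm_add_le (Lp.aestronglyMeasurable f) (Lp.aestronglyMeasurable g) hq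

theorem eLpNorm_L2_sub_le (q : ℝ≥0∞) (hq : 1 ≤ q) (f g : L2 d) :
    eLpNorm (f - g : L2 d) q volume ≤ eLpNorm f q volume + eLpNorm g q volume := by
  rw [eLpNorm_congr_ae (Lp.coeFn_sub f g)]
  exact eLpNorm_sub_le (Lp.aestronglyMeasurable f) (Lp.aestronglyMeasurable g) hq

theorem eLpNorm_lowFreq_top_le (n : ℕ) (f : L2 d) {q q' : ℝ≥0∞}
    [ENNReal.HolderConjugate q' q] :
    eLpNorm (lowFreq n f) ∞ volume ≤ eLpNorm (cutoffKernel d n) q' volume * eLpNorm f q volume := by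
  rw [eLpNorm_congr_ae (lowFreq_ae_eq n 0 f), eLpNorm_exponent_top]
  exact eLpNormEssSup_le_of_ae_enorm_bound
    (Eventually.of_forall fun x => enorm_lowFreqDeriv_zero_le n 0 f x)

/-- A dyadic frequency block of `f`. -/
def freqBlock (n : ℕ) (f : L2 d) : L2 d := lowFreq (n + 1) f - lowFreq n f

theorem fourier_freqBlock (n : ℕ) (f : L2 d) : (𝓕 (freqBlock n f) : L2 d) =ᵐ[volume]
    fun η => ((cutoff (n + 1) η - cutoff n η : ℝ) : ℂ) * (𝓕 f : L2 d) η := by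
  filter_upwards [fourier_sub_ae (lowFreq (n + 1) f) (lowFreq n f), fourier_lowFreq n f,
    fourier_lowFreq (n + 1) f] with η h1 h2 h3
  rw [freqBlock, h1, h2, h3]
  push_cast
  ring

/-- A block vanishes for |η| ≥ 2^{n+2}, and the cutoff of index n + 2 equals 1 on the ball of that
radius. Bernstein's inequality can thus be applied to the block itself. -/
theorem lowFreq_freqBlock (n : ℕ) (f : L2 d) : lowFreq (n + 2) (freqBlock n f) = freqBlock n f := by
  refine L2.ext_fourier ?_
  filter_upwards [fourier_lowFreq (n + 2) (freqBlock n f), fourier_freqBlock n f] with η h1 h2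
  rw [h1, h2]
  rcases le_total ‖η‖ (2 ^ (n + 2)) with h | h
  · simp [cutoff_eq_one h]
  · have h3 : cutoff (n + 1) η = 0 := cutoff_eq_zero h
    have h4 : cutoff n η = 0 := cutoff_eq_zero (le_trans (by gcongr <;> norm_num) h)
    simp [h3, h4]

theorem lowFreq_lowFreq_zero (f : L2 d) : lowFreq 1 (lowFreq 0 f) = lowFreq 0 f := by
  refine L2.ext_fourier ?_
  filter_upwards [fourier_lowFreq 1 (lowFreq 0 f), fourier_lowFreq 0 f] with η h1 h2
  rw [h1, h2]
  rcases le_total ‖η‖ (2 ^ 1) with h | h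
  · simp [cutoff_eq_one h]
  · have h3 : cutoff 0 η = 0 := cutoff_eq_zero h
    simp [h3]

theorem abs_cutoff_sub_le (n : ℕ) (η : Rd d) : |cutoff (n + 1) η - cutoff n η| ≤ 1 := by
  rw [abs_le]
  constructor <;> linarith [cutoff_nonneg n η, cutoff_le_one n η, cutoff_nonneg (n + 1) η,
    cutoff_le_one (n + 1) η]

theorem two_pow_rpow_le_weight {a : ℝ} (ha : a ≤ 0) {n : ℕ} {η : Rd d} (h : 2 ^ n ≤ ‖η‖) :
    sobolevWeight a η ≤ 2 ^ (n * a) := by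
  unfold sobolevWeight
  have h1 : ((2 : ℝ) ^ n) ^ 2 ≤ 1 + ‖η‖ ^ 2 := by
    have : ((2 : ℝ) ^ n) ^ 2 ≤ ‖η‖ ^ 2 := by gcongr
    linarith
  refine (Real.rpow_le_rpow_of_nonpos (by positivity) h1 (by linarith)).trans (le_of_eq ?_)
  rw [← Real.rpow_natCast, ← Real.rpow_natCast, ← Real.rpow_mul (by norm_num),
    ← Real.rpow_mul (by norm_num)]
  congr 1
  push_cast
  ring

/-- A block lives where |η| ≥ 2^n, and there the weight of order k - a ≤ 0 is at most 2^{n(k-a)}. -/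
theorem sobolevNorm_freqBlock_le {k a : ℝ} (h : k ≤ a) (n : ℕ) (f : L2 d) :
    sobolevNorm k (freqBlock n f) ≤ ENNReal.ofReal (2 ^ (n * (k - a))) * sobolevNorm a f := by
  unfold sobolevNorm
  have hpos : (0 : ℝ) ≤ 2 ^ (n * (k - a)) := by positivity
  rw [← Real.enorm_of_nonneg hpos, ← eLpNorm_const_smul]
  refine eLpNorm_mono_ae ?_
  filter_upwards [fourier_freqBlock n f] with η hη
  rw [hη, Pi.smul_apply, norm_smul, norm_mul, norm_mul, norm_mul, Complex.norm_real,
    Complex.norm_real, Complex.norm_real, Real.norm_of_nonneg (sobolevWeight_pos k η).le,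
    Real.norm_of_nonneg (sobolevWeight_pos a η).le, Real.norm_of_nonneg hpos,
    Real.norm_eq_abs, ← mul_assoc, ← mul_assoc]
  refine mul_le_mul_of_nonneg_right ?_ (norm_nonneg _)
  rcases le_total ‖η‖ (2 ^ n) with h1 | h1
  · have h3 : cutoff n η = 1 := cutoff_eq_one h1
    have h4 : cutoff (n + 1) η = 1 := cutoff_eq_one (h1.trans (by gcongr <;> norm_num))
    rw [h3, h4, sub_self, abs_zero, mul_zero]
    have := (sobolevWeight_pos a η).le
    positivity
  · have h5 : sobolevWeight k η = sobolevWeight (k - a) η * sobolevWeight a η := by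
      rw [← sobolevWeight_add]; ring_nf
    have h6 := two_pow_rpow_le_weight (sub_nonpos.2 h) h1
    calc _ ≤ sobolevWeight k η * 1 := by
          gcongr
          · exact (sobolevWeight_pos k η).le
          · exact abs_cutoff_sub_le n η
      _ ≤ _ := by
          rw [mul_one, h5]
          gcongr
          exact (sobolevWeight_pos a η).le

theorem sobolevNorm_lowFreq_le (a : ℝ) (n : ℕ) (f : L2 d) :
    sobolevNorm a (lowFreq n f) ≤ sobolevNorm a f := by
  refine eLpNorm_mono_ae ?_
  filter_upwards [fourier_lowFreq n f] with η hη
  rw [hη, norm_mul, norm_mul, norm_mul]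
  have := norm_cutoff_le_one n η
  gcongr
  nlinarith [norm_nonneg ((𝓕 f : L2 d) η)]

theorem lowFreq_eq_sum (N : ℕ) (f : L2 d) :
    lowFreq N f = lowFreq 0 f + ∑ n ∈ Finset.range N, freqBlock n f := by
  unfold freqBlock
  rw [Finset.sum_range_sub (fun n => lowFreq n f)]
  abel

theorem eLpNorm_L2_sum_le (q : ℝ≥0∞) (hq : 1 ≤ q) (N : ℕ) (u : ℕ → L2 d) :
    eLpNorm (∑ n ∈ Finset.range N, u n : L2 d) q volume ≤
      ∑ n ∈ Finset.range N, eLpNorm (u n) q volume := by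
  induction N with
  | zero =>
    rw [Finset.sum_range_zero, Finset.sum_range_zero,
      eLpNorm_congr_ae (Lp.coeFn_zero ℂ 2 (volume : Measure (Rd d))), eLpNorm_zero]
  | succ N ih =>
    rw [Finset.sum_range_succ, Finset.sum_range_succ]
    exact (eLpNorm_L2_add_le q hq _ _).trans (by gcongr)

end lebesgue

/-! ### From the Strichartz estimate to L^p in time with values in L^∞ -/

section

variable {d : ℕ} {P : Rd d → ℝ} (hP : Measurable P)

theorem measurable_eLpNorm_propagatorL2 (q : ℝ≥0∞) (f : L2 d) :
    Measurable fun t : ℝ => eLpNorm (propagatorL2 hP t f) q volume :=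
  (measurable_eLpNorm_L2 q).comp (continuous_propagatorL2_apply hP f).measurable

/-- The Strichartz estimate for a low frequency function, in the uniform norm. -/
theorem StrichartzEstimate.lowFreq_top {p q q' : ℝ≥0∞} [ENNReal.HolderConjugate q' q] {k T₀ C : ℝ}
    (h : StrichartzEstimate hP p q k T₀ C) (hC : 0 ≤ C) (m : ℕ) (f : L2 d) (hf : lowFreq m f = f)
    (hk : sobolevNorm k f ≠ ∞) :
    eLpNorm (fun t : ℝ => eLpNorm (propagatorL2 hP t f) ∞ volume) p (volume.restrict (Icc 0 T₀)) ≤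
      eLpNorm (cutoffKernel d m) q' volume * (ENNReal.ofReal C * sobolevNorm k f) := by
  refine (eLpNorm_le_mul_eLpNorm_of_ae_le_mul'' p
    (measurable_eLpNorm_propagatorL2 hP q f).aestronglyMeasurable
    (c := eLpNorm (cutoffKernel d m) q' volume) (Eventually.of_forall fun t => ?_)).trans
    (by gcongr; exact h.le_of_L2 hP hC f hk)
  simp only [enorm_eq_self]
  conv_lhs => rw [← hf, ← lowFreq_propagatorL2]
  exact eLpNorm_lowFreq_top_le (q := q) (q' := q') m _

/-- The Strichartz estimate implies an estimate in `L^p([0, T₀]; L^∞)`, for frequency-truncated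
data, uniformly in the truncation. -/
theorem StrichartzEstimate.lowFreq_top_le {p q : ℝ≥0∞} {k T₀ C : ℝ}
    (h : StrichartzEstimate hP p q k T₀ C) (hp : 1 ≤ p) (hq : 1 < q) (hC : 0 ≤ C) {a : ℝ}
    (ha : k + d * (q⁻¹).toReal < a) :
    ∃ C' : ℝ≥0∞, C' ≠ ∞ ∧ ∀ (N : ℕ) (f : L2 d), sobolevNorm a f ≠ ∞ →
      eLpNorm (fun t : ℝ => eLpNorm (propagatorL2 hP t (lowFreq N f)) ∞ volume) p
        (volume.restrict (Icc 0 T₀)) ≤ C' * sobolevNorm a f := by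
  set q' : ℝ≥0∞ := ENNReal.conjExponent q with hq'
  have hconj : ENNReal.HolderConjugate q q' := ENNReal.HolderConjugate.conjExponent hq.le
  have hconj' : ENNReal.HolderConjugate q' q := hconj.symm
  have hq'top : q' ≠ ∞ := (ENNReal.HolderConjugate.ne_top_iff_ne_one q' q).2 hq.ne'
  have hq'inv : 1 - q'.toReal⁻¹ = (q⁻¹).toReal := by
    have h1 := congrArg ENNReal.toReal (ENNReal.HolderConjugate.inv_add_inv_eq_one q' q)
    rw [ENNReal.toReal_add (ENNReal.inv_ne_top.2 (ENNReal.HolderConjugate.ne_zero q' q))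
      (ENNReal.inv_ne_top.2 (ENNReal.HolderConjugate.ne_zero q q')), ENNReal.toReal_inv,
      ENNReal.toReal_one] at h1
    linarith
  set K := eLpNorm (cutoffKernel d 0) q' volume with hK
  have hKtop : K ≠ ∞ := (memLp_cutoffKernel d 0 q').2.ne
  -- The net exponent of a block: Bernstein loses d/q, Strichartz loses k, and the H^a norm gains a.
  -- It is negative, so the blocks sum geometrically with ratio ρ = 2^β.
  set β : ℝ := d * (q⁻¹).toReal + (k - a) with hβ
  have hβ0 : β < 0 := by rw [hβ]; linarith
  have hka : k ≤ a := by
    have : 0 ≤ d * (q⁻¹).toReal := by positivity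
    linarith
  set A : ℝ≥0∞ := ENNReal.ofReal (2 ^ (d * (q⁻¹).toReal)) * K * ENNReal.ofReal C with hA
  set ρ : ℝ≥0∞ := ENNReal.ofReal (2 ^ β) with hρ
  have hρ1 : ρ < 1 := by
    rw [hρ, ENNReal.ofReal_lt_one]
    exact Real.rpow_lt_one_of_one_lt_of_neg one_lt_two hβ0
  -- The factor 2^{2d/q} appears because the n-th block is reproduced by the cutoff of index n + 2.
  set A2 : ℝ≥0∞ := ENNReal.ofReal (2 ^ (2 * (d * (q⁻¹).toReal))) * K * ENNReal.ofReal C with hA2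
  refine ⟨A + A2 * (1 - ρ)⁻¹, ?_, ?_⟩
  · refine ENNReal.add_ne_top.2 ⟨?_, ENNReal.mul_ne_top ?_ ?_⟩
    · exact ENNReal.mul_ne_top (ENNReal.mul_ne_top ENNReal.ofReal_ne_top hKtop) ENNReal.ofReal_ne_top
    · exact ENNReal.mul_ne_top (ENNReal.mul_ne_top ENNReal.ofReal_ne_top hKtop) ENNReal.ofReal_ne_top
    · rw [ENNReal.inv_ne_top]
      exact (tsub_pos_of_lt hρ1).ne'
  intro N f hf
  have hkern : ∀ m : ℕ, eLpNorm (cutoffKernel d m) q' volume =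
      ENNReal.ofReal (2 ^ (m * (d * (q⁻¹).toReal))) * K := by
    intro m
    rw [eLpNorm_cutoffKernel d m hq'top, hq'inv, mul_assoc]
  set g : ℕ → ℝ → ℝ≥0∞ := fun n t => eLpNorm (propagatorL2 hP t (freqBlock n f)) ∞ volume with hg
  have hg0 : eLpNorm (fun t : ℝ => eLpNorm (propagatorL2 hP t (lowFreq 0 f)) ∞ volume) p
      (volume.restrict (Icc 0 T₀)) ≤ A * sobolevNorm a f := by
    have hle : sobolevNorm k (lowFreq 0 f) ≤ sobolevNorm a f :=
      (sobolevNorm_lowFreq_le k 0 f).trans (sobolevNorm_mono hka f)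
    refine (h.lowFreq_top hP hC 1 (lowFreq 0 f) (lowFreq_lowFreq_zero f) (q' := q')
      (ne_top_of_le_ne_top hf hle)).trans ?_
    rw [hkern, hA, Nat.cast_one, one_mul, ← mul_assoc]
    gcongr
  have hgn : ∀ n, eLpNorm (g n) p (volume.restrict (Icc 0 T₀)) ≤ A2 * ρ ^ n * sobolevNorm a f := by
    intro n
    have hle := sobolevNorm_freqBlock_le hka n f
    refine (h.lowFreq_top hP hC (n + 2) (freqBlock n f) (lowFreq_freqBlock n f) (q' := q')
      (ne_top_of_le_ne_top (ENNReal.mul_ne_top ENNReal.ofReal_ne_top hf) hle)).trans ?_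
    rw [hkern]
    calc _ ≤ ENNReal.ofReal (2 ^ ((n + 2 : ℕ) * (d * (q⁻¹).toReal))) * K *
          (ENNReal.ofReal C * (ENNReal.ofReal (2 ^ (n * (k - a))) * sobolevNorm a f)) := by gcongr
      _ = (ENNReal.ofReal (2 ^ ((n + 2 : ℕ) * (d * (q⁻¹).toReal))) *
          ENNReal.ofReal (2 ^ (n * (k - a)))) * (K * ENNReal.ofReal C) * sobolevNorm a f := by ring
      _ = (ENNReal.ofReal (2 ^ (2 * (d * (q⁻¹).toReal))) * ρ ^ n) * (K * ENNReal.ofReal C) *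
          sobolevNorm a f := by
        congr 2
        rw [hρ, ← ENNReal.ofReal_pow (by positivity), ← ENNReal.ofReal_mul (by positivity),
          ← ENNReal.ofReal_mul (by positivity), ← Real.rpow_natCast (2 ^ β),
          ← Real.rpow_mul (by norm_num), ← Real.rpow_add (by norm_num),
          ← Real.rpow_add (by norm_num)]
        congr 2
        rw [hβ]
        push_cast
        ring
      _ = _ := by rw [hA2]; ring
  calc _ ≤ eLpNorm ((fun t : ℝ => eLpNorm (propagatorL2 hP t (lowFreq 0 f)) ∞ volume) +
        ∑ n ∈ Finset.range N, g n) p (volume.restrict (Icc 0 T₀)) := by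
        refine eLpNorm_mono_enorm fun t => ?_
        simp only [enorm_eq_self, Pi.add_apply, Finset.sum_apply]
        have e : propagatorL2 hP t (lowFreq N f) = propagatorL2 hP t (lowFreq 0 f) +
            ∑ n ∈ Finset.range N, propagatorL2 hP t (freqBlock n f) := by
          rw [lowFreq_eq_sum, propagatorL2_add]
          congr 1
          exact map_sum (propagatorL2ₗᵢ hP t) _ _
        rw [e]
        refine (eLpNorm_L2_add_le ∞ le_top _ _).trans ?_
        gcongr
        exact eLpNorm_L2_sum_le ∞ le_top N _
    _ ≤ _ := by
        refine (eLpNorm_add_le (measurable_eLpNorm_propagatorL2 hP ∞ _).aestronglyMeasurable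
          (Finset.aestronglyMeasurable_sum _ fun n _ =>
            (measurable_eLpNorm_propagatorL2 hP ∞ _).aestronglyMeasurable) hp).trans ?_
        rw [add_mul]
        refine add_le_add hg0 ?_
        refine (eLpNorm_sum_le (fun n _ =>
          (measurable_eLpNorm_propagatorL2 hP ∞ _).aestronglyMeasurable) hp).trans ?_
        calc _ ≤ ∑ n ∈ Finset.range N, A2 * ρ ^ n * sobolevNorm a f :=
              Finset.sum_le_sum fun n _ => hgn n
          _ = A2 * (∑ n ∈ Finset.range N, ρ ^ n) * sobolevNorm a f := by
              rw [Finset.mul_sum, Finset.sum_mul]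
          _ ≤ A2 * (1 - ρ)⁻¹ * sobolevNorm a f := by
              gcongr
              rw [← ENNReal.tsum_geometric]
              exact ENNReal.sum_le_tsum _

/-- The Strichartz estimate implies that `S(t)` maps `H^a` to `L^{p₁}([0, T₀]; L^∞)`. -/
theorem StrichartzEstimate.lintegral_top_le {p q : ℝ≥0∞} {k T₀ C : ℝ}
    (h : StrichartzEstimate hP p q k T₀ C) (hp : 1 ≤ p) (hq : 1 < q) (hC : 0 ≤ C) {a : ℝ}
    (ha : k + d * (q⁻¹).toReal < a) {p₁ : ℝ} (hp₁ : 1 ≤ p₁) (hp₁p : ENNReal.ofReal p₁ ≤ p) :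
    ∃ C' : ℝ≥0∞, C' ≠ ∞ ∧ ∀ f : L2 d, sobolevNorm a f ≠ ∞ →
      ∫⁻ t in Icc 0 T₀, eLpNorm (propagatorL2 hP t f) ∞ volume ^ p₁ ≤
        (C' * sobolevNorm a f) ^ p₁ := by
  obtain ⟨C', hC', hmain⟩ := h.lowFreq_top_le hP hp hq hC ha
  -- The Hölder factor for passing from L^p to L^{p₁} on the finite interval; it also reduces p = ∞
  -- to a finite exponent.
  set M : ℝ≥0∞ := (volume.restrict (Icc 0 T₀)) univ ^
    (1 / (ENNReal.ofReal p₁).toReal - 1 / p.toReal) with hM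
  have hp₁0 : 0 < p₁ := by linarith
  have hMtop : M ≠ ∞ := by
    refine (ENNReal.rpow_lt_top_of_nonneg ?_ (measure_ne_top _ _)).ne
    rw [sub_nonneg]
    rcases eq_or_ne p ∞ with rfl | hpt
    · simp
    · refine one_div_le_one_div_of_le ?_ (ENNReal.toReal_mono hpt hp₁p)
      rw [ENNReal.toReal_ofReal hp₁0.le]
      exact hp₁0
  refine ⟨C' * M, ENNReal.mul_ne_top hC' hMtop, fun f hf => ?_⟩
  have hN : ∀ N, ∫⁻ t in Icc 0 T₀, eLpNorm (propagatorL2 hP t (lowFreq N f)) ∞ volume ^ p₁ ≤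
      (C' * M * sobolevNorm a f) ^ p₁ := by
    intro N
    have h1 := (eLpNorm_le_eLpNorm_mul_rpow_measure_univ hp₁p
      (measurable_eLpNorm_propagatorL2 hP ∞ (lowFreq N f)).aestronglyMeasurable
      (μ := volume.restrict (Icc 0 T₀))).trans
      (mul_le_mul_left (hmain N f hf) M)
    rw [eLpNorm_eq_lintegral_rpow_enorm_toReal (by simpa using hp₁0) ENNReal.ofReal_ne_top,
      ENNReal.toReal_ofReal hp₁0.le] at h1
    have h2 := ENNReal.rpow_le_rpow h1 hp₁0.le
    rw [← ENNReal.rpow_mul, one_div_mul_cancel hp₁0.ne', ENNReal.rpow_one] at h2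
    simp only [enorm_eq_self] at h2
    refine h2.trans (le_of_eq ?_)
    congr 1
    ring
  -- The truncation is removed by lower semicontinuity of the uniform norm at each time, followed by
  -- Fatou's lemma in time.
  calc _ ≤ ∫⁻ t in Icc 0 T₀, liminf (fun N =>
        eLpNorm (propagatorL2 hP t (lowFreq N f)) ∞ volume ^ p₁) atTop := by
        refine lintegral_mono fun t => ?_
        have hlim : Tendsto (fun N => propagatorL2 hP t (lowFreq N f)) atTop
            (𝓝 (propagatorL2 hP t f)) :=
          ((propagatorL2ₗᵢ hP t).continuous.tendsto f).comp (tendsto_lowFreq f)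
        have := ENNReal.rpow_le_rpow (eLpNorm_L2_le_liminf ∞ hlim) hp₁0.le
        refine this.trans (le_of_eq ?_)
        exact (ENNReal.orderIsoRpow p₁ hp₁0).liminf_apply
    _ ≤ liminf (fun N => ∫⁻ t in Icc 0 T₀,
        eLpNorm (propagatorL2 hP t (lowFreq N f)) ∞ volume ^ p₁) atTop :=
        lintegral_liminf_le fun N =>
          (measurable_eLpNorm_propagatorL2 hP ∞ (lowFreq N f)).pow_const p₁
    _ ≤ _ := by
        refine liminf_le_of_le (by isBoundedDefault) fun b hb => ?_
        obtain ⟨n, hn⟩ := hb.exists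
        exact hn.trans (hN n)

/-- The estimate of `StrichartzEstimate.lintegral_top_le` holds backwards in time. -/
theorem StrichartzEstimate.lintegral_top_le_neg {p q : ℝ≥0∞} {k T₀ C : ℝ}
    (h : StrichartzEstimate hP p q k T₀ C) (hp : 1 ≤ p) (hq : 1 < q) (hC : 0 ≤ C) {a : ℝ}
    (ha : k + d * (q⁻¹).toReal < a) {p₁ : ℝ} (hp₁ : 1 ≤ p₁) (hp₁p : ENNReal.ofReal p₁ ≤ p) :
    ∃ C' : ℝ≥0∞, C' ≠ ∞ ∧ ∀ f : L2 d, sobolevNorm a f ≠ ∞ →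
      ∫⁻ t in Icc 0 T₀, eLpNorm (propagatorL2 hP (-t) f) ∞ volume ^ p₁ ≤
        (C' * sobolevNorm a f) ^ p₁ := by
  obtain ⟨C', hC', hmain⟩ := h.lintegral_top_le hP hp hq hC ha hp₁ hp₁p
  refine ⟨C', hC', fun f hf => ?_⟩
  -- S(-t) f = S(T₀ - t) S(-T₀) f, the operator S(-T₀) preserves the H^a norm, and t ↦ T₀ - t
  -- preserves [0, T₀].
  have h1 := hmain (propagatorL2 hP (-T₀) f) (by rwa [sobolevNorm_propagatorL2])
  rw [sobolevNorm_propagatorL2] at h1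
  refine le_trans (le_of_eq ?_) h1
  rw [← lintegral_indicator measurableSet_Icc, ← lintegral_indicator measurableSet_Icc,
    ← lintegral_sub_left_eq_self _ T₀]
  refine lintegral_congr fun t => ?_
  by_cases ht : t ∈ Icc 0 T₀
  · have ht' : T₀ - t ∈ Icc 0 T₀ := ⟨by linarith [ht.2], by linarith [ht.1]⟩
    rw [indicator_of_mem ht, indicator_of_mem ht', propagatorL2_propagatorL2]
    congr 4
    ring_nf
  · have ht' : T₀ - t ∉ Icc 0 T₀ := fun h' => ht ⟨by linarith [h'.2], by linarith [h'.1]⟩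
    rw [indicator_of_notMem ht, indicator_of_notMem ht']

end

/-! ### Minkowski's inequality and Duhamel's formula -/

/-- Minkowski's integral inequality in `L^p`, for a finite measure. -/
theorem lintegral_lintegral_rpow_le {α β : Type*} [MeasurableSpace α] [MeasurableSpace β]
    {μ : Measure α} {ν : Measure β} [SFinite μ] [IsFiniteMeasure ν] {p : ℝ} (hp : 1 ≤ p)
    {k : α → β → ℝ≥0∞} (hk : Measurable (Function.uncurry k)) {h : β → ℝ≥0∞} (hh : Measurable h)
    (hfin : ∫⁻ τ, h τ ∂ν ≠ ∞) (hle : ∀ᵐ τ ∂ν, ∫⁻ t, k t τ ^ p ∂μ ≤ h τ ^ p) :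
    ∫⁻ t, (∫⁻ τ, k t τ ∂ν) ^ p ∂μ ≤ (∫⁻ τ, h τ ∂ν) ^ p := by
  have hp0 : 0 < p := by linarith
  -- The proof is Hölder's inequality with the weight H = h + ε. The shift by ε makes the negative
  -- powers of H harmless where h vanishes, and it disappears in the limit because ν is finite.
  have key : ∀ ε : ℝ≥0∞, ε ≠ 0 → ε ≠ ∞ →
      ∫⁻ t, (∫⁻ τ, k t τ ∂ν) ^ p ∂μ ≤ (∫⁻ τ, h τ ∂ν + ε * ν univ) ^ p := by
    intro ε hε hε'
    set H : β → ℝ≥0∞ := fun τ => h τ + ε with hH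
    have hHm : Measurable H := hh.add_const ε
    have hH0 : ∀ τ, H τ ≠ 0 := fun τ h0 => hε (by simp [hH] at h0; exact h0.2)
    have hHfin : ∀ᵐ τ ∂ν, H τ ≠ ∞ := by
      filter_upwards [ae_lt_top hh hfin] with τ hτ
      exact ENNReal.add_ne_top.2 ⟨hτ.ne, hε'⟩
    have hHint : ∫⁻ τ, H τ ∂ν = ∫⁻ τ, h τ ∂ν + ε * ν univ := by
      rw [hH, lintegral_add_left hh, lintegral_const]
    rw [← hHint]
    set A := ∫⁻ τ, H τ ∂ν with hA
    have hAtop : A ≠ ∞ := by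
      rw [hHint]
      exact ENNReal.add_ne_top.2 ⟨hfin, ENNReal.mul_ne_top hε' (measure_ne_top _ _)⟩
    have hstep : ∀ t, (∫⁻ τ, k t τ ∂ν) ^ p ≤ (∫⁻ τ, k t τ ^ p * H τ ^ (1 - p) ∂ν) * A ^ (p - 1) := by
      intro t
      have hkt : Measurable (k t) := hk.of_uncurry_left
      have h1 := ENNReal.lintegral_mul_norm_pow_le (μ := ν)
        (f := fun τ => k t τ ^ p * H τ ^ (1 - p)) (g := H)
        ((hkt.pow_const p).mul (hHm.pow_const _)).aemeasurable hHm.aemeasurable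
        (p := 1 / p) (q := 1 - 1 / p) (by positivity)
        (by rw [sub_nonneg, div_le_one hp0]; exact hp) (by ring)
      -- Split k = (k^p H^{1-p})^{1/p} · H^{1-1/p}. After integration in t the first factor
      -- contributes at most ∫ H, by the bound on the p-th moment of k(·, τ).
      have h2 : ∫⁻ τ, k t τ ∂ν =
          ∫⁻ τ, (k t τ ^ p * H τ ^ (1 - p)) ^ (1 / p) * H τ ^ (1 - 1 / p) ∂ν := by
        refine lintegral_congr_ae ?_
        filter_upwards [hHfin] with τ hτ
        rw [ENNReal.mul_rpow_of_nonneg _ _ (by positivity), ← ENNReal.rpow_mul, ← ENNReal.rpow_mul,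
          mul_one_div_cancel hp0.ne', ENNReal.rpow_one, mul_assoc,
          ← ENNReal.rpow_add _ _ (hH0 τ) hτ]
        have : (1 - p) * (1 / p) + (1 - 1 / p) = 0 := by field_simp; ring
        rw [this, ENNReal.rpow_zero, mul_one]
      rw [← h2] at h1
      refine (ENNReal.rpow_le_rpow h1 hp0.le).trans (le_of_eq ?_)
      rw [ENNReal.mul_rpow_of_nonneg _ _ hp0.le, ← ENNReal.rpow_mul, ← ENNReal.rpow_mul,
        one_div_mul_cancel hp0.ne', ENNReal.rpow_one]
      congr 2
      field_simp
    have hm : Measurable (Function.uncurry fun t τ => k t τ ^ p * H τ ^ (1 - p)) :=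
      (hk.pow_const p).mul ((hHm.comp measurable_snd).pow_const _)
    calc _ ≤ ∫⁻ t, (∫⁻ τ, k t τ ^ p * H τ ^ (1 - p) ∂ν) * A ^ (p - 1) ∂μ := lintegral_mono hstep
      _ = (∫⁻ t, ∫⁻ τ, k t τ ^ p * H τ ^ (1 - p) ∂ν ∂μ) * A ^ (p - 1) :=
          lintegral_mul_const _ hm.lintegral_prod_right'
      _ = (∫⁻ τ, ∫⁻ t, k t τ ^ p * H τ ^ (1 - p) ∂μ ∂ν) * A ^ (p - 1) := by
          rw [lintegral_lintegral_swap hm.aemeasurable]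
      _ ≤ (∫⁻ τ, H τ ∂ν) * A ^ (p - 1) := by
          gcongr 1
          refine lintegral_mono_ae ?_
          filter_upwards [hle, hHfin] with τ hτ hτ'
          rw [lintegral_mul_const _ (hk.of_uncurry_right.pow_const p)]
          calc _ ≤ H τ ^ p * H τ ^ (1 - p) := by
                gcongr
                refine hτ.trans (ENNReal.rpow_le_rpow ?_ hp0.le)
                exact le_self_add
            _ = H τ := by
                rw [← ENNReal.rpow_add _ _ (hH0 τ) hτ']
                simp
      _ ≤ A ^ p := by
          rcases eq_or_ne A 0 with h0 | h0
          · rw [← hA, h0, zero_mul]; exact zero_le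
          · rw [← hA]
            nth_rewrite 1 [← ENNReal.rpow_one A]
            rw [← ENNReal.rpow_add _ _ h0 hAtop]
            simp
  have hlim : Tendsto (fun n : ℕ => (∫⁻ τ, h τ ∂ν + ((n : ℝ≥0∞) + 1)⁻¹ * ν univ) ^ p) atTop
      (𝓝 ((∫⁻ τ, h τ ∂ν + 0 * ν univ) ^ p)) := by
    refine Tendsto.ennrpow_const _ (Tendsto.const_add _ (ENNReal.Tendsto.mul_const ?_
      (Or.inr (measure_ne_top _ _))))
    have := (tendsto_add_atTop_iff_nat 1).2 ENNReal.tendsto_inv_nat_nhds_zero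
    simpa using this
  rw [zero_mul, add_zero] at hlim
  refine ge_of_tendsto' hlim fun n => key _ (by simp) ?_
  rw [ENNReal.inv_ne_top]
  simp

section

variable {d : ℕ}

theorem eLpNorm_L2_real_smul (q : ℝ≥0∞) (c : ℝ) (f : L2 d) :
    eLpNorm (c • f : L2 d) q volume = ‖c‖ₑ * eLpNorm f q volume := by
  rw [eLpNorm_congr_ae (Lp.coeFn_smul c f), eLpNorm_const_smul]

theorem convex_setOf_eLpNorm_le (q : ℝ≥0∞) (hq : 1 ≤ q) (c : ℝ≥0∞) :
    Convex ℝ {f : L2 d | eLpNorm f q volume ≤ c} := by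
  intro f hf g hg a b ha hb hab
  simp only [mem_ofPred_eq] at *
  refine (eLpNorm_L2_add_le q hq _ _).trans ?_
  rw [eLpNorm_L2_real_smul, eLpNorm_L2_real_smul]
  calc _ ≤ ‖a‖ₑ * c + ‖b‖ₑ * c := by gcongr
    _ = c := by
      rw [← add_mul, ← ofReal_norm, ← ofReal_norm, Real.norm_of_nonneg ha,
        Real.norm_of_nonneg hb, ← ENNReal.ofReal_add ha hb, hab]
      simp

/-- The `L^q` norm of a Bochner integral in `L²` is at most the integral of the `L^q` norms. -/
theorem eLpNorm_integral_L2_le {α : Type*} [MeasurableSpace α] {μ : Measure α} {q : ℝ≥0∞}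
    (hq : 1 ≤ q) {g : α → L2 d} (hg : StronglyMeasurable g) :
    eLpNorm (∫ x, g x ∂μ : L2 d) q volume ≤ ∫⁻ x, eLpNorm (g x) q volume ∂μ := by
  have hm : Measurable fun x => eLpNorm (g x) q volume :=
    (measurable_eLpNorm_L2 q).comp hg.measurable
  rcases eq_or_ne (∫⁻ x, eLpNorm (g x) q volume ∂μ) ∞ with h | h
  · rw [h]; exact le_top
  have hz : ∀ f : L2 d, eLpNorm f q volume = 0 → f = 0 := fun f hf => by
    rw [eLpNorm_eq_zero_iff (Lp.aestronglyMeasurable f) (by positivity)] at hf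
    exact Lp.eq_zero_iff_ae_eq_zero.2 hf
  -- Normalisation: with density n(x) = ‖g(x)‖_q, the function g/n takes values in the unit ball for
  -- the L^q norm. That ball is closed and convex in L², so it contains the average of g/n, and ∫ g
  -- is this average times the total mass.
  set n : α → NNReal := fun x => (eLpNorm (g x) q volume).toNNReal with hn
  have hnm : Measurable n := hm.ennreal_toNNReal
  have hne : ∀ᵐ x ∂μ, (n x : ℝ≥0∞) = eLpNorm (g x) q volume := by
    filter_upwards [ae_lt_top hm h] with x hx
    exact ENNReal.coe_toNNReal hx.ne
  set ν : Measure α := μ.withDensity fun x => (n x : ℝ≥0∞) with hν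
  have hmass : ν univ = ∫⁻ x, eLpNorm (g x) q volume ∂μ := by
    rw [hν, withDensity_apply _ MeasurableSet.univ, Measure.restrict_univ]
    exact lintegral_congr_ae hne
  have hνfin : IsFiniteMeasure ν := ⟨by rw [hmass]; exact lt_top_iff_ne_top.2 h⟩
  have h_integral : ∫ x, g x ∂μ = ∫ x, (n x : ℝ)⁻¹ • g x ∂ν := by
    rw [hν, integral_withDensity_eq_integral_smul hnm]
    refine integral_congr_ae ?_
    filter_upwards [hne] with x hx
    rcases eq_or_ne (n x) 0 with h0 | h0
    · rw [h0] at hx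
      rw [hz _ hx.symm]
      simp
    · rw [NNReal.smul_def, smul_smul, mul_inv_cancel₀ (by exact_mod_cast h0), one_smul]
  rcases eq_or_ne ν 0 with hν0 | hν0
  · rw [h_integral, hν0, integral_zero_measure, eLpNorm_congr_ae (Lp.coeFn_zero ℂ 2 volume), eLpNorm_zero]
    exact zero_le
  have : NeZero ν := ⟨hν0⟩
  have hmem : ∀ᵐ x ∂ν, (n x : ℝ)⁻¹ • g x ∈ {f : L2 d | eLpNorm f q volume ≤ 1} := by
    have : ∀ᵐ x ∂ν, (n x : ℝ≥0∞) = eLpNorm (g x) q volume :=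
      (withDensity_absolutelyContinuous μ _).ae_le hne
    filter_upwards [this] with x hx
    rw [eLpNorm_L2_real_smul, ← hx, ← ofReal_norm, Real.norm_of_nonneg (by positivity)]
    rcases eq_or_ne (n x) 0 with h0 | h0
    · rw [h0]; simp
    · rw [← NNReal.coe_inv, ENNReal.ofReal_coe_nnreal, ← ENNReal.coe_mul, inv_mul_cancel₀ h0]
      simp
  have hbd : Integrable (fun x => (n x : ℝ)⁻¹ • g x) ν ∨
      ¬ Integrable (fun x => (n x : ℝ)⁻¹ • g x) ν := em _
  rcases hbd with hi | hi
  · have h1 := (convex_setOf_eLpNorm_le q hq 1).average_mem (isClosed_setOf_eLpNorm_le q 1) hmem hi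
    simp only [mem_ofPred_eq, average_eq] at h1
    have h2 : ∫ x, g x ∂μ = (ν.real univ) • ((ν.real univ)⁻¹ •
        ∫ x, (n x : ℝ)⁻¹ • g x ∂ν) := by
      have hr : ν.real univ ≠ 0 := by
        rw [Measure.real, ENNReal.toReal_ne_zero]
        exact ⟨fun h0 => hν0 (Measure.measure_univ_eq_zero.1 h0), measure_ne_top _ _⟩
      rw [smul_smul, mul_inv_cancel₀ hr, one_smul, h_integral]
    rw [h2, eLpNorm_L2_real_smul, ← hmass]
    calc _ ≤ ‖ν.real univ‖ₑ * 1 := by gcongr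
      _ = _ := by
        rw [mul_one, ← ofReal_norm, Real.norm_of_nonneg (by positivity)]
        exact ENNReal.ofReal_toReal (measure_ne_top _ _)
  -- Without integrability the Bochner integral is 0 by convention and the bound is trivial.
  · rw [h_integral, integral_undef hi, eLpNorm_congr_ae (Lp.coeFn_zero ℂ 2 volume), eLpNorm_zero]
    exact zero_le

variable {P : Rd d → ℝ} (hP : Measurable P)

theorem stronglyMeasurable_propagatorL2 {α : Type*} [MeasurableSpace α] {t : α → ℝ} {f : α → L2 d}
    (ht : StronglyMeasurable t) (hf : StronglyMeasurable f) :
    StronglyMeasurable fun x => propagatorL2 hP (t x) (f x) :=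
  Continuous.comp_stronglyMeasurable (g := fun x : ℝ × L2 d => propagatorL2 hP x.1 x.2)
    (f := fun x => (t x, f x)) (continuous_propagatorL2 hP) (ht.prodMk hf)

/-- The inhomogeneous estimate in `L^{p₁}([0, T]; L^∞)`. -/
theorem duhamel_lintegral_top_le {a p₁ T₀ T : ℝ} {C' : ℝ≥0∞} (hC' : C' ≠ ∞) (hp₁ : 1 ≤ p₁)
    (hmain : ∀ f : L2 d, sobolevNorm a f ≠ ∞ →
      ∫⁻ t in Icc 0 T₀, eLpNorm (propagatorL2 hP (-t) f) ∞ volume ^ p₁ ≤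
        (C' * sobolevNorm a f) ^ p₁)
    (hT : T ≤ T₀) {H : ℝ → L2 d} (hH : StronglyMeasurable H) {h : ℝ → ℝ≥0∞} (hh : Measurable h)
    (hle : ∀ᵐ τ, τ ∈ Icc 0 T → sobolevNorm a (H τ) ≤ h τ) (hfin : ∫⁻ τ in Icc 0 T, h τ ≠ ∞) :
    ∫⁻ t in Icc 0 T, eLpNorm (∫ τ in (0 : ℝ)..t, propagatorL2 hP (-(t - τ)) (H τ) : L2 d) ∞
      volume ^ p₁ ≤ (C' * ∫⁻ τ in Icc 0 T, h τ) ^ p₁ := by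
  have hp0 : 0 < p₁ := by linarith
  -- The kernel is extended by 0 to τ > t, so that Minkowski's inequality applies on the full square
  -- [0,T]².
  obtain ⟨k₀, hk₀⟩ : ∃ k₀ : ℝ × ℝ → ℝ≥0∞, k₀ = {x : ℝ × ℝ | x.2 ≤ x.1}.indicator
    (fun x => eLpNorm (propagatorL2 hP (-(x.1 - x.2)) (H x.2)) ∞ volume) := ⟨_, rfl⟩
  obtain ⟨k, hk⟩ : ∃ k : ℝ → ℝ → ℝ≥0∞, k = fun t τ => k₀ (t, τ) := ⟨_, rfl⟩
  have hk1 : ∀ t τ, τ ≤ t → k t τ = eLpNorm (propagatorL2 hP (-(t - τ)) (H τ)) ∞ volume := by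
    intro t τ h
    rw [hk, hk₀]
    exact indicator_of_mem (show (t, τ) ∈ {x : ℝ × ℝ | x.2 ≤ x.1} from h) _
  have hk2 : ∀ t τ, ¬ τ ≤ t → k t τ = 0 := by
    intro t τ h
    rw [hk, hk₀]
    exact indicator_of_notMem (show (t, τ) ∉ {x : ℝ × ℝ | x.2 ≤ x.1} from h) _
  have hsm : StronglyMeasurable fun x : ℝ × ℝ => propagatorL2 hP (-(x.1 - x.2)) (H x.2) := by
    exact stronglyMeasurable_propagatorL2 hP
      (by fun_prop : Continuous fun x : ℝ × ℝ => -(x.1 - x.2)).stronglyMeasurable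
      (hH.comp_measurable measurable_snd)
  have hk₀m : Measurable k₀ := by
    rw [hk₀]
    exact Measurable.indicator ((measurable_eLpNorm_L2 ∞).comp hsm.measurable)
      (measurableSet_le measurable_snd measurable_fst)
  have hkm : Measurable (Function.uncurry k) := by
    have : Function.uncurry k = k₀ := by
      ext ⟨t, τ⟩
      rw [hk]
      rfl
    rwa [this]
  have hstep : ∀ t ∈ Icc 0 T, eLpNorm
      (∫ τ in (0 : ℝ)..t, propagatorL2 hP (-(t - τ)) (H τ) : L2 d) ∞ volume ≤
      ∫⁻ τ in Icc 0 T, k t τ := by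
    intro t ht
    rw [intervalIntegral.integral_of_le ht.1]
    have hsmt : StronglyMeasurable fun τ : ℝ => propagatorL2 hP (-(t - τ)) (H τ) :=
      stronglyMeasurable_propagatorL2 hP
        (by fun_prop : Continuous fun τ : ℝ => -(t - τ)).stronglyMeasurable hH
    refine (eLpNorm_integral_L2_le le_top hsmt).trans ?_
    calc _ = ∫⁻ τ in Ioc 0 t, k t τ := by
          refine setLIntegral_congr_fun measurableSet_Ioc fun τ hτ => ?_
          exact (hk1 t τ hτ.2).symm
      _ ≤ _ := lintegral_mono_set (fun τ hτ => ⟨hτ.1.le, hτ.2.trans ht.2⟩ : Ioc 0 t ⊆ Icc 0 T)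
  calc _ ≤ ∫⁻ t in Icc 0 T, (∫⁻ τ in Icc 0 T, k t τ) ^ p₁ :=
        setLIntegral_mono' measurableSet_Icc fun t ht =>
          ENNReal.rpow_le_rpow (hstep t ht) hp0.le
    _ ≤ (∫⁻ τ in Icc 0 T, C' * h τ) ^ p₁ := by
        refine lintegral_lintegral_rpow_le hp₁ hkm (hh.const_mul C') ?_ ?_
        · rw [lintegral_const_mul _ hh]
          exact ENNReal.mul_ne_top hC' hfin
        · rw [ae_restrict_iff' measurableSet_Icc]
          have hhfin : ∀ᵐ τ, τ ∈ Icc 0 T → h τ < ∞ :=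
            (ae_restrict_iff' measurableSet_Icc).1 (ae_lt_top hh hfin)
          filter_upwards [hle, hhfin] with τ h1 h2 hτ
          have h3 := hmain (H τ) (ne_top_of_le_ne_top (h2 hτ).ne (h1 hτ))
          refine le_trans ?_ (h3.trans (ENNReal.rpow_le_rpow (by gcongr; exact h1 hτ) hp0.le))
          -- For fixed τ, the translation t ↦ t - τ carries [τ, T] into [0, T₀], where the
          -- homogeneous estimate for H(τ) applies.
          rw [← lintegral_indicator measurableSet_Icc, ← lintegral_indicator measurableSet_Icc,
            ← lintegral_sub_right_eq_self ((Icc 0 T₀).indicator _) τ]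
          refine lintegral_mono fun t => ?_
          dsimp only
          by_cases ht : t ∈ Icc 0 T
          · rw [indicator_of_mem ht]
            by_cases htτ : τ ≤ t
            · rw [indicator_of_mem (show t - τ ∈ Icc 0 T₀ from
                ⟨by linarith, by linarith [ht.2, hτ.1]⟩)]
              rw [hk1 t τ htτ]
            · rw [hk2 t τ htτ, ENNReal.zero_rpow_of_pos hp0]
              exact zero_le
          · rw [indicator_of_notMem ht]
            exact zero_le
    _ = _ := by rw [lintegral_const_mul _ hh]

end

/-! ### Positively homogeneous functions, and the power nonlinearity -/

section Homogeneous

universe uH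
variable {E : Type uH} [NormedAddCommGroup E] [NormedSpace ℝ E]

/-- `f` is positively homogeneous of degree `a` and smooth away from the origin. -/
structure SmoothHomogeneous (a : ℝ) (f : ℂ → E) : Prop where
  contDiffOn : ContDiffOn ℝ (⊤ : ℕ∞) f {0}ᶜ
  map_smul : ∀ t : ℝ, 0 < t → ∀ z, f (t • z) = t ^ a • f z

namespace SmoothHomogeneous

/-- Differentiate f(tz) = t^a f(z) in z. The identity persists at the origin even if f is not
differentiable there, since `fderiv` is then 0. -/
theorem fderiv {a : ℝ} {f : ℂ → E} (hf : SmoothHomogeneous a f) :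
    SmoothHomogeneous (a - 1) (fderiv ℝ f) where
  contDiffOn := hf.contDiffOn.fderiv_of_isOpen isOpen_compl_singleton (by simp)
  map_smul t ht z := by
    have h1 := fderiv_comp_smul (𝕜 := ℝ) (f := f) (x := z) t
    have h2 : (fun x => f (t • x)) = t ^ a • f := funext fun x => hf.map_smul t ht x
    rw [h2, fderiv_const_smul_field] at h1
    rw [Real.rpow_sub_one ht.ne', div_eq_inv_mul, mul_smul, Pi.smul_apply] at *
    rw [h1, smul_smul, inv_mul_cancel₀ ht.ne', one_smul]

theorem clm_comp {F : Type*} [NormedAddCommGroup F] [NormedSpace ℝ F] {a : ℝ} {f : ℂ → E}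
    (hf : SmoothHomogeneous a f) (L : E →L[ℝ] F) : SmoothHomogeneous a (L ∘ f) where
  contDiffOn := L.contDiff.comp_contDiffOn hf.contDiffOn
  map_smul t ht z := by rw [Function.comp_apply, hf.map_smul t ht z, _root_.map_smul, Function.comp_apply]

theorem iteratedFDeriv {a : ℝ} {f : ℂ → E} (hf : SmoothHomogeneous a f) (n : ℕ) :
    SmoothHomogeneous (a - n) (iteratedFDeriv ℝ n f) := by
  induction n with
  | zero =>
    rw [iteratedFDeriv_zero_eq_comp]
    simpa using hf.clm_comp
      (continuousMultilinearCurryFin0 ℝ ℂ E).symm.toContinuousLinearEquiv.toContinuousLinearMap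
  | succ n ih =>
    rw [iteratedFDeriv_succ_eq_comp_left, show a - ((n + 1 : ℕ) : ℝ) = a - n - 1 by push_cast; ring]
    exact ih.fderiv.clm_comp (continuousMultilinearCurryLeftEquiv ℝ
      (fun _ : Fin (n + 1) => ℂ) E).symm.toContinuousLinearEquiv.toContinuousLinearMap

/-- Compactness of the unit circle and scaling. -/
theorem exists_norm_le {a : ℝ} {f : ℂ → E} (hf : SmoothHomogeneous a f) :
    ∃ C, 0 ≤ C ∧ ∀ z ≠ 0, ‖f z‖ ≤ C * ‖z‖ ^ a := by
  obtain ⟨C, hC⟩ := (isCompact_sphere (0 : ℂ) 1).exists_bound_of_continuousOn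
    (hf.contDiffOn.continuousOn.mono fun z hz h0 => by
      rw [mem_singleton_iff] at h0; simp [h0] at hz)
  refine ⟨C, (norm_nonneg _).trans (hC 1 (by simp)), fun z hz => ?_⟩
  have hz' : 0 < ‖z‖ := norm_pos_iff.2 hz
  have h1 : z = ‖z‖ • (‖z‖⁻¹ • z) := by rw [smul_smul, mul_inv_cancel₀ hz'.ne', one_smul]
  have h2 := hC (‖z‖⁻¹ • z) (by simp [hz'.ne'])
  calc ‖f z‖ = ‖z‖ ^ a * ‖f (‖z‖⁻¹ • z)‖ := by
        conv_lhs => rw [h1, hf.map_smul _ hz', norm_smul, Real.norm_of_nonneg (by positivity)]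
    _ ≤ C * ‖z‖ ^ a := by rw [mul_comm C]; gcongr

theorem apply_zero {a : ℝ} {f : ℂ → E} (hf : SmoothHomogeneous a f) (ha : 0 < a) : f 0 = 0 := by
  have h := hf.map_smul 2 two_pos 0
  rw [smul_zero] at h
  have h1 : (1 : ℝ) < 2 ^ a := Real.one_lt_rpow one_lt_two ha
  have h2 : ((2 : ℝ) ^ a - 1) • f 0 = 0 := by rw [sub_smul, one_smul, ← h, sub_self]
  exact (smul_eq_zero.1 h2).resolve_left (by linarith)

theorem exists_norm_le' {a : ℝ} {f : ℂ → E} (hf : SmoothHomogeneous a f) (ha : 0 < a) :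
    ∃ C, 0 ≤ C ∧ ∀ z, ‖f z‖ ≤ C * ‖z‖ ^ a := by
  obtain ⟨C, hC, h⟩ := hf.exists_norm_le
  refine ⟨C, hC, fun z => ?_⟩
  rcases eq_or_ne z 0 with rfl | hz
  · rw [hf.apply_zero ha, norm_zero]; positivity
  · exact h z hz

theorem hasFDerivAt_zero {a : ℝ} {f : ℂ → E} (hf : SmoothHomogeneous a f) (ha : 1 < a) :
    HasFDerivAt f (0 : ℂ →L[ℝ] E) 0 := by
  obtain ⟨C, hC, h⟩ := hf.exists_norm_le' (by linarith)
  rw [hasFDerivAt_iff_isLittleO_nhds_zero]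
  simp only [zero_add, hf.apply_zero (by linarith), sub_zero, _root_.zero_apply]
  refine (Asymptotics.IsBigO.of_bound C (Eventually.of_forall fun z => ?_) :
    f =O[𝓝 0] fun z => ‖z‖ ^ a).trans_isLittleO ?_
  · rw [Real.norm_of_nonneg (by positivity : 0 ≤ ‖z‖ ^ a)]; exact h z
  · have h1 : Tendsto (fun z : ℂ => ‖z‖ ^ (a - 1)) (𝓝 0) (𝓝 0) := by
      have : Continuous fun z : ℂ => ‖z‖ ^ (a - 1) :=
        continuous_norm.rpow_const fun _ => Or.inr (by linarith)
      simpa [Real.zero_rpow (by linarith : a - 1 ≠ 0)] using this.tendsto 0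
    have h2 := (Asymptotics.isLittleO_one_iff ℝ).2 h1
    have h3 := h2.mul_isBigO (Asymptotics.isBigO_refl (fun z : ℂ => ‖z‖) (𝓝 0))
    simp only [one_mul] at h3
    refine (h3.congr_left fun z => ?_).of_norm_right
    rcases eq_or_ne z 0 with rfl | hz
    · simp [Real.zero_rpow (by linarith : a ≠ 0)]
    · rw [Real.rpow_sub_one (norm_ne_zero_iff.2 hz), div_mul_cancel₀ _ (norm_ne_zero_iff.2 hz)]

theorem continuous {a : ℝ} {f : ℂ → E} (hf : SmoothHomogeneous a f) (ha : 0 < a) :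
    Continuous f := by
  rw [continuous_iff_continuousAt]
  intro z
  rcases eq_or_ne z 0 with rfl | hz
  · obtain ⟨C, hC, h⟩ := hf.exists_norm_le' ha
    rw [ContinuousAt, hf.apply_zero ha]
    refine squeeze_zero_norm h ?_
    have : Continuous fun z : ℂ => C * ‖z‖ ^ a :=
      continuous_const.mul (continuous_norm.rpow_const fun _ => Or.inr ha.le)
    simpa [Real.zero_rpow ha.ne'] using this.tendsto 0
  · exact hf.contDiffOn.continuousOn.continuousAt (isOpen_compl_singleton.mem_nhds hz)

theorem differentiableAt {a : ℝ} {f : ℂ → E} (hf : SmoothHomogeneous a f) {z : ℂ} (hz : z ≠ 0) :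
    DifferentiableAt ℝ f z :=
  (hf.contDiffOn.contDiffAt (isOpen_compl_singleton.mem_nhds hz)).differentiableAt (by simp)

theorem differentiable {a : ℝ} {f : ℂ → E} (hf : SmoothHomogeneous a f) (ha : 1 < a) :
    Differentiable ℝ f := fun z => by
  rcases eq_or_ne z 0 with rfl | hz
  · exact (hf.hasFDerivAt_zero ha).differentiableAt
  · exact hf.differentiableAt hz

end SmoothHomogeneous

end Homogeneous

namespace SmoothHomogeneous

theorem contDiff {E : Type*} [NormedAddCommGroup E] [NormedSpace ℝ E] {a : ℝ} {f : ℂ → E}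
    (hf : SmoothHomogeneous a f) {n : ℕ} (hn : n < a) : ContDiff ℝ n f := by
  induction n generalizing E a with
  | zero => exact contDiff_zero.2 (hf.continuous (by simpa using hn))
  | succ n ih =>
    push_cast at hn ⊢
    refine contDiff_succ_iff_fderiv.2
      ⟨hf.differentiable ?_, fun h => absurd h (by simp), ih hf.fderiv (by linarith)⟩
    have : (0 : ℝ) ≤ n := n.cast_nonneg
    linarith

/-- A homogeneous function of degree `β > 0` is locally Hölder continuous with every exponent
`θ ≤ min 1 β`. -/
theorem exists_holder {E : Type*} [NormedAddCommGroup E] [NormedSpace ℝ E] {β : ℝ} {g : ℂ → E}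
    (hg : SmoothHomogeneous β g) {θ : ℝ} (hθ : 0 < θ) (hθ1 : θ ≤ 1) (hθβ : θ ≤ β) (κ : ℝ) :
    ∃ C, 0 ≤ C ∧ ∀ x y, ‖x‖ ≤ κ → ‖y‖ ≤ κ → ‖g x - g y‖ ≤ C * ‖x - y‖ ^ θ := by
  rcases lt_or_ge κ 0 with hκ | hκ
  · exact ⟨0, le_rfl, fun x y hx => absurd (hx.trans_lt hκ) (norm_nonneg x).not_gt⟩
  obtain ⟨C₁, hC₁, h₁⟩ := hg.exists_norm_le' (hθ.trans_le hθβ)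
  obtain ⟨C₂, hC₂, h₂⟩ := hg.fderiv.exists_norm_le
  -- L bounds ρ^{β-1} for 1/2 ≤ ρ ≤ 3/2, whatever the sign of β - 1.
  set L : ℝ := (1 / 2 : ℝ) ^ (β - 1) + (3 / 2) ^ (β - 1)
  have hL : 0 ≤ L := by positivity
  set C := 2 * C₁ * κ ^ (β - θ) * 2 ^ θ + C₂ * L * κ ^ (β - θ)
  have key : ∀ x y, ‖x‖ ≤ κ → ‖y‖ ≤ ‖x‖ → ‖g x - g y‖ ≤ C * ‖x - y‖ ^ θ := by
    intro x y hx hyx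
    rcases eq_or_ne x 0 with rfl | hx0
    · have : y = 0 := by simpa using hyx
      subst this
      simp [Real.zero_rpow hθ.ne']
    have hx0' : 0 < ‖x‖ := norm_pos_iff.2 hx0
    -- If |x - y| ≥ |x|/2, the sizes of g(x) and g(y) suffice. Otherwise the segment stays in the
    -- ball of radius |x|/2 about x, away from the origin; the mean value inequality applies there,
    -- and |x|^{θ-1} ≤ |x - y|^{θ-1} turns the Lipschitz bound into a Hölder bound.
    rcases le_or_gt (‖x‖ / 2) ‖x - y‖ with h | h
    · calc ‖g x - g y‖ ≤ C₁ * ‖x‖ ^ β + C₁ * ‖y‖ ^ β :=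
            (norm_sub_le _ _).trans (add_le_add (h₁ x) (h₁ y))
        _ ≤ C₁ * ‖x‖ ^ β + C₁ * ‖x‖ ^ β := by
            gcongr
            linarith
        _ = 2 * C₁ * (‖x‖ ^ (β - θ) * ‖x‖ ^ θ) := by
            rw [← Real.rpow_add hx0']; ring_nf
        _ ≤ 2 * C₁ * (κ ^ (β - θ) * (2 * ‖x - y‖) ^ θ) := by
            gcongr
            linarith
        _ = 2 * C₁ * κ ^ (β - θ) * 2 ^ θ * ‖x - y‖ ^ θ := by
            rw [Real.mul_rpow two_pos.le (norm_nonneg _)]; ring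
        _ ≤ C * ‖x - y‖ ^ θ := by
            gcongr
            exact le_add_of_nonneg_right (by positivity)
    · have hball : ∀ z ∈ Metric.ball x (‖x‖ / 2), ‖x‖ / 2 < ‖z‖ ∧ ‖z‖ < 3 / 2 * ‖x‖ := by
        intro z hz
        rw [mem_ball_iff_norm] at hz
        have h3 := norm_sub_norm_le x z
        have h4 := norm_sub_norm_le z x
        rw [norm_sub_rev] at h3
        constructor <;> linarith
      have hd : ∀ z ∈ Metric.ball x (‖x‖ / 2), ‖_root_.fderiv ℝ g z‖ ≤ C₂ * L * ‖x‖ ^ (β - 1) := by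
        intro z hz
        obtain ⟨h3, h4⟩ := hball z hz
        have hz0 : z ≠ 0 := norm_pos_iff.1 (by linarith)
        refine (h₂ z hz0).trans ?_
        rw [mul_assoc]
        gcongr
        have hz' : ‖z‖ = (‖z‖ / ‖x‖) * ‖x‖ := by field_simp
        rw [hz', Real.mul_rpow (by positivity) hx0'.le]
        gcongr
        have h5 : 1 / 2 ≤ ‖z‖ / ‖x‖ := by rw [le_div_iff₀ hx0']; linarith
        have h6 : ‖z‖ / ‖x‖ ≤ 3 / 2 := by rw [div_le_iff₀ hx0']; linarith
        rcases le_total 0 (β - 1) with hb | hb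
        · exact (Real.rpow_le_rpow (by positivity) h6 hb).trans
            (le_add_of_nonneg_left (by positivity))
        · exact (Real.rpow_le_rpow_of_nonpos (by positivity) h5 hb).trans
            (le_add_of_nonneg_right (by positivity))
      have h7 := (convex_ball x (‖x‖ / 2)).norm_image_sub_le_of_norm_fderiv_le (𝕜 := ℝ)
        (fun z hz => hg.differentiableAt (norm_pos_iff.1 (by linarith [(hball z hz).1]))) hd
        (show y ∈ Metric.ball x (‖x‖ / 2) by rw [mem_ball_iff_norm, norm_sub_rev]; exact h)
        (Metric.mem_ball_self (by positivity))
      rcases eq_or_ne x y with rfl | hxy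
      · simp [Real.zero_rpow hθ.ne']
      have hxy' : 0 < ‖x - y‖ := norm_pos_iff.2 (sub_ne_zero.2 hxy)
      calc ‖g x - g y‖ ≤ C₂ * L * ‖x‖ ^ (β - 1) * ‖x - y‖ := h7
        _ = C₂ * L * (‖x‖ ^ (β - θ) * ‖x‖ ^ (θ - 1)) * ‖x - y‖ := by
            rw [← Real.rpow_add hx0']; ring_nf
        _ ≤ C₂ * L * (κ ^ (β - θ) * ‖x - y‖ ^ (θ - 1)) * ‖x - y‖ := by
            gcongr ?_ * (?_ * ?_) * ?_
            · exact Real.rpow_le_rpow hx0'.le hx (by linarith)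
            · exact Real.rpow_le_rpow_of_nonpos hxy' (by linarith) (by linarith)
        _ = C₂ * L * κ ^ (β - θ) * ‖x - y‖ ^ θ := by
            rw [Real.rpow_sub_one hxy'.ne']; field_simp
        _ ≤ C * ‖x - y‖ ^ θ := by
            gcongr
            exact le_add_of_nonneg_left (by positivity)
  refine ⟨C, by positivity, fun x y hx hy => ?_⟩
  rcases le_total ‖y‖ ‖x‖ with h | h
  · exact key x y hx h
  · rw [norm_sub_rev, norm_sub_rev x]
    exact key y x hy h

end SmoothHomogeneous

/-- The power nonlinearity `|z|^b z`. -/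
def powNonlin (b : ℝ) (z : ℂ) : ℂ := ((‖z‖ ^ b : ℝ) : ℂ) * z

theorem smoothHomogeneous_powNonlin (b : ℝ) : SmoothHomogeneous (b + 1) (powNonlin b) where
  contDiffOn := by
    intro z hz
    refine ContDiffAt.contDiffWithinAt ?_
    unfold powNonlin
    refine ContDiffAt.mul ?_ contDiffAt_id
    exact Complex.ofRealCLM.contDiff.contDiffAt.comp z
      ((contDiffAt_norm ℝ hz).rpow_const_of_ne (norm_ne_zero_iff.2 hz))
  map_smul t ht z := by
    rw [powNonlin, powNonlin, norm_smul, Real.norm_of_nonneg ht.le,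
      Real.mul_rpow ht.le (norm_nonneg _), Real.rpow_add_one ht.ne']
    simp only [Complex.real_smul]
    push_cast
    ring

theorem contDiff_powNonlin_two_mul (n : ℕ) (m : ℕ∞) : ContDiff ℝ m (powNonlin (2 * n)) := by
  have h : powNonlin (2 * n) = fun z => (((‖z‖ ^ 2) ^ n : ℝ) : ℂ) * z := by
    ext z
    rw [powNonlin, ← pow_mul, ← Real.rpow_natCast]
    push_cast
    rfl
  rw [h]
  exact (Complex.ofRealCLM.contDiff.comp ((contDiff_norm_sq ℝ).pow n)).mul contDiff_id

/-- A `C^r` function on `ℂ`, all of whose derivatives up to order `r` are bounded and `θ`-Hölder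
on balls. -/
structure LocallyHolder (r : ℕ) (θ : ℝ) (F : ℂ → ℂ) : Prop where
  contDiff : ContDiff ℝ r F
  pos : 0 < θ
  le_one : θ ≤ 1
  exists_bound : ∀ κ, ∃ C, 0 ≤ C ∧ ∀ j ≤ r, ∀ x y, ‖x‖ ≤ κ → ‖y‖ ≤ κ →
    ‖iteratedFDeriv ℝ j F x‖ ≤ C ∧
    ‖iteratedFDeriv ℝ j F x - iteratedFDeriv ℝ j F y‖ ≤ C * ‖x - y‖ ^ θ

/-- A bound for each `j ≤ r` gives a common bound. -/
theorem LocallyHolder.of_forall {r : ℕ} {θ : ℝ} {F : ℂ → ℂ} (hF : ContDiff ℝ r F) (h0 : 0 < θ)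
    (h1 : θ ≤ 1) (h : ∀ κ, ∀ j ≤ r, ∃ C, 0 ≤ C ∧ ∀ x y, ‖x‖ ≤ κ → ‖y‖ ≤ κ →
      ‖iteratedFDeriv ℝ j F x - iteratedFDeriv ℝ j F y‖ ≤ C * ‖x - y‖ ^ θ) :
    LocallyHolder r θ F := by
  refine ⟨hF, h0, h1, fun κ => ?_⟩
  have hb : ∀ j, ∃ C, 0 ≤ C ∧ (j ≤ r → ∀ x y, ‖x‖ ≤ κ → ‖y‖ ≤ κ →
      ‖iteratedFDeriv ℝ j F x‖ ≤ C ∧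
      ‖iteratedFDeriv ℝ j F x - iteratedFDeriv ℝ j F y‖ ≤ C * ‖x - y‖ ^ θ) := by
    intro j
    by_cases hj : j ≤ r
    · obtain ⟨C, hC, hC'⟩ := h κ j hj
      obtain ⟨C₂, hC₂⟩ := (isCompact_closedBall (0 : ℂ) κ).exists_bound_of_continuousOn
        (hF.continuous_iteratedFDeriv (m := j) (by exact_mod_cast hj)).continuousOn
      refine ⟨max C C₂, hC.trans (le_max_left _ _), fun _ x y hx hy => ⟨?_, ?_⟩⟩
      · exact (hC₂ x (by simpa using hx)).trans (le_max_right _ _)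
      · refine (hC' x y hx hy).trans ?_
        gcongr
        exact le_max_left _ _
    · exact ⟨0, le_rfl, fun h => absurd h hj⟩
  choose C hC hC' using hb
  refine ⟨∑ j ∈ Finset.range (r + 1), C j, Finset.sum_nonneg fun j _ => hC j,
    fun j hj x y hx hy => ?_⟩
  have hle : C j ≤ ∑ j ∈ Finset.range (r + 1), C j :=
    Finset.single_le_sum (fun j _ => hC j) (Finset.mem_range.2 (by omega))
  refine ⟨(hC' j hj x y hx hy).1.trans hle, (hC' j hj x y hx hy).2.trans ?_⟩
  gcongr

/-- If b is an even integer, |z|^b z is smooth and θ = 1 works. Otherwise the j-th derivative is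
homogeneous of degree b + 1 - j ≥ b + 1 - r > 0, hence Hölder continuous with exponent min(1, b + 1
- r). The condition θ ≤ b keeps the exponent b - θ in later estimates nonnegative. -/
theorem exists_locallyHolder_powNonlin {b : ℝ} (hb : 0 < b) {r : ℕ}
    (h : (∃ n : ℕ, b = 2 * n) ∨ r < b + 1) :
    ∃ θ, θ ≤ b ∧ LocallyHolder r θ (powNonlin b) := by
  rcases h with ⟨n, hn⟩ | h
  · have hn1 : 1 ≤ b := by
      have : 0 < n := by
        by_contra h0
        have : n = 0 := by omega
        subst this
        simp at hn
        linarith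
      have : (1 : ℝ) ≤ n := by exact_mod_cast this
      linarith
    have hsm : ∀ m : ℕ∞, ContDiff ℝ m (powNonlin b) := hn ▸ contDiff_powNonlin_two_mul n
    refine ⟨1, hn1, LocallyHolder.of_forall (hsm r) one_pos le_rfl fun κ j _ => ?_⟩
    have h1 : ContDiff ℝ 1 (iteratedFDeriv ℝ j (powNonlin b)) :=
      (hsm (j + 1 : ℕ)).iteratedFDeriv_right (m := 1) (by
        rw [add_comm]; norm_cast)
    obtain ⟨K, hK⟩ := h1.contDiffOn.exists_lipschitzOnWith one_ne_zero
      (convex_closedBall (0 : ℂ) κ) (isCompact_closedBall (0 : ℂ) κ)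
    refine ⟨K, K.2, fun x y hx hy => ?_⟩
    have := hK.norm_sub_le (x := x) (y := y) (by simpa using hx) (by simpa using hy)
    simpa using this
  · have hs := smoothHomogeneous_powNonlin b
    refine ⟨min (min 1 b) (b + 1 - r), (min_le_left _ _).trans (min_le_right _ _),
      LocallyHolder.of_forall (hs.contDiff h) ?_ ((min_le_left _ _).trans (min_le_left _ _))
      fun κ j hj => (hs.iteratedFDeriv j).exists_holder ?_
        ((min_le_left _ _).trans (min_le_left _ _)) ?_ κ⟩
    · exact lt_min (lt_min one_pos hb) (by linarith)
    · exact lt_min (lt_min one_pos hb) (by linarith)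
    · refine (min_le_right _ _).trans ?_
      have : (j : ℝ) ≤ r := by exact_mod_cast hj
      linarith

theorem norm_powNonlin (b : ℝ) (z : ℂ) : ‖powNonlin b z‖ = ‖z‖ ^ b * ‖z‖ := by
  rw [powNonlin, norm_mul, Complex.norm_real, Real.norm_of_nonneg (by positivity)]

theorem contDiff_powNonlin {b : ℝ} (hb : 0 < b) : ContDiff ℝ 1 (powNonlin b) :=
  (smoothHomogeneous_powNonlin b).contDiff (n := 1) (by simpa using hb)

theorem exists_norm_fderiv_powNonlin_le {b : ℝ} (hb : 0 < b) :
    ∃ C, 0 ≤ C ∧ ∀ z, ‖fderiv ℝ (powNonlin b) z‖ ≤ C * ‖z‖ ^ b := by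
  have := (smoothHomogeneous_powNonlin b).fderiv.exists_norm_le'
  rw [add_sub_cancel_right] at this
  exact this hb

/-- `||x|^b x - |y|^b y| ≤ C M^b |x - y|` on the ball of radius `M`. -/
theorem exists_norm_powNonlin_sub_le {b : ℝ} (hb : 0 < b) :
    ∃ C, 0 ≤ C ∧ ∀ M x y, ‖x‖ ≤ M → ‖y‖ ≤ M →
      ‖powNonlin b x - powNonlin b y‖ ≤ C * M ^ b * ‖x - y‖ := by
  obtain ⟨C, hC, h⟩ := exists_norm_fderiv_powNonlin_le hb
  refine ⟨C, hC, fun M x y hx hy => ?_⟩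
  refine (convex_closedBall (0 : ℂ) M).norm_image_sub_le_of_norm_fderiv_le (𝕜 := ℝ)
    (fun z _ => (contDiff_powNonlin hb).differentiable one_ne_zero z) (fun z hz => ?_)
    (by simpa using hy) (by simpa using hx)
  refine (h z).trans ?_
  have : ‖z‖ ≤ M := by simpa using hz
  gcongr

/-- Second differences of a `C^{1,θ}` function. -/
theorem LocallyHolder.exists_second_difference_le {r : ℕ} {θ : ℝ} {F : ℂ → ℂ}
    (hF : LocallyHolder r θ F) (hr : 1 ≤ r) (κ : ℝ) :
    ∃ C, 0 ≤ C ∧ ∀ u v u' v', ‖u‖ ≤ κ → ‖v‖ ≤ κ → ‖u'‖ ≤ κ → ‖v'‖ ≤ κ →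
      ‖(F u - F v) - (F u' - F v')‖ ≤
        C * (‖(u - v) - (u' - v')‖ + ‖u - v‖ ^ θ * ‖v - v'‖) := by
  -- The radius 3κ accommodates the auxiliary point v' + (u - v).
  obtain ⟨C, hC, h⟩ := hF.exists_bound (3 * κ)
  have hd : Differentiable ℝ F := hF.contDiff.differentiable (by exact_mod_cast (by omega : r ≠ 0))
  have hnorm : ∀ x y, ‖fderiv ℝ F x - fderiv ℝ F y‖ =
      ‖iteratedFDeriv ℝ 1 F x - iteratedFDeriv ℝ 1 F y‖ := by
    intro x y
    rw [← (continuousMultilinearCurryFin1 ℝ ℂ ℂ).symm.norm_map, map_sub]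
    congr 1
    ext m
    simp [iteratedFDeriv_one_apply]
  refine ⟨C, hC, fun u v u' v' hu hv hu' hv' => ?_⟩
  have hκ : 0 ≤ κ := (norm_nonneg _).trans hu
  -- The first bracket is the variation between v' and v of z ↦ F(z + (u - v)) - F(z), whose
  -- derivative is O(|u - v|^θ). The remainder is a Lipschitz term in (u - v) - (u' - v').
  have e1 : (F u - F v) - (F u' - F v') = ((F (v + (u - v)) - F v) - (F (v' + (u - v)) - F v')) +
      (F (v' + (u - v)) - F u') := by rw [add_sub_cancel]; ring
  have hw : ‖u - v‖ ≤ 2 * κ := (norm_sub_le _ _).trans (by linarith)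
  have h1 : ‖F (v' + (u - v)) - F u'‖ ≤ C * ‖(u - v) - (u' - v')‖ := by
    have := (convex_closedBall (0 : ℂ) (3 * κ)).norm_image_sub_le_of_norm_fderiv_le (𝕜 := ℝ)
      (f := F) (C := C) (fun z _ => hd z) (fun z hz => ?_)
      (show u' ∈ _ by rw [mem_closedBall_zero_iff]; linarith)
      (show v' + (u - v) ∈ _ by
        rw [mem_closedBall_zero_iff]; exact (norm_add_le _ _).trans (by linarith))
    · rwa [show v' + (u - v) - u' = (u - v) - (u' - v') by ring] at this
    · have h3 := (h 1 hr z z (by simpa using hz) (by simpa using hz)).1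
      rwa [norm_iteratedFDeriv_one] at h3
  have h2 : ‖(F (v + (u - v)) - F v) - (F (v' + (u - v)) - F v')‖ ≤
      C * ‖u - v‖ ^ θ * ‖v - v'‖ := by
    refine (convex_closedBall (0 : ℂ) κ).norm_image_sub_le_of_norm_fderiv_le (𝕜 := ℝ)
      (f := fun z => F (z + (u - v)) - F z) (fun z _ => ?_) (fun z hz => ?_)
      (by simpa using hv') (by simpa using hv)
    · fun_prop
    · have hz : ‖z‖ ≤ κ := by simpa using hz
      rw [fderiv_fun_sub (by fun_prop) (by fun_prop), fderiv_comp_add_right, hnorm]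
      have h3 := (h 1 hr (z + (u - v)) z ((norm_add_le _ _).trans (by linarith))
        (by linarith)).2
      rwa [add_sub_cancel_left] at h3
  rw [e1]
  refine (norm_add_le _ _).trans ((add_le_add h2 h1).trans (le_of_eq ?_))
  ring

/-! ### Gagliardo–Nirenberg inequalities along a direction -/

/-- `V j` is the `j`-th derivative of `V 0` in the direction `e`; all of these are continuous,
bounded and square integrable. -/
structure SmoothAlong (e : Rd d) (V : ℕ → Rd d → ℂ) : Prop where
  hasLineDerivAt : ∀ j x, HasLineDerivAt ℝ (V j) (V (j + 1) x) x e
  continuous : ∀ j, Continuous (V j)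
  memLp : ∀ j, MemLp (V j) 2 volume
  bounded : ∀ j, ∃ C, ∀ x, ‖V j x‖ ≤ C

theorem smoothAlong_lowFreqDeriv (n : ℕ) (e : Rd d) (f : L2 d) :
    SmoothAlong e (lowFreqDeriv n e f) where
  hasLineDerivAt := lowFreqDeriv_hasLineDerivAt n e f
  continuous := continuous_lowFreqDeriv n e f
  memLp := memLp_lowFreqDeriv n e f
  bounded j := ⟨_, norm_lowFreqDeriv_le n e f j⟩

theorem continuous_powNonlin {b : ℝ} (hb : 0 < b) : Continuous (powNonlin b) :=
  (contDiff_powNonlin hb).continuous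

/-- Integration by parts for `∫ |∂f|^{b+2}`. -/
theorem exists_lintegral_rpow_deriv_le {b : ℝ} (hb : 0 < b) :
    ∃ C : ℝ≥0∞, C ≠ ∞ ∧ ∀ {e : Rd d} {V : ℕ → Rd d → ℂ}, SmoothAlong e V → ∀ j,
      ∫⁻ x, ‖V (j + 1) x‖ₑ ^ (b + 2) ≤
        C * ∫⁻ x, ‖V j x‖ₑ * ‖V (j + 1) x‖ₑ ^ b * ‖V (j + 2) x‖ₑ := by
  obtain ⟨C, hC, hder⟩ := exists_norm_fderiv_powNonlin_le hb
  refine ⟨ENNReal.ofReal C, ENNReal.ofReal_ne_top, fun {e V} hV j => ?_⟩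
  obtain ⟨K, hK⟩ := hV.bounded (j + 1)
  -- N is the conjugate of |V_{j+1}|^b V_{j+1}, so V_{j+1} N = |V_{j+1}|^{b+2}. It is differentiable
  -- along e because b > 0, and the derivative on V_{j+1} is moved onto it.
  set N : Rd d → ℂ := fun x => starRingEnd ℂ (powNonlin b (V (j + 1) x))
  set N' : Rd d → ℂ := fun x => starRingEnd ℂ (fderiv ℝ (powNonlin b) (V (j + 1) x) (V (j + 2) x))
  have hNd : ∀ x, HasLineDerivAt ℝ N (N' x) x e := by
    intro x
    have h1 : HasDerivAt (fun t : ℝ => V (j + 1) (x + t • e)) (V (j + 2) x) 0 :=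
      hV.hasLineDerivAt (j + 1) x
    have h2 : HasFDerivAt (powNonlin b) (fderiv ℝ (powNonlin b) (V (j + 1) x))
        (V (j + 1) (x + (0 : ℝ) • e)) := by
      rw [zero_smul, add_zero]
      exact ((contDiff_powNonlin hb).differentiable one_ne_zero _).hasFDerivAt
    have h3 : HasDerivAt (fun t : ℝ => powNonlin b (V (j + 1) (x + t • e)))
        (fderiv ℝ (powNonlin b) (V (j + 1) x) (V (j + 2) x)) 0 :=
      HasFDerivAt.comp_hasDerivAt (l := powNonlin b) (f := fun t : ℝ => V (j + 1) (x + t • e))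
        (0 : ℝ) h2 h1
    exact (Complex.conjCLE.toContinuousLinearMap.hasFDerivAt).comp_hasDerivAt (0 : ℝ) h3
  have hNc : Continuous N :=
    Complex.continuous_conj.comp ((continuous_powNonlin hb).comp (hV.continuous (j + 1)))
  have hN'c : Continuous N' := by
    refine Complex.continuous_conj.comp (Continuous.clm_apply ?_ (hV.continuous (j + 2)))
    exact ((contDiff_powNonlin hb).continuous_fderiv one_ne_zero).comp (hV.continuous (j + 1))
  have hNle : ∀ x, ‖N x‖ ≤ K ^ b * ‖V (j + 1) x‖ := by
    intro x
    rw [RCLike.norm_conj, norm_powNonlin]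
    gcongr
    exact hK x
  have hN'le : ∀ x, ‖N' x‖ ≤ C * ‖V (j + 1) x‖ ^ b * ‖V (j + 2) x‖ := by
    intro x
    rw [RCLike.norm_conj]
    refine (ContinuousLinearMap.le_opNorm _ _).trans ?_
    gcongr
    exact hder _
  have hN'le' : ∀ x, ‖N' x‖ ≤ C * K ^ b * ‖V (j + 2) x‖ := by
    intro x
    refine (hN'le x).trans ?_
    gcongr
    exact hK x
  have hNm : MemLp N 2 volume :=
    (hV.memLp (j + 1)).of_le_mul hNc.aestronglyMeasurable (Eventually.of_forall hNle)
  have hN'm : MemLp N' 2 volume :=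
    (hV.memLp (j + 2)).of_le_mul hN'c.aestronglyMeasurable (Eventually.of_forall hN'le')
  have hibp := integral_bilinear_hasLineDerivAt_right_eq_neg_left_of_integrable
    (μ := (volume : Measure (Rd d))) (f := V j) (f' := V (j + 1)) (g := N) (g' := N') (v := e)
    (B := ContinuousLinearMap.mul ℝ ℂ)
    ((hV.memLp (j + 1)).integrable_mul hNm) ((hV.memLp j).integrable_mul hN'm)
    ((hV.memLp j).integrable_mul hNm) (fun x _ => hV.hasLineDerivAt j x) (fun x _ => hNd x)
  simp only [ContinuousLinearMap.mul_apply'] at hibp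
  have hprod : ∀ x, V (j + 1) x * N x = ((‖V (j + 1) x‖ ^ (b + 2) : ℝ) : ℂ) := by
    intro x
    simp only [N, powNonlin, map_mul, Complex.conj_ofReal]
    rw [mul_left_comm, Complex.mul_conj, Complex.normSq_eq_norm_sq,
      Real.rpow_add_of_nonneg (norm_nonneg _) hb.le two_pos.le]
    push_cast
    norm_num
  have h_integral : Integrable fun x => V (j + 1) x * N x := (hV.memLp (j + 1)).integrable_mul hNm
  have h1 : ∫⁻ x, ‖V (j + 1) x‖ₑ ^ (b + 2) = ‖∫ x, V (j + 1) x * N x‖ₑ := by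
    simp only [hprod] at h_integral ⊢
    have h_integral' : Integrable fun x => ‖V (j + 1) x‖ ^ (b + 2) := by
      refine h_integral.norm.congr (Eventually.of_forall fun x => ?_)
      simp only [Complex.norm_real]
      exact Real.norm_of_nonneg (by positivity)
    rw [integral_complex_ofReal, ← ofReal_norm, Complex.norm_real,
      Real.norm_of_nonneg (integral_nonneg fun x => by positivity),
      ofReal_integral_eq_lintegral_ofReal h_integral' (Eventually.of_forall fun x => by positivity)]
    refine lintegral_congr fun x => ?_
    rw [← ofReal_norm, ENNReal.ofReal_rpow_of_nonneg (norm_nonneg _) (by linarith)]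
  rw [h1, ← enorm_neg, ← hibp]
  refine (enorm_integral_le_lintegral_enorm _).trans ?_
  rw [← lintegral_const_mul' _ _ ENNReal.ofReal_ne_top]
  refine lintegral_mono fun x => ?_
  rw [enorm_mul]
  have h2 : ‖N' x‖ₑ ≤ ENNReal.ofReal C * ‖V (j + 1) x‖ₑ ^ b * ‖V (j + 2) x‖ₑ := by
    rw [← ofReal_norm, ← ofReal_norm, ← ofReal_norm,
      ENNReal.ofReal_rpow_of_nonneg (norm_nonneg _) hb.le, ← ENNReal.ofReal_mul hC,
      ← ENNReal.ofReal_mul (by positivity)]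
    exact ENNReal.ofReal_le_ofReal (hN'le x)
  calc ‖V j x‖ₑ * ‖N' x‖ₑ
      ≤ ‖V j x‖ₑ * (ENNReal.ofReal C * ‖V (j + 1) x‖ₑ ^ b * ‖V (j + 2) x‖ₑ) := by gcongr
    _ = _ := by ring

theorem lintegral_enorm_rpow_ne_top {f : Rd d → ℂ} (hf : MemLp f 2 volume) {K : ℝ}
    (hK : ∀ x, ‖f x‖ ≤ K) {p : ℝ} (hp : 2 ≤ p) : ∫⁻ x, ‖f x‖ₑ ^ p ≠ ∞ := by
  have h2 : ∫⁻ x, ‖f x‖ₑ ^ (2 : ℝ) ≠ ∞ := by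
    have := lintegral_rpow_enorm_lt_top_of_eLpNorm_lt_top two_ne_zero ENNReal.ofNat_ne_top hf.2
    simpa using this.ne
  have hK0 : 0 ≤ K := (norm_nonneg _).trans (hK 0)
  refine ne_top_of_le_ne_top (b := ENNReal.ofReal K ^ (p - 2) * ∫⁻ x, ‖f x‖ₑ ^ (2 : ℝ))
    (ENNReal.mul_ne_top (ENNReal.rpow_ne_top_of_nonneg (by linarith) ENNReal.ofReal_ne_top) h2) ?_
  rw [← lintegral_const_mul' _ _
    (ENNReal.rpow_ne_top_of_nonneg (by linarith) ENNReal.ofReal_ne_top)]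
  refine lintegral_mono fun x => ?_
  calc ‖f x‖ₑ ^ p = ‖f x‖ₑ ^ (p - 2) * ‖f x‖ₑ ^ (2 : ℝ) := by
        rw [← ENNReal.rpow_add_of_nonneg _ _ (by linarith) two_pos.le]; ring_nf
    _ ≤ _ := by
        gcongr
        rw [← ofReal_norm]
        exact ENNReal.ofReal_le_ofReal (hK x)

/-- `I ≤ C I^w J^{1-w}` implies `I ≤ C' J`. -/
theorem le_of_le_mul_rpow_mul_rpow {C I J : ℝ≥0∞} {w w' : ℝ} (hw : 0 ≤ w) (hw' : 0 < w')
    (hww : w + w' = 1) (hI : I ≠ ∞) (h : I ≤ C * I ^ w * J ^ w') : I ≤ C ^ w'⁻¹ * J := by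
  rcases eq_or_ne I 0 with rfl | hI0
  · exact zero_le
  have h1 : I ^ w * I ^ w' = I := by
    rw [← ENNReal.rpow_add_of_nonneg _ _ hw hw'.le, hww, ENNReal.rpow_one]
  have h2 : I ^ w * I ^ w' ≤ I ^ w * (C * J ^ w') := by
    rw [h1]; exact h.trans_eq (by ring)
  have h3 : I ^ w' ≤ C * J ^ w' :=
    (ENNReal.mul_le_mul_iff_right (by simp [hI0, hI]) (ENNReal.rpow_ne_top_of_nonneg hw hI)).1 h2
  calc I = (I ^ w') ^ w'⁻¹ := by rw [← ENNReal.rpow_mul, mul_inv_cancel₀ hw'.ne', ENNReal.rpow_one]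
    _ ≤ (C * J ^ w') ^ w'⁻¹ := by gcongr
    _ = C ^ w'⁻¹ * J := by
      rw [ENNReal.mul_rpow_of_nonneg _ _ (by positivity), ← ENNReal.rpow_mul,
        mul_inv_cancel₀ hw'.ne', ENNReal.rpow_one]

theorem lintegral_mul_three_le {α : Type*} [MeasurableSpace α] {μ : Measure α}
    {f₁ f₂ f₃ : α → ℝ≥0∞} (h₁ : AEMeasurable f₁ μ) (h₂ : AEMeasurable f₂ μ)
    (h₃ : AEMeasurable f₃ μ) {w₁ w₂ w₃ : ℝ} (hw₁ : 0 ≤ w₁) (hw₂ : 0 ≤ w₂) (hw₃ : 0 ≤ w₃)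
    (hw : w₁ + w₂ + w₃ = 1) :
    ∫⁻ x, f₁ x ^ w₁ * f₂ x ^ w₂ * f₃ x ^ w₃ ∂μ ≤
      (∫⁻ x, f₁ x ∂μ) ^ w₁ * (∫⁻ x, f₂ x ∂μ) ^ w₂ * (∫⁻ x, f₃ x ∂μ) ^ w₃ := by
  have := ENNReal.lintegral_prod_norm_pow_le (μ := μ)
    (Finset.univ : Finset (Fin 3)) (f := ![f₁, f₂, f₃]) (p := ![w₁, w₂, w₃])
    (fun i _ => by fin_cases i <;> assumption)
    (by simpa [Fin.sum_univ_three] using hw) (fun i _ => by fin_cases i <;> simpa)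
  simpa [Fin.prod_univ_three] using this

/-- One step `I_j ≤ K I_{j+1}` of the Gagliardo–Nirenberg inequality, for `j = i + 1`. -/
theorem exists_gagliardoNirenberg_succ (r : ℕ) (κ : ℝ) (i : ℕ) (hi : i + 1 < r) :
    ∃ K : ℝ≥0∞, K ≠ ∞ ∧ ∀ {e : Rd d} {V : ℕ → Rd d → ℂ}, SmoothAlong e V →
      (∀ x, ‖V 0 x‖ ≤ κ) →
      ∫⁻ x, ‖V (i + 1) x‖ₑ ^ (2 * r / (i + 1) : ℝ) ≤
        K * ∫⁻ x, ‖V (i + 2) x‖ₑ ^ (2 * r / (i + 2) : ℝ) := by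
  induction i with
  | zero =>
    have hr : (1 : ℝ) < r := by exact_mod_cast hi
    obtain ⟨C, hC, h⟩ := exists_lintegral_rpow_deriv_le (d := d) (b := 2 * r - 2) (by linarith)
    refine ⟨(C * ENNReal.ofReal κ) ^ (1 / r : ℝ)⁻¹, ?_, fun {e V} hV hκ => ?_⟩
    · exact ENNReal.rpow_ne_top_of_nonneg (by positivity) (ENNReal.mul_ne_top hC ENNReal.ofReal_ne_top)
    obtain ⟨K₁, hK₁⟩ := hV.bounded 1
    have h0 := h hV 0
    simp only [zero_add, Nat.cast_zero, div_one, sub_add_cancel] at h0 ⊢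
    refine le_of_le_mul_rpow_mul_rpow (w := 1 - 1 / r) ?_ (by positivity) (by ring)
      (lintegral_enorm_rpow_ne_top (hV.memLp 1) hK₁ (by linarith)) (h0.trans ?_)
    · rw [sub_nonneg, div_le_one (by linarith)]; exact hr.le
    · rw [mul_assoc, mul_assoc]
      gcongr
      -- Only two factors are present: V₀ is bounded by κ and leaves the integral. The unused slot
      -- has weight 0, and x^0 = 1 even for x = 0.
      have h1 := lintegral_mul_three_le (μ := (volume : Measure (Rd d))) (f₁ := fun _ => 0)
        (f₂ := fun x => ‖V 1 x‖ₑ ^ (2 * r : ℝ)) (f₃ := fun x => ‖V 2 x‖ₑ ^ (2 * r / 2 : ℝ))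
        (w₁ := 0) (w₂ := 1 - 1 / r) (w₃ := 1 / r) aemeasurable_const
        ((hV.continuous 1).measurable.enorm.pow_const _).aemeasurable
        ((hV.continuous 2).measurable.enorm.pow_const _).aemeasurable le_rfl
        (by rw [sub_nonneg, div_le_one (by linarith)]; exact hr.le) (by positivity) (by ring)
      simp only [ENNReal.rpow_zero, one_mul] at h1
      refine le_trans ?_ (mul_le_mul_right h1 (ENNReal.ofReal κ))
      rw [← lintegral_const_mul' _ _ ENNReal.ofReal_ne_top]
      refine lintegral_mono fun x => ?_
      rw [mul_assoc]
      refine mul_le_mul' (by rw [← ofReal_norm]; exact ENNReal.ofReal_le_ofReal (hκ x)) ?_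
      rw [← ENNReal.rpow_mul, ← ENNReal.rpow_mul]
      refine le_of_eq ?_
      congr 2
      · field_simp
      · rw [show (2 * r / 2 : ℝ) * (1 / r) = 1 by field_simp, ENNReal.rpow_one]
  | succ i ih =>
    obtain ⟨K₀, hK₀, hprev⟩ := ih (by omega)
    have hr : (i + 2 : ℝ) < r := by
      have : ((i + 1 + 1 : ℕ) : ℝ) < r := by exact_mod_cast hi
      push_cast at this
      linarith
    have hr0 : (0 : ℝ) < r := by have : (0 : ℝ) ≤ i := i.cast_nonneg; linarith
    have hb : 0 < (2 * r / (i + 2) - 2 : ℝ) := by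
      rw [sub_pos, lt_div_iff₀ (by positivity)]; linarith
    obtain ⟨C, hC, h⟩ := exists_lintegral_rpow_deriv_le (d := d) hb
    -- Hölder weights for the product |V_{i+1}| |V_{i+2}|^{2r/(i+2)-2} |V_{i+3}|: the outer ones are
    -- the reciprocals of the exponents 2r/(i+1) and 2r/(i+3). The previous step bounds the first
    -- integral by the middle one, which is finite and is absorbed by `le_of_le_mul_rpow_mul_rpow`.
    set w₁ : ℝ := (i + 1) / (2 * r) with hw₁
    set w₂ : ℝ := 1 - (i + 2) / r with hw₂
    set w₃ : ℝ := (i + 3) / (2 * r) with hw₃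
    have hw₁0 : 0 < w₁ := by positivity
    have hw₃0 : 0 < w₃ := by positivity
    have hw₂0 : 0 ≤ w₂ := by
      rw [hw₂, sub_nonneg, div_le_one (by linarith)]; exact hr.le
    have hsum : w₁ + w₂ + w₃ = 1 := by rw [hw₁, hw₂, hw₃]; field_simp; ring
    refine ⟨(C * K₀ ^ w₁) ^ w₃⁻¹, ?_, fun {e V} hV hκ => ?_⟩
    · exact ENNReal.rpow_ne_top_of_nonneg (by positivity)
        (ENNReal.mul_ne_top hC (ENNReal.rpow_ne_top_of_nonneg hw₁0.le hK₀))
    obtain ⟨K₁, hK₁⟩ := hV.bounded (i + 2)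
    have h0 := h hV (i + 1)
    have hp := hprev hV hκ
    simp only [sub_add_cancel] at h0
    push_cast at hp h0 ⊢
    rw [show (i + 1 + 1 : ℝ) = i + 2 by ring, show (i + 1 + 2 : ℝ) = i + 3 by ring]
    refine le_of_le_mul_rpow_mul_rpow (w := w₁ + w₂) (by positivity) hw₃0 (by linarith)
      (lintegral_enorm_rpow_ne_top (hV.memLp _) hK₁ (by linarith)) (h0.trans ?_)
    have h1 := lintegral_mul_three_le (μ := (volume : Measure (Rd d))) (f₁ := fun x => ‖V (i + 1) x‖ₑ ^ (2 * r / (i + 1) : ℝ))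
        (f₂ := fun x => ‖V (i + 2) x‖ₑ ^ (2 * r / (i + 2) : ℝ))
        (f₃ := fun x => ‖V (i + 3) x‖ₑ ^ (2 * r / (i + 3) : ℝ))
        (w₁ := w₁) (w₂ := w₂) (w₃ := w₃)
        ((hV.continuous _).measurable.enorm.pow_const _).aemeasurable
        ((hV.continuous _).measurable.enorm.pow_const _).aemeasurable
        ((hV.continuous _).measurable.enorm.pow_const _).aemeasurable hw₁0.le hw₂0 hw₃0.le hsum
    calc C * ∫⁻ x, ‖V (i + 1) x‖ₑ * ‖V (i + 2) x‖ₑ ^ (2 * r / (i + 2) - 2 : ℝ) * ‖V (i + 3) x‖ₑ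
        = C * ∫⁻ x, (‖V (i + 1) x‖ₑ ^ (2 * r / (i + 1) : ℝ)) ^ w₁ *
          (‖V (i + 2) x‖ₑ ^ (2 * r / (i + 2) : ℝ)) ^ w₂ *
          (‖V (i + 3) x‖ₑ ^ (2 * r / (i + 3) : ℝ)) ^ w₃ := by
          congr 1
          refine lintegral_congr fun x => ?_
          rw [← ENNReal.rpow_mul, ← ENNReal.rpow_mul, ← ENNReal.rpow_mul,
            show (2 * r / (i + 1) : ℝ) * w₁ = 1 by rw [hw₁]; field_simp,
            show (2 * r / (i + 2) : ℝ) * w₂ = 2 * r / (i + 2) - 2 by rw [hw₂]; field_simp,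
            show (2 * r / (i + 3) : ℝ) * w₃ = 1 by rw [hw₃]; field_simp,
            ENNReal.rpow_one, ENNReal.rpow_one]
      _ ≤ C * _ := mul_le_mul_right h1 C
      _ ≤ C * ((K₀ * ∫⁻ x, ‖V (i + 2) x‖ₑ ^ (2 * r / (i + 2) : ℝ)) ^ w₁ *
          (∫⁻ x, ‖V (i + 2) x‖ₑ ^ (2 * r / (i + 2) : ℝ)) ^ w₂ *
          (∫⁻ x, ‖V (i + 3) x‖ₑ ^ (2 * r / (i + 3) : ℝ)) ^ w₃) := by gcongr
      _ = _ := by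
          rw [ENNReal.mul_rpow_of_nonneg _ _ hw₁0.le,
            ENNReal.rpow_add_of_nonneg _ _ hw₁0.le hw₂0]
          ring

/-- The Gagliardo–Nirenberg inequality `∫ |∂^j V|^{2r/j} ≤ K ∫ |∂^r V|²` for bounded `V`. -/
theorem exists_gagliardoNirenberg (d r : ℕ) (κ : ℝ) :
    ∃ K : ℝ≥0∞, K ≠ ∞ ∧ ∀ {e : Rd d} {V : ℕ → Rd d → ℂ}, SmoothAlong e V →
      (∀ x, ‖V 0 x‖ ≤ κ) → ∀ j, 1 ≤ j → j ≤ r →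
      ∫⁻ x, ‖V j x‖ₑ ^ (2 * r / j : ℝ) ≤ K * ∫⁻ x, ‖V r x‖ₑ ^ 2 := by
  -- Downward chain from order r, with m the distance to r.
  have hstep : ∀ m, m + 1 ≤ r → ∃ K : ℝ≥0∞, K ≠ ∞ ∧ ∀ {e : Rd d} {V : ℕ → Rd d → ℂ},
      SmoothAlong e V → (∀ x, ‖V 0 x‖ ≤ κ) →
      ∫⁻ x, ‖V (r - m) x‖ₑ ^ (2 * r / (r - m : ℕ) : ℝ) ≤ K * ∫⁻ x, ‖V r x‖ₑ ^ 2 := by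
    intro m
    induction m with
    | zero =>
      intro hr
      refine ⟨1, ENNReal.one_ne_top, fun _ _ => ?_⟩
      have : (r : ℝ) ≠ 0 := by exact_mod_cast (by omega : r ≠ 0)
      rw [Nat.sub_zero, show (2 * r / r : ℝ) = (2 : ℕ) by field_simp; norm_num, one_mul]
      simp only [ENNReal.rpow_natCast, le_refl]
    | succ m ih =>
      intro hr
      obtain ⟨K, hK, h⟩ := ih (by omega)
      obtain ⟨i, hi⟩ : ∃ i, r - (m + 1) = i + 1 := ⟨r - (m + 1) - 1, by omega⟩
      have hi' : r - m = i + 2 := by omega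
      obtain ⟨K', hK', h'⟩ := exists_gagliardoNirenberg_succ (d := d) r κ i (by omega)
      refine ⟨K' * K, ENNReal.mul_ne_top hK' hK, fun {e V} hV hκ => ?_⟩
      have h1 := h hV hκ
      have h2 := h' hV hκ
      rw [hi'] at h1
      rw [hi, mul_assoc]
      push_cast at h1 h2 ⊢
      exact h2.trans (by gcongr)
  have hall : ∀ j, ∃ K : ℝ≥0∞, K ≠ ∞ ∧ (1 ≤ j → j ≤ r → ∀ {e : Rd d} {V : ℕ → Rd d → ℂ},
      SmoothAlong e V → (∀ x, ‖V 0 x‖ ≤ κ) →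
      ∫⁻ x, ‖V j x‖ₑ ^ (2 * r / j : ℝ) ≤ K * ∫⁻ x, ‖V r x‖ₑ ^ 2) := by
    intro j
    by_cases hj : 1 ≤ j ∧ j ≤ r
    · obtain ⟨K, hK, h⟩ := hstep (r - j) (by omega)
      rw [show r - (r - j) = j by omega] at h
      exact ⟨K, hK, fun _ _ => h⟩
    · exact ⟨0, ENNReal.zero_ne_top, fun h1 h2 => absurd ⟨h1, h2⟩ hj⟩
  choose K hK h using hall
  refine ⟨∑ j ∈ Finset.range (r + 1), K j, ENNReal.sum_ne_top.2 fun j _ => hK j,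
    fun {e V} hV hκ j h1 h2 => (h j h1 h2 hV hκ).trans ?_⟩
  gcongr
  exact Finset.single_le_sum (f := K) (fun j _ => zero_le) (Finset.mem_range.2 (by omega))

/-! ### Derivatives of compositions along a direction -/

namespace SmoothAlong

variable {e : Rd d} {V U : ℕ → Rd d → ℂ}

theorem sub (hU : SmoothAlong e U) (hV : SmoothAlong e V) :
    SmoothAlong e (fun j x => U j x - V j x) where
  hasLineDerivAt j x := (hU.hasLineDerivAt j x).sub (hV.hasLineDerivAt j x)
  continuous j := (hU.continuous j).sub (hV.continuous j)
  memLp j := (hU.memLp j).sub (hV.memLp j)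
  bounded j := by
    obtain ⟨C, hC⟩ := hU.bounded j
    obtain ⟨C', hC'⟩ := hV.bounded j
    exact ⟨C + C', fun x => (norm_sub_le _ _).trans (add_le_add (hC x) (hC' x))⟩

theorem const_mul (hV : SmoothAlong e V) (c : ℂ) : SmoothAlong e (fun j x => c * V j x) where
  hasLineDerivAt j x := HasDerivAt.const_mul c (hV.hasLineDerivAt j x)
  continuous j := continuous_const.mul (hV.continuous j)
  memLp j := (hV.memLp j).const_mul c
  bounded j := by
    obtain ⟨C, hC⟩ := hV.bounded j
    exact ⟨‖c‖ * C, fun x => by rw [norm_mul]; gcongr; exact hC x⟩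

theorem hasDerivAt (hV : SmoothAlong e V) (j : ℕ) (x : Rd d) (t : ℝ) :
    HasDerivAt (fun t : ℝ => V j (x + t • e)) (V (j + 1) (x + t • e)) t := by
  have h : HasDerivAt (fun s : ℝ => V j (x + t • e + s • e)) (V (j + 1) (x + t • e)) 0 :=
    hV.hasLineDerivAt j (x + t • e)
  have h2 := HasDerivAt.comp_sub_const (f := fun s : ℝ => V j (x + t • e + s • e)) t t
    (by rwa [sub_self])
  refine h2.congr_of_eventuallyEq (Eventually.of_forall fun s => ?_)
  simp only [add_assoc, ← add_smul, add_sub_cancel]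

theorem iteratedDeriv_line (hV : SmoothAlong e V) (j : ℕ) (x : Rd d) :
    iteratedDeriv j (fun t : ℝ => V 0 (x + t • e)) = fun t => V j (x + t • e) := by
  induction j with
  | zero => rw [iteratedDeriv_zero]
  | succ j ih =>
    rw [iteratedDeriv_succ, ih]
    ext t
    exact (hV.hasDerivAt j x t).deriv

theorem contDiff_line (hV : SmoothAlong e V) (x : Rd d) (n : ℕ) :
    ContDiff ℝ n fun t : ℝ => V 0 (x + t • e) := by
  refine contDiff_of_differentiable_iteratedDeriv (n := (n : ℕ∞)) fun m _ => ?_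
  rw [hV.iteratedDeriv_line]
  exact fun t => (hV.hasDerivAt m x t).differentiableAt

end SmoothAlong

/-- The `m`-th derivative of `F ∘ V 0`, expressed by the derivatives `V j` of `V 0`. -/
def compDeriv (F : ℂ → ℂ) (V : ℕ → Rd d → ℂ) (m : ℕ) (x : Rd d) : ℂ :=
  ∑ c : OrderedFinpartition m,
    iteratedFDeriv ℝ c.length F (V 0 x) (fun i => V (c.partSize i) x)

section compDeriv

variable {e : Rd d} {V U : ℕ → Rd d → ℂ} {F : ℂ → ℂ} {r : ℕ}

/-- On a line in the direction e everything depends on one real variable, where the formula of Faà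
di Bruno is available. -/
theorem iteratedDeriv_comp_line (hV : SmoothAlong e V) (hF : ContDiff ℝ r F) {m : ℕ} (hm : m ≤ r)
    (x : Rd d) (t : ℝ) :
    iteratedDeriv m (fun t : ℝ => F (V 0 (x + t • e))) t = compDeriv F V m (x + t • e) := by
  have h := iteratedDeriv_vcomp_eq_sum_orderedFinpartition (𝕜 := ℝ) (i := m) (n := r) (x := t)
    (g := F) (f := fun t : ℝ => V 0 (x + t • e)) hF.contDiffAt
    (hV.contDiff_line x r).contDiffAt (by exact_mod_cast hm)
  simp only [hV.iteratedDeriv_line] at h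
  exact h

theorem compDeriv_zero (hV : SmoothAlong e V) (hF : ContDiff ℝ r F) (x : Rd d) :
    compDeriv F V 0 x = F (V 0 x) := by
  have := iteratedDeriv_comp_line hV hF (Nat.zero_le r) x 0
  simpa using this.symm

theorem compDeriv_hasLineDerivAt (hV : SmoothAlong e V) (hF : ContDiff ℝ r F) {m : ℕ}
    (hm : m < r) (x : Rd d) :
    HasLineDerivAt ℝ (compDeriv F V m) (compDeriv F V (m + 1) x) x e := by
  have hc : ContDiff ℝ r fun t : ℝ => F (V 0 (x + t • e)) := hF.comp (hV.contDiff_line x r)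
  have h1 : Differentiable ℝ (iteratedDeriv m fun t : ℝ => F (V 0 (x + t • e))) :=
    hc.differentiable_iteratedDeriv m (by exact_mod_cast hm)
  have h2 := (h1 0).hasDerivAt
  rw [← iteratedDeriv_succ, iteratedDeriv_comp_line hV hF hm, zero_smul, add_zero] at h2
  exact h2.congr_of_eventuallyEq
    (Eventually.of_forall fun t => (iteratedDeriv_comp_line hV hF hm.le x t).symm)

theorem continuous_compDeriv (hV : SmoothAlong e V) (hF : ContDiff ℝ r F) {m : ℕ}
    (hm : m ≤ r) : Continuous (compDeriv F V m) := by
  refine continuous_finsetSum _ fun c _ => ?_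
  have h1 : Continuous fun x => iteratedFDeriv ℝ c.length F (V 0 x) :=
    (hF.continuous_iteratedFDeriv (m := c.length)
      (by exact_mod_cast c.length_le.trans hm)).comp (hV.continuous 0)
  exact h1.eval (continuous_pi fun i => hV.continuous _)

/-- In order 0, F is Lipschitz on balls and vanishes at 0. In positive order each partition has at
least one block; the factor of one block is in L² and all the others are bounded. -/
theorem memLp_compDeriv (hV : SmoothAlong e V) {θ : ℝ} (hF : LocallyHolder r θ F) (hr : 1 ≤ r)
    (hF0 : F 0 = 0) {m : ℕ} (hm : m ≤ r) : MemLp (compDeriv F V m) 2 volume := by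
  rcases Nat.eq_zero_or_pos m with rfl | hm0
  · obtain ⟨κ, hκ⟩ := hV.bounded 0
    have hκ0 : 0 ≤ κ := (norm_nonneg _).trans (hκ 0)
    obtain ⟨C, hC, h⟩ := hF.exists_bound κ
    refine (hV.memLp 0).of_le_mul (c := C)
      (continuous_compDeriv hV hF.contDiff hm).aestronglyMeasurable (Eventually.of_forall fun x => ?_)
    rw [compDeriv_zero hV hF.contDiff]
    have := (convex_closedBall (0 : ℂ) κ).norm_image_sub_le_of_norm_fderiv_le (𝕜 := ℝ)
      (f := F) (C := C)
      (fun z _ => hF.contDiff.differentiable (by exact_mod_cast (by omega : r ≠ 0)) z)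
      (fun z hz => ?_) (show (0 : ℂ) ∈ _ by simpa using hκ0)
      (show V 0 x ∈ _ by simpa using hκ x)
    · simpa [hF0] using this
    · have h3 := (h 1 hr z z (by simpa using hz) (by simpa using hz)).1
      rwa [norm_iteratedFDeriv_one] at h3
  · refine memLp_finsetSum _ fun c _ => ?_
    have hl := c.length_pos hm0
    set i₀ : Fin c.length := ⟨0, hl⟩
    obtain ⟨κ, hκ⟩ := hV.bounded 0
    obtain ⟨C, hC, h⟩ := hF.exists_bound κ
    choose B hB using hV.bounded
    refine (hV.memLp (c.partSize i₀)).of_le_mul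
      (c := C * ∏ i ∈ Finset.univ.erase i₀, B (c.partSize i)) ?_ (Eventually.of_forall fun x => ?_)
    · have h1 : Continuous fun x => iteratedFDeriv ℝ c.length F (V 0 x) :=
        (hF.contDiff.continuous_iteratedFDeriv (m := c.length)
          (by exact_mod_cast c.length_le.trans hm)).comp (hV.continuous 0)
      exact (h1.eval (continuous_pi fun i => hV.continuous _)).aestronglyMeasurable
    · refine (ContinuousMultilinearMap.le_opNorm _ _).trans ?_
      rw [mul_assoc, ← Finset.prod_erase_mul _ _ (Finset.mem_univ i₀)]
      gcongr with i
      · exact (h c.length (c.length_le.trans hm) _ _ (hκ x) (hκ x)).1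
      · exact hB _ x

theorem OrderedFinpartition.sum_partSize {n : ℕ} (c : OrderedFinpartition n) :
    ∑ i, c.partSize i = n := by
  have := c.sum_sigma_eq_sum (fun _ => 1)
  simpa using this

/-- Young's inequality for the products in the formula of Faà di Bruno. -/
theorem sq_prod_partSize_le {r : ℕ} (hr : 1 ≤ r) (c : OrderedFinpartition r) {a : ℕ → ℝ}
    (ha : ∀ k, 0 ≤ a k) :
    (∏ i, a (c.partSize i)) ^ 2 ≤ ∑ k ∈ Finset.Icc 1 r, a k ^ (2 * r / k : ℝ) := by
  have hr0 : (0 : ℝ) < r := by exact_mod_cast hr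
  set S := ∑ k ∈ Finset.Icc 1 r, a k ^ (2 * r / k : ℝ) with hS
  have hS0 : 0 ≤ S := Finset.sum_nonneg fun k _ => Real.rpow_nonneg (ha k) _
  -- Each factor with part size k contributes at most S^{k/r} after squaring, and the part sizes add
  -- up to r, so the product is at most S.
  have h1 : ∀ k, 1 ≤ k → k ≤ r → a k ^ 2 ≤ S ^ (k / r : ℝ) := by
    intro k hk hkr
    have hk0 : (0 : ℝ) < k := by exact_mod_cast hk
    have h2 : a k ^ (2 * r / k : ℝ) ≤ S :=
      Finset.single_le_sum (f := fun k : ℕ => a k ^ (2 * r / k : ℝ))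
        (fun k _ => Real.rpow_nonneg (ha k) _) (Finset.mem_Icc.2 ⟨hk, hkr⟩)
    calc a k ^ 2 = (a k ^ (2 * r / k : ℝ)) ^ (k / r : ℝ) := by
          rw [← Real.rpow_mul (ha k), ← Real.rpow_natCast]
          congr 1
          push_cast
          field_simp
      _ ≤ _ := Real.rpow_le_rpow (Real.rpow_nonneg (ha k) _) h2 (by positivity)
  rw [← Finset.prod_pow]
  calc ∏ i, a (c.partSize i) ^ 2 ≤ ∏ i, S ^ (c.partSize i / r : ℝ) :=
        Finset.prod_le_prod (fun i _ => by positivity)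
          fun i _ => h1 _ (c.partSize_pos i) (c.partSize_le i)
    _ = S ^ (∑ i, (c.partSize i / r : ℝ)) := by
        rw [Real.rpow_sum_of_nonneg hS0 fun i _ => by positivity]
    _ = S := by
        rw [← Finset.sum_div]
        have : (∑ i, (c.partSize i : ℝ)) = r := by exact_mod_cast c.sum_partSize
        rw [this, div_self hr0.ne', Real.rpow_one]

theorem add_three_rpow_le {a b c p : ℝ} (ha : 0 ≤ a) (hb : 0 ≤ b) (hc : 0 ≤ c) (hp : 0 ≤ p) :
    (a + b + c) ^ p ≤ 3 ^ p * (a ^ p + b ^ p + c ^ p) := by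
  have hm : a + b + c ≤ 3 * max (max a b) c := by
    have := le_max_left (max a b) c
    have := le_max_right (max a b) c
    have := le_max_left a b
    have := le_max_right a b
    linarith
  have hm0 : 0 ≤ max (max a b) c := hc.trans (le_max_right _ _)
  calc (a + b + c) ^ p ≤ (3 * max (max a b) c) ^ p := by gcongr
    _ = 3 ^ p * max (max a b) c ^ p := Real.mul_rpow (by norm_num) hm0
    _ ≤ _ := by
      gcongr
      have := Real.rpow_nonneg ha p
      have := Real.rpow_nonneg hb p
      have := Real.rpow_nonneg hc p
      rcases max_choice (max a b) c with h | h <;> rw [h]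
      · rcases max_choice a b with h | h <;> rw [h] <;> linarith
      · linarith

/-- Pointwise bound for the difference of two compositions. -/
theorem exists_sq_norm_compDeriv_sub_le (d : ℕ) {θ : ℝ} (hF : LocallyHolder r θ F) (hr : 1 ≤ r)
    (κ : ℝ) (hκ : 0 ≤ κ) :
    ∃ C, 0 ≤ C ∧ ∀ {U V : ℕ → Rd d → ℂ} {δ : ℝ} {x : Rd d}, 0 < δ → δ ≤ 2 →
      ‖U 0 x‖ ≤ κ → ‖V 0 x‖ ≤ κ → ‖U 0 x - V 0 x‖ ≤ κ * δ →
      ‖compDeriv F U r x - compDeriv F V r x‖ ^ 2 ≤ C * ∑ k ∈ Finset.Icc 1 r,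
        (δ ^ (2 * θ) * (‖U k x‖ ^ (2 * r / k : ℝ) + ‖V k x‖ ^ (2 * r / k : ℝ)) +
          δ ^ 2 * ‖(δ⁻¹ : ℂ) * (U k x - V k x)‖ ^ (2 * r / k : ℝ)) := by
  obtain ⟨C, hC, hb⟩ := hF.exists_bound κ
  set N : ℝ := (Fintype.card (OrderedFinpartition r) : ℝ)
  set C₁ : ℝ := 2 * (C * κ ^ θ) ^ 2 + 8 * (C * r) ^ 2 with hC₁
  refine ⟨N * (N * (C₁ * 3 ^ (2 * r : ℝ))), by positivity,
    fun {U V δ x} hδ hδ2 hU hV hW => ?_⟩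
  set A : ℕ → ℝ := fun k => ‖U k x‖ + ‖V k x‖ + ‖(δ⁻¹ : ℂ) * (U k x - V k x)‖ with hA
  set A₀ : ℕ → ℝ := fun k => ‖U k x‖ + ‖V k x‖ + 0 with hA₀
  set R : ℝ := ∑ k ∈ Finset.Icc 1 r,
        (δ ^ (2 * θ) * (‖U k x‖ ^ (2 * r / k : ℝ) + ‖V k x‖ ^ (2 * r / k : ℝ)) +
          δ ^ 2 * ‖(δ⁻¹ : ℂ) * (U k x - V k x)‖ ^ (2 * r / k : ℝ)) with hR
  -- As δ ≤ 2 and θ ≤ 1, the terms of size δ² involving U and V can be absorbed in those of size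
  -- δ^{2θ}.
  have hδθ : δ ^ 2 ≤ 4 * δ ^ (2 * θ) := by
    have h1 : (δ / 2) ^ (2 : ℝ) ≤ (δ / 2) ^ (2 * θ) :=
      Real.rpow_le_rpow_of_exponent_ge (by positivity) (by linarith) (by linarith [hF.le_one])
    rw [Real.div_rpow hδ.le two_pos.le, Real.div_rpow hδ.le two_pos.le] at h1
    have h2 : (1 : ℝ) ≤ 2 ^ (2 * θ) := Real.one_le_rpow one_le_two (by linarith [hF.pos])
    have h3 : δ ^ (2 * θ) / 2 ^ (2 * θ) ≤ δ ^ (2 * θ) := div_le_self (by positivity) h2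
    norm_num at h1
    linarith
  have hA0 : ∀ k, 0 ≤ A k := fun k => by positivity
  have hterm : ∀ c : OrderedFinpartition r,
      ‖iteratedFDeriv ℝ c.length F (U 0 x) (fun i => U (c.partSize i) x) -
        iteratedFDeriv ℝ c.length F (V 0 x) (fun i => V (c.partSize i) x)‖ ^ 2 ≤
      C₁ * 3 ^ (2 * r : ℝ) * R := by
    intro c
    set D₁ := iteratedFDeriv ℝ c.length F (U 0 x)
    set D₂ := iteratedFDeriv ℝ c.length F (V 0 x)
    have hbc := hb c.length c.length_le
    have hl : (c.length : ℝ) ≤ r := by exact_mod_cast c.length_le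
    -- The difference splits in two. If the derivative of F changes, its Hölder continuity gives
    -- δ^θ. If the arguments change, one factor at a time, each change gives δ times the normalised
    -- difference δ⁻¹(U - V).
    have t1 : ‖(D₁ - D₂) (fun i => U (c.partSize i) x)‖ ≤
        C * κ ^ θ * δ ^ θ * ∏ i, A₀ (c.partSize i) := by
      refine (ContinuousMultilinearMap.le_opNorm _ _).trans ?_
      gcongr with i
      · refine (hbc _ _ hU hV).2.trans ?_
        rw [mul_assoc, ← Real.mul_rpow hκ hδ.le]
        gcongr
        exact hF.pos.le
      · simp only [hA₀, add_zero]
        exact le_add_of_nonneg_right (norm_nonneg _)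
    have t2 : ‖D₂ (fun i => U (c.partSize i) x) - D₂ (fun i => V (c.partSize i) x)‖ ≤
        C * r * δ * ∏ i, A (c.partSize i) := by
      refine (D₂.norm_image_sub_le' _ _).trans ?_
      have h3 : ∀ i : Fin c.length, (∏ j, if j = i then
          ‖U (c.partSize i) x - V (c.partSize i) x‖ else
            max ‖U (c.partSize j) x‖ ‖V (c.partSize j) x‖) ≤ δ * ∏ i, A (c.partSize i) := by
        intro i
        rw [← Finset.mul_prod_erase _ _ (Finset.mem_univ i),
          ← Finset.mul_prod_erase _ (fun i => A (c.partSize i)) (Finset.mem_univ i), ← mul_assoc]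
        refine mul_le_mul ?_ (Finset.prod_le_prod (fun j hj => ?_) fun j hj => ?_)
          (Finset.prod_nonneg fun j _ => ?_) (by positivity)
        · rw [if_pos rfl]
          have : ‖U (c.partSize i) x - V (c.partSize i) x‖ =
              δ * ‖(δ⁻¹ : ℂ) * (U (c.partSize i) x - V (c.partSize i) x)‖ := by
            rw [norm_mul, norm_inv, Complex.norm_real, Real.norm_of_nonneg hδ.le]
            field_simp
          rw [this]
          gcongr
          exact le_add_of_nonneg_left (by positivity)
        · rw [if_neg (Finset.ne_of_mem_erase hj)]; positivity
        · rw [if_neg (Finset.ne_of_mem_erase hj)]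
          refine max_le ?_ ?_ <;> simp only [hA] <;>
          · have := norm_nonneg (U (c.partSize j) x)
            have := norm_nonneg (V (c.partSize j) x)
            have := norm_nonneg ((δ⁻¹ : ℂ) * (U (c.partSize j) x - V (c.partSize j) x))
            linarith
        · split_ifs <;> positivity
      calc ‖D₂‖ * _ ≤ C * ∑ i : Fin c.length, δ * ∏ i, A (c.partSize i) := by
            gcongr with i
            · exact (hbc _ _ hV hV).1
            · exact h3 i
        _ = C * c.length * δ * ∏ i, A (c.partSize i) := by
            rw [Finset.sum_const, Finset.card_univ, Fintype.card_fin, nsmul_eq_mul]; ring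
        _ ≤ _ := by
            have : 0 ≤ ∏ i, A (c.partSize i) := Finset.prod_nonneg fun i _ => hA0 _
            gcongr
    have t3 : ‖D₁ (fun i => U (c.partSize i) x) - D₂ (fun i => V (c.partSize i) x)‖ ≤
        C * κ ^ θ * δ ^ θ * ∏ i, A₀ (c.partSize i) + C * r * δ * ∏ i, A (c.partSize i) := by
      refine le_trans (le_of_eq ?_) ((norm_add_le _ _).trans (add_le_add t1 t2))
      congr 1
      rw [_root_.sub_apply]
      ring
    have p1 := sq_prod_partSize_le hr c (a := A₀) (fun k => by positivity)
    have p2 := sq_prod_partSize_le hr c hA0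
    set p₁ := ∏ i, A₀ (c.partSize i)
    set p₂ := ∏ i, A (c.partSize i)
    have hpow : ∀ k ∈ Finset.Icc 1 r, ∀ z, 0 ≤ z →
        (‖U k x‖ + ‖V k x‖ + z) ^ (2 * r / k : ℝ) ≤ 3 ^ (2 * r : ℝ) *
          (‖U k x‖ ^ (2 * r / k : ℝ) + ‖V k x‖ ^ (2 * r / k : ℝ) + z ^ (2 * r / k : ℝ)) := by
      intro k hk z hz
      have hk1 : (1 : ℝ) ≤ k := by exact_mod_cast (Finset.mem_Icc.1 hk).1
      refine (add_three_rpow_le (norm_nonneg _) (norm_nonneg _) hz (by positivity)).trans ?_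
      gcongr
      · norm_num
      · exact div_le_self (by positivity) hk1
    have q1 : δ ^ (2 * θ) * p₁ ^ 2 ≤ 3 ^ (2 * r : ℝ) * R := by
      refine (mul_le_mul_of_nonneg_left p1 (by positivity)).trans ?_
      rw [hR, Finset.mul_sum, Finset.mul_sum]
      refine Finset.sum_le_sum fun k hk => ?_
      have hk0 : (0 : ℝ) < k := by
        have := (Finset.mem_Icc.1 hk).1
        exact_mod_cast this
      have := hpow k hk 0 le_rfl
      rw [Real.zero_rpow (by have : (0 : ℝ) < r := by exact_mod_cast hr
                             positivity)] at this
      calc δ ^ (2 * θ) * A₀ k ^ (2 * r / k : ℝ) ≤ δ ^ (2 * θ) * (3 ^ (2 * r : ℝ) *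
            (‖U k x‖ ^ (2 * r / k : ℝ) + ‖V k x‖ ^ (2 * r / k : ℝ))) :=
              mul_le_mul_of_nonneg_left (by simpa only [hA₀, add_zero] using this) (by positivity)
        _ = 3 ^ (2 * r : ℝ) * (δ ^ (2 * θ) *
            (‖U k x‖ ^ (2 * r / k : ℝ) + ‖V k x‖ ^ (2 * r / k : ℝ))) := by ring
        _ ≤ _ := by
            gcongr
            exact le_add_of_nonneg_right (by positivity)
    have q2 : δ ^ 2 * p₂ ^ 2 ≤ 4 * (3 ^ (2 * r : ℝ) * R) := by
      refine (mul_le_mul_of_nonneg_left p2 (by positivity)).trans ?_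
      rw [hR, Finset.mul_sum, Finset.mul_sum, Finset.mul_sum]
      refine Finset.sum_le_sum fun k hk => ?_
      have := hpow k hk ‖(δ⁻¹ : ℂ) * (U k x - V k x)‖ (norm_nonneg _)
      calc δ ^ 2 * A k ^ (2 * r / k : ℝ) ≤ δ ^ 2 * (3 ^ (2 * r : ℝ) *
            (‖U k x‖ ^ (2 * r / k : ℝ) + ‖V k x‖ ^ (2 * r / k : ℝ) +
              ‖(δ⁻¹ : ℂ) * (U k x - V k x)‖ ^ (2 * r / k : ℝ))) := by gcongr
        _ = 3 ^ (2 * r : ℝ) * (δ ^ 2 *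
            (‖U k x‖ ^ (2 * r / k : ℝ) + ‖V k x‖ ^ (2 * r / k : ℝ)) +
              δ ^ 2 * ‖(δ⁻¹ : ℂ) * (U k x - V k x)‖ ^ (2 * r / k : ℝ)) := by ring
        _ ≤ 3 ^ (2 * r : ℝ) * (4 * δ ^ (2 * θ) *
            (‖U k x‖ ^ (2 * r / k : ℝ) + ‖V k x‖ ^ (2 * r / k : ℝ)) +
              4 * (δ ^ 2 * ‖(δ⁻¹ : ℂ) * (U k x - V k x)‖ ^ (2 * r / k : ℝ))) := by
            have hz : 0 ≤ δ ^ 2 * ‖(δ⁻¹ : ℂ) * (U k x - V k x)‖ ^ (2 * r / k : ℝ) := by positivity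
            refine mul_le_mul_of_nonneg_left (add_le_add ?_ (by linarith)) (by positivity)
            gcongr
        _ = _ := by ring
    have hδsq : (δ ^ θ) ^ 2 = δ ^ (2 * θ) := by
      rw [mul_comm, Real.rpow_mul hδ.le]; norm_num
    calc _ ≤ (C * κ ^ θ * δ ^ θ * p₁ + C * r * δ * p₂) ^ 2 := by gcongr
      _ ≤ 2 * ((C * κ ^ θ * δ ^ θ * p₁) ^ 2 + (C * r * δ * p₂) ^ 2) := add_sq_le
      _ = 2 * (C * κ ^ θ) ^ 2 * (δ ^ (2 * θ) * p₁ ^ 2) + 2 * (C * r) ^ 2 * (δ ^ 2 * p₂ ^ 2) := by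
          rw [← hδsq]; ring
      _ ≤ 2 * (C * κ ^ θ) ^ 2 * (3 ^ (2 * r : ℝ) * R) +
          2 * (C * r) ^ 2 * (4 * (3 ^ (2 * r : ℝ) * R)) := by gcongr
      _ = C₁ * 3 ^ (2 * r : ℝ) * R := by rw [hC₁]; ring
  have h1 : ‖compDeriv F U r x - compDeriv F V r x‖ ^ 2 ≤
      N * ∑ c : OrderedFinpartition r,
        ‖iteratedFDeriv ℝ c.length F (U 0 x) (fun i => U (c.partSize i) x) -
        iteratedFDeriv ℝ c.length F (V 0 x) (fun i => V (c.partSize i) x)‖ ^ 2 := by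
    rw [compDeriv, compDeriv, ← Finset.sum_sub_distrib]
    refine (pow_le_pow_left₀ (norm_nonneg _) (norm_sum_le _ _) 2).trans ?_
    exact sq_sum_le_card_mul_sum_sq
  refine h1.trans ?_
  rw [mul_assoc]
  gcongr
  refine (Finset.sum_le_sum fun c _ => hterm c).trans (le_of_eq ?_)
  rw [Finset.sum_const, Finset.card_univ, nsmul_eq_mul]
  ring

/-- The `L²` bound for the difference of two compositions. -/
theorem exists_lintegral_compDeriv_sub_le (d : ℕ) {θ : ℝ} (hF : LocallyHolder r θ F) (hr : 1 ≤ r)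
    (κ : ℝ) (hκ : 0 ≤ κ) :
    ∃ C : ℝ≥0∞, C ≠ ∞ ∧ ∀ {e : Rd d} {U V : ℕ → Rd d → ℂ} {δ : ℝ}, SmoothAlong e U →
      SmoothAlong e V → 0 < δ → δ ≤ 2 → (∀ x, ‖U 0 x‖ ≤ κ) → (∀ x, ‖V 0 x‖ ≤ κ) →
      (∀ x, ‖U 0 x - V 0 x‖ ≤ κ * δ) →
      ∫⁻ x, ‖compDeriv F U r x - compDeriv F V r x‖ₑ ^ 2 ≤
        C * ((∫⁻ x, ‖U r x - V r x‖ₑ ^ 2) +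
          ENNReal.ofReal (δ ^ (2 * θ)) * ((∫⁻ x, ‖U r x‖ₑ ^ 2) + ∫⁻ x, ‖V r x‖ₑ ^ 2)) := by
  obtain ⟨C, hC, hpt⟩ := exists_sq_norm_compDeriv_sub_le d hF hr κ hκ
  obtain ⟨K, hK, hgn⟩ := exists_gagliardoNirenberg d r κ
  refine ⟨ENNReal.ofReal C * (r * K), ENNReal.mul_ne_top ENNReal.ofReal_ne_top
    (ENNReal.mul_ne_top (ENNReal.natCast_ne_top r) hK),
    fun {e U V δ} hU hV hδ hδ2 hUκ hVκ hWκ => ?_⟩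
  -- After division by δ the difference is bounded by κ, so the Gagliardo–Nirenberg inequality holds
  -- for it with the same constant. The prefactor δ² then undoes the normalisation: δ² ∫ |W_r|² = ∫
  -- |U_r - V_r|².
  set W : ℕ → Rd d → ℂ := fun j x => (δ⁻¹ : ℂ) * (U j x - V j x) with hWdef
  have hWs : SmoothAlong e W := (hU.sub hV).const_mul _
  have hW0 : ∀ x, ‖W 0 x‖ ≤ κ := by
    intro x
    rw [hWdef]
    simp only
    rw [norm_mul, norm_inv, Complex.norm_real, Real.norm_of_nonneg hδ.le, inv_mul_le_iff₀ hδ]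
    linarith [hWκ x]
  have e2 : ∀ (k : ℕ) (z : ℂ), ENNReal.ofReal (‖z‖ ^ (2 * r / k : ℝ)) = ‖z‖ₑ ^ (2 * r / k : ℝ) := by
    intro k z
    rw [← ofReal_norm, ENNReal.ofReal_rpow_of_nonneg (norm_nonneg _) (by positivity)]
  have hmeas : ∀ {Z : ℕ → Rd d → ℂ}, SmoothAlong e Z → ∀ k (p : ℝ),
      Measurable fun x => ‖Z k x‖ₑ ^ p :=
    fun hZ k p => (hZ.continuous k).measurable.enorm.pow_const p
  have h1 : ∀ x, ‖compDeriv F U r x - compDeriv F V r x‖ₑ ^ 2 ≤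
      ENNReal.ofReal C * ∑ k ∈ Finset.Icc 1 r, (ENNReal.ofReal (δ ^ (2 * θ)) *
        (‖U k x‖ₑ ^ (2 * r / k : ℝ) + ‖V k x‖ₑ ^ (2 * r / k : ℝ)) +
        ENNReal.ofReal (δ ^ 2) * ‖W k x‖ₑ ^ (2 * r / k : ℝ)) := by
    intro x
    have h2 := ENNReal.ofReal_le_ofReal (hpt hδ hδ2 (hUκ x) (hVκ x) (hWκ x))
    rw [ENNReal.ofReal_pow (norm_nonneg _), ofReal_norm, ENNReal.ofReal_mul hC,
      ENNReal.ofReal_sum_of_nonneg fun k _ => by positivity] at h2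
    refine h2.trans (le_of_eq ?_)
    congr 1
    refine Finset.sum_congr rfl fun k _ => ?_
    rw [ENNReal.ofReal_add (by positivity) (by positivity), ENNReal.ofReal_mul (by positivity),
      ENNReal.ofReal_mul (by positivity), ENNReal.ofReal_add (by positivity) (by positivity),
      e2, e2, e2]
  refine (lintegral_mono h1).trans ?_
  rw [lintegral_const_mul' _ _ ENNReal.ofReal_ne_top, mul_assoc]
  gcongr
  rw [lintegral_finsetSum]
  swap
  · intro k _
    exact (((hmeas hU k _).add (hmeas hV k _)).const_mul _).add ((hmeas hWs k _).const_mul _)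
  have hWr : ENNReal.ofReal (δ ^ 2) * ∫⁻ x, ‖W r x‖ₑ ^ 2 = ∫⁻ x, ‖U r x - V r x‖ₑ ^ 2 := by
    rw [← lintegral_const_mul' _ _ ENNReal.ofReal_ne_top]
    refine lintegral_congr fun x => ?_
    rw [← ofReal_norm, ← ENNReal.ofReal_pow (norm_nonneg _), ← ENNReal.ofReal_mul (by positivity),
      ← ofReal_norm, ← ENNReal.ofReal_pow (norm_nonneg _), ← mul_pow]
    congr 2
    rw [hWdef]
    simp only
    rw [norm_mul, norm_inv, Complex.norm_real, Real.norm_of_nonneg hδ.le]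
    field_simp
  calc _ ≤ ∑ k ∈ Finset.Icc 1 r, K * ((∫⁻ x, ‖U r x - V r x‖ₑ ^ 2) +
          ENNReal.ofReal (δ ^ (2 * θ)) * ((∫⁻ x, ‖U r x‖ₑ ^ 2) + ∫⁻ x, ‖V r x‖ₑ ^ 2)) := by
        refine Finset.sum_le_sum fun k hk => ?_
        obtain ⟨hk1, hk2⟩ := Finset.mem_Icc.1 hk
        rw [lintegral_add_right _ ((hmeas hWs k _).const_mul _),
          lintegral_const_mul' _ _ ENNReal.ofReal_ne_top, lintegral_add_left (hmeas hU k _),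
          lintegral_const_mul' _ _ ENNReal.ofReal_ne_top]
        calc _ ≤ ENNReal.ofReal (δ ^ (2 * θ)) *
              (K * (∫⁻ x, ‖U r x‖ₑ ^ 2) + K * ∫⁻ x, ‖V r x‖ₑ ^ 2) +
              ENNReal.ofReal (δ ^ 2) * (K * ∫⁻ x, ‖W r x‖ₑ ^ 2) := by
              gcongr
              · exact hgn hU hUκ k hk1 hk2
              · exact hgn hV hVκ k hk1 hk2
              · exact hgn hWs hW0 k hk1 hk2
          _ = _ := by rw [← hWr]; ring
    _ = _ := by
        rw [Finset.sum_const, Nat.card_Icc, nsmul_eq_mul, Nat.add_sub_cancel]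
        ring

end compDeriv

/-! ### Fourier transforms of derivatives -/

theorem hasTemperateGrowth_derivSymbol (e : Rd d) : (derivSymbol e).HasTemperateGrowth := by
  unfold derivSymbol
  fun_prop

/-- The Fourier transform of the derivative of a square integrable function. -/
theorem fourier_toLp_of_hasLineDerivAt {e : Rd d} {f f' : Rd d → ℂ} (hf : MemLp f 2 volume)
    (hf' : MemLp f' 2 volume) (h : ∀ x, HasLineDerivAt ℝ f (f' x) x e) :
    (𝓕 hf'.toLp : L2 d) =ᵐ[volume] fun η => derivSymbol e η * (𝓕 hf.toLp : L2 d) η := by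
  -- The pointwise derivative is the distributional one, by integration by parts against Schwartz
  -- functions.
  have h1 : (hf'.toLp : 𝓢'(Rd d, ℂ)) = ∂_{e} (hf.toLp : 𝓢'(Rd d, ℂ)) := by
    ext φ
    rw [lineDerivOp_apply_apply]
    have i1 := isFunction_L2_iff.2 hf'.coeFn_toLp φ
    have i2 := isFunction_L2_iff.2 hf.coeFn_toLp (-∂_{e} φ)
    have i3 := isFunction_L2_iff.2 hf.coeFn_toLp φ
    have i4 := isFunction_L2_iff.2 hf.coeFn_toLp (∂_{e} φ)
    rw [i1.2, i2.2]
    have hφ : ∀ x, HasLineDerivAt ℝ φ ((∂_{e} φ : 𝓢(Rd d, ℂ)) x) x e := by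
      intro x
      rw [SchwartzMap.lineDerivOp_apply]
      exact (φ.differentiableAt.lineDifferentiableAt).hasLineDerivAt
    have := integral_bilinear_hasLineDerivAt_right_eq_neg_left_of_integrable
      (μ := (volume : Measure (Rd d))) (f := φ) (f' := (∂_{e} φ : 𝓢(Rd d, ℂ))) (g := f) (g' := f')
      (v := e) (B := ContinuousLinearMap.mul ℝ ℂ) i4.1 i1.1 i3.1 (fun x _ => hφ x) (fun x _ => h x)
    simp only [ContinuousLinearMap.mul_apply'] at this
    rw [this, ← integral_neg]
    refine integral_congr_ae (Eventually.of_forall fun x => ?_)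
    simp
  have h2 : IsFunction (𝓕 (hf'.toLp : 𝓢'(Rd d, ℂ)))
      (fun η => derivSymbol e η * (𝓕 hf.toLp : L2 d) η) := by
    rw [h1, TemperedDistribution.fourier_lineDerivOp_eq, Lp.fourier_toTemperedDistribution_eq]
    have h3 := (IsFunction.of_L2 (𝓕 hf.toLp : L2 d)).smulLeft (hasTemperateGrowth_derivSymbol e)
    have h4 : derivSymbol e = (2 * Real.pi * Complex.I) • fun η : Rd d => ((inner ℝ η e : ℝ) : ℂ) := by
      ext η; simp [derivSymbol]
    rw [h4, smulLeftCLM_smul (by fun_prop)] at h3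
    exact h3
  rw [Lp.fourier_toTemperedDistribution_eq] at h2
  exact isFunction_L2_iff.1 h2

/-! ### Dyadic characterization of Sobolev norms -/

/-- A growing geometric sum is comparable to its last term; in the companion statement a decaying
one is comparable to its first. -/
theorem tsum_ite_le_pow_le {x : ℝ} (hx : 1 < x) (N : ℕ) :
    ∑' n : ℕ, (if n ≤ N then ENNReal.ofReal (x ^ n) else 0) ≤
      ENNReal.ofReal (x / (x - 1)) * ENNReal.ofReal (x ^ N) := by
  have hx0 : 0 < x - 1 := by linarith
  have hx' : 0 < x := by linarith
  rw [tsum_eq_sum (s := Finset.range (N + 1))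
    (fun n hn => if_neg (by simpa [Nat.lt_succ_iff] using hn))]
  calc ∑ n ∈ Finset.range (N + 1), (if n ≤ N then ENNReal.ofReal (x ^ n) else 0)
      = ∑ n ∈ Finset.range (N + 1), ENNReal.ofReal (x ^ n) :=
        Finset.sum_congr rfl fun n hn => if_pos (by simpa [Nat.lt_succ_iff] using hn)
    _ = ENNReal.ofReal ((x ^ (N + 1) - 1) / (x - 1)) := by
        rw [← ENNReal.ofReal_sum_of_nonneg fun n _ => by positivity, geom_sum_eq hx.ne']
    _ ≤ ENNReal.ofReal (x / (x - 1) * x ^ N) := by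
        refine ENNReal.ofReal_le_ofReal ?_
        rw [div_mul_eq_mul_div, pow_succ']
        gcongr
        linarith
    _ = _ := ENNReal.ofReal_mul (by positivity)

theorem tsum_ite_le_succ_pow_le {y : ℝ} (hy : 0 < y) (hy1 : y < 1) (N : ℕ) :
    ∑' n : ℕ, (if N ≤ n + 1 then ENNReal.ofReal (y ^ n) else 0) ≤
      ENNReal.ofReal (y⁻¹ / (1 - y)) * ENNReal.ofReal (y ^ N) := by
  have h1y : 0 < 1 - y := by linarith
  set g : ℕ → ℝ≥0∞ := fun m => if N ≤ m then ENNReal.ofReal (y ^ m) else 0 with hg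
  have h1 : ∀ n, (if N ≤ n + 1 then ENNReal.ofReal (y ^ n) else 0) =
      ENNReal.ofReal y⁻¹ * g (n + 1) := by
    intro n
    simp only [hg]
    split_ifs
    · rw [← ENNReal.ofReal_mul (by positivity), pow_succ']
      congr 1
      field_simp
    · simp
  have h2 : ∑' n, g (n + 1) ≤ ∑' n, g n :=
    ENNReal.tsum_comp_le_tsum_of_injective (add_left_injective 1) g
  have h3 : ∑' n, g n = ENNReal.ofReal (y ^ N) * (1 - ENNReal.ofReal y)⁻¹ := by
    rw [← Summable.sum_add_tsum_nat_add' (k := N) ENNReal.summable,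
      Finset.sum_eq_zero (fun n hn => if_neg (by simpa using hn)), zero_add,
      ← ENNReal.tsum_geometric, ← ENNReal.tsum_mul_left]
    refine tsum_congr fun n => ?_
    simp only [hg]
    rw [if_pos (by omega), ← ENNReal.ofReal_pow hy.le, ← ENNReal.ofReal_mul (by positivity),
      pow_add, mul_comm]
  simp_rw [h1]
  rw [ENNReal.tsum_mul_left]
  refine (mul_le_mul_right (h2.trans_eq h3) _).trans (le_of_eq ?_)
  rw [← ENNReal.ofReal_one, ← ENNReal.ofReal_sub _ hy.le, ← ENNReal.ofReal_inv_of_pos h1y,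
    ← ENNReal.ofReal_mul (by positivity), ← ENNReal.ofReal_mul (by positivity),
    ← ENNReal.ofReal_mul (by positivity)]
  congr 1
  field_simp

theorem sobolevWeight_sq (a : ℝ) (η : Rd d) : sobolevWeight a η ^ 2 = (1 + ‖η‖ ^ 2) ^ a := by
  rw [sobolevWeight, ← Real.rpow_natCast, ← Real.rpow_mul (by positivity)]
  congr 1
  push_cast
  ring

theorem exists_dyadic (η : Rd d) : ∃ N : ℕ, (4 : ℝ) ^ N ≤ 1 + ‖η‖ ^ 2 ∧ 1 + ‖η‖ ^ 2 < 4 ^ (N + 1) :=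
  exists_nat_pow_near (by nlinarith [sq_nonneg ‖η‖]) (by norm_num)

theorem four_pow_rpow (a : ℝ) (n : ℕ) : ((4 : ℝ) ^ n) ^ a = (4 ^ a) ^ n := by
  rw [← Real.rpow_natCast, ← Real.rpow_mul (by norm_num), mul_comm, Real.rpow_mul (by norm_num),
    Real.rpow_natCast]

theorem aemeasurable_enorm_fourier_sq (f : L2 d) :
    AEMeasurable (fun η => ‖(𝓕 f : L2 d) η‖ₑ ^ 2) volume :=
  (Lp.aestronglyMeasurable (𝓕 f : L2 d)).enorm.pow_const 2

theorem measurable_ofReal_weight_sq (a : ℝ) :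
    Measurable fun η : Rd d => ENNReal.ofReal (sobolevWeight a η) ^ 2 :=
  (continuous_sobolevWeight a).measurable.ennreal_ofReal.pow_const 2

theorem enorm_add_sq_le {E : Type*} [SeminormedAddCommGroup E] (a b : E) :
    ‖a + b‖ₑ ^ 2 ≤ 2 * (‖a‖ₑ ^ 2 + ‖b‖ₑ ^ 2) := by
  have h : ‖a + b‖ ^ 2 ≤ 2 * (‖a‖ ^ 2 + ‖b‖ ^ 2) :=
    (pow_le_pow_left₀ (norm_nonneg _) (norm_add_le a b) 2).trans add_sq_le
  have := ENNReal.ofReal_le_ofReal h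
  rwa [ENNReal.ofReal_mul two_pos.le, ENNReal.ofReal_add (by positivity) (by positivity),
    ENNReal.ofReal_pow (norm_nonneg _), ENNReal.ofReal_pow (norm_nonneg _),
    ENNReal.ofReal_pow (norm_nonneg _), ofReal_norm, ofReal_norm, ofReal_norm,
    ENNReal.ofReal_ofNat] at this

/-- A decomposition `G = (G - B n) + B n` for each `n` controls the Sobolev norm of `G`. -/
theorem sobolevNorm_sq_le_tsum {s r : ℝ} (hs : 0 ≤ s) (hsr : s ≤ r) (G : L2 d) (B : ℕ → L2 d) :
    sobolevNorm s G ^ 2 ≤ ENNReal.ofReal (2 * 4 ^ s) *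
      ∑' n, (ENNReal.ofReal ((4 ^ s) ^ n) * ‖G - B n‖ₑ ^ 2 +
        ENNReal.ofReal ((4 ^ (s - r)) ^ n) * sobolevNorm r (B n) ^ 2) := by
  have h1 : ∀ n, ENNReal.ofReal ((4 ^ s) ^ n) * ‖G - B n‖ₑ ^ 2 +
        ENNReal.ofReal ((4 ^ (s - r)) ^ n) * sobolevNorm r (B n) ^ 2 =
      ∫⁻ η, (ENNReal.ofReal ((4 ^ s) ^ n) * ‖(𝓕 (G - B n) : L2 d) η‖ₑ ^ 2 +
        ENNReal.ofReal ((4 ^ (s - r)) ^ n) *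
          (ENNReal.ofReal (sobolevWeight r η) ^ 2 * ‖(𝓕 (B n) : L2 d) η‖ₑ ^ 2)) := by
    intro n
    rw [lintegral_add_left' ((aemeasurable_enorm_fourier_sq _).const_mul _),
      lintegral_const_mul' _ _ ENNReal.ofReal_ne_top, lintegral_const_mul' _ _ ENNReal.ofReal_ne_top,
      ← sobolevNorm_sq, ← enorm_sq_eq_lintegral_fourier]
  simp_rw [h1]
  rw [← lintegral_tsum, sobolevNorm_sq, ← lintegral_const_mul' _ _ ENNReal.ofReal_ne_top]
  swap
  · intro n
    exact ((aemeasurable_enorm_fourier_sq _).const_mul _).add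
      (((measurable_ofReal_weight_sq r).aemeasurable.mul
        (aemeasurable_enorm_fourier_sq _)).const_mul _)
  refine lintegral_mono_ae ?_
  filter_upwards [ae_all_iff.2 fun n => fourier_sub_ae G (B n)] with η hη
  obtain ⟨N, hN1, hN2⟩ := exists_dyadic η
  -- At a frequency with 1 + |η|² ∼ 4^N only the N-th term of the series is kept: there 4^{Ns} is
  -- comparable to the squared weight of order s, and 4^{N(s-r)} to the quotient of the squared
  -- weights.
  refine le_trans ?_ (mul_le_mul_right (ENNReal.le_tsum N) _)
  have hJ : 0 < 1 + ‖η‖ ^ 2 := by positivity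
  have w1 : sobolevWeight s η ^ 2 ≤ 4 ^ s * (4 ^ s) ^ N := by
    rw [sobolevWeight_sq, ← pow_succ', ← four_pow_rpow]
    exact Real.rpow_le_rpow hJ.le hN2.le hs
  have w2 : sobolevWeight s η ^ 2 ≤ (4 ^ (s - r)) ^ N * sobolevWeight r η ^ 2 := by
    rw [sobolevWeight_sq, sobolevWeight_sq, ← four_pow_rpow,
      show s = (s - r) + r by ring, Real.rpow_add hJ, show s - r + r - r = s - r by ring]
    gcongr ?_ * _
    exact Real.rpow_le_rpow_of_nonpos (by positivity) hN1 (by linarith)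
  have h4 : (1 : ℝ) ≤ 4 ^ s := Real.one_le_rpow (by norm_num) hs
  have hW := ENNReal.ofReal_le_ofReal w1
  have hW2 := ENNReal.ofReal_le_ofReal w2
  rw [ENNReal.ofReal_mul (by positivity), ENNReal.ofReal_pow (sobolevWeight_pos _ _).le] at hW hW2
  rw [ENNReal.ofReal_pow (sobolevWeight_pos r η).le] at hW2
  have hsplit : (𝓕 G : L2 d) η = (𝓕 (G - B N) : L2 d) η + (𝓕 (B N) : L2 d) η := by
    rw [hη N]; ring
  rw [hsplit]
  calc _ ≤ ENNReal.ofReal (sobolevWeight s η) ^ 2 * (2 * (‖(𝓕 (G - B N) : L2 d) η‖ₑ ^ 2 +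
        ‖(𝓕 (B N) : L2 d) η‖ₑ ^ 2)) := by gcongr; exact enorm_add_sq_le _ _
    _ = 2 * (ENNReal.ofReal (sobolevWeight s η) ^ 2 * ‖(𝓕 (G - B N) : L2 d) η‖ₑ ^ 2 +
        ENNReal.ofReal (sobolevWeight s η) ^ 2 * ‖(𝓕 (B N) : L2 d) η‖ₑ ^ 2) := by ring
    _ ≤ 2 * (ENNReal.ofReal (4 ^ s) * ENNReal.ofReal ((4 ^ s) ^ N) *
          ‖(𝓕 (G - B N) : L2 d) η‖ₑ ^ 2 +
        ENNReal.ofReal (4 ^ s) * (ENNReal.ofReal ((4 ^ (s - r)) ^ N) *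
          ENNReal.ofReal (sobolevWeight r η) ^ 2 * ‖(𝓕 (B N) : L2 d) η‖ₑ ^ 2)) := by
        refine mul_le_mul_right (add_le_add (by gcongr) ?_) _
        refine le_trans (by gcongr) (le_mul_of_one_le_left zero_le ?_)
        rw [← ENNReal.ofReal_one]
        exact ENNReal.ofReal_le_ofReal h4
    _ = _ := by
        rw [ENNReal.ofReal_mul two_pos.le, ENNReal.ofReal_ofNat]
        ring

/-- The high frequency parts, summed with the weights `4^{ns}`. -/
theorem tsum_highFreq_le {s : ℝ} (hs : 0 < s) (u : L2 d) :
    ∑' n, ENNReal.ofReal ((4 ^ s) ^ n) * ‖u - lowFreq n u‖ₑ ^ 2 ≤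
      ENNReal.ofReal (4 ^ s / (4 ^ s - 1)) * sobolevNorm s u ^ 2 := by
  have hx : (1 : ℝ) < 4 ^ s := Real.one_lt_rpow (by norm_num) hs
  simp_rw [enorm_sq_eq_lintegral_fourier, ← lintegral_const_mul' _ _ ENNReal.ofReal_ne_top]
  rw [← lintegral_tsum (fun n => (aemeasurable_enorm_fourier_sq _).const_mul _), sobolevNorm_sq,
    ← lintegral_const_mul' _ _ ENNReal.ofReal_ne_top]
  refine lintegral_mono_ae ?_
  filter_upwards [ae_all_iff.2 fun n => fourier_sub_ae u (lowFreq n u),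
    ae_all_iff.2 fun n => fourier_lowFreq n u] with η h1 h2
  obtain ⟨N, hN1, hN2⟩ := exists_dyadic η
  -- For n > N the cutoff of index n equals 1 at η and the term vanishes, so the series is a finite
  -- geometric sum up to N.
  have h3 : ∀ n, ENNReal.ofReal ((4 ^ s) ^ n) * ‖(𝓕 (u - lowFreq n u) : L2 d) η‖ₑ ^ 2 ≤
      (if n ≤ N then ENNReal.ofReal ((4 ^ s) ^ n) else 0) * ‖(𝓕 u : L2 d) η‖ₑ ^ 2 := by
    intro n
    have h4 : (𝓕 (u - lowFreq n u) : L2 d) η = ((1 - cutoff n η : ℝ) : ℂ) * (𝓕 u : L2 d) η := by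
      rw [h1 n, h2 n]; push_cast; ring
    rw [h4]
    split_ifs with hn
    · gcongr
      rw [enorm_mul]
      refine mul_le_of_le_one_left zero_le ?_
      rw [← ofReal_norm, Complex.norm_real, ENNReal.ofReal_le_one, Real.norm_eq_abs, abs_le]
      constructor <;> linarith [cutoff_nonneg n η, cutoff_le_one n η]
    · have h5 : ‖η‖ ≤ 2 ^ n := by
        have h6 : ‖η‖ ^ 2 ≤ (2 ^ n) ^ 2 := by
          have h7 : (4 : ℝ) ^ (N + 1) ≤ 4 ^ n := pow_le_pow_right₀ (by norm_num) (by omega)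
          rw [← pow_mul, mul_comm, pow_mul]
          norm_num
          linarith
        exact le_of_sq_le_sq h6 (by positivity)
      rw [cutoff_eq_one h5]
      simp
  refine (ENNReal.tsum_le_tsum h3).trans ?_
  rw [ENNReal.tsum_mul_right, ← mul_assoc]
  gcongr
  refine (tsum_ite_le_pow_le hx N).trans ?_
  gcongr
  rw [← ENNReal.ofReal_pow (sobolevWeight_pos _ _).le, sobolevWeight_sq, ← four_pow_rpow]
  exact ENNReal.ofReal_le_ofReal (Real.rpow_le_rpow (by positivity) hN1 hs.le)

/-- The low frequency parts, summed with the weights `4^{n(s-r)}`. -/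
theorem exists_tsum_lowFreq_le {s r : ℝ} (hsr : s < r) : ∃ C : ℝ≥0∞, C ≠ ∞ ∧ ∀ u : L2 d,
    ∑' n, ENNReal.ofReal ((4 ^ (s - r)) ^ n) * sobolevNorm r (lowFreq n u) ^ 2 ≤
      C * sobolevNorm s u ^ 2 := by
  set y : ℝ := 4 ^ (s - r) with hy
  have hy0 : 0 < y := by positivity
  have hy1 : y < 1 := Real.rpow_lt_one_of_one_lt_of_neg (by norm_num) (by linarith)
  refine ⟨ENNReal.ofReal (y⁻¹ / (1 - y)) * ENNReal.ofReal y⁻¹,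
    ENNReal.mul_ne_top ENNReal.ofReal_ne_top ENNReal.ofReal_ne_top, fun u => ?_⟩
  simp_rw [sobolevNorm_sq, ← lintegral_const_mul' _ _ ENNReal.ofReal_ne_top]
  rw [← lintegral_tsum,
    ← lintegral_const_mul' _ _ (ENNReal.mul_ne_top ENNReal.ofReal_ne_top ENNReal.ofReal_ne_top)]
  swap
  · exact fun n => ((measurable_ofReal_weight_sq r).aemeasurable.mul
      (aemeasurable_enorm_fourier_sq _)).const_mul _
  refine lintegral_mono_ae ?_
  filter_upwards [ae_all_iff.2 fun n => fourier_lowFreq n u] with η h2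
  obtain ⟨N, hN1, hN2⟩ := exists_dyadic η
  -- For n + 1 < N the cutoff vanishes at η; the shift by one reflects its support in the ball of
  -- radius 2^{n+1}.
  have h3 : ∀ n, ENNReal.ofReal (y ^ n) * (ENNReal.ofReal (sobolevWeight r η) ^ 2 *
      ‖(𝓕 (lowFreq n u) : L2 d) η‖ₑ ^ 2) ≤
      (if N ≤ n + 1 then ENNReal.ofReal (y ^ n) else 0) *
        (ENNReal.ofReal (sobolevWeight r η) ^ 2 * ‖(𝓕 u : L2 d) η‖ₑ ^ 2) := by
    intro n
    rw [h2 n]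
    split_ifs with hn
    · gcongr
      rw [enorm_mul]
      refine mul_le_of_le_one_left zero_le ?_
      rw [← ofReal_norm, ENNReal.ofReal_le_one]
      exact norm_cutoff_le_one n η
    · have h5 : 2 ^ (n + 1) ≤ ‖η‖ := by
        have h6 : (2 ^ (n + 1)) ^ 2 ≤ ‖η‖ ^ 2 := by
          have h7 : (4 : ℝ) ^ (n + 2) ≤ 4 ^ N := pow_le_pow_right₀ (by norm_num) (by omega)
          rw [← pow_mul, mul_comm, pow_mul]
          have h8 : (1 : ℝ) ≤ 4 ^ (n + 1) := one_le_pow₀ (by norm_num)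
          rw [pow_succ (4 : ℝ) (n + 1)] at h7
          norm_num
          linarith
        exact le_of_sq_le_sq h6 (norm_nonneg _)
      rw [cutoff_eq_zero h5]
      simp
  refine (ENNReal.tsum_le_tsum h3).trans ?_
  rw [ENNReal.tsum_mul_right, ← mul_assoc, ← mul_assoc]
  gcongr ?_ * _
  refine (mul_le_mul_left (tsum_ite_le_succ_pow_le hy0 hy1 N) _).trans ?_
  rw [mul_assoc, mul_assoc]
  refine mul_le_mul_right ?_ _
  rw [← ENNReal.ofReal_pow (sobolevWeight_pos _ _).le, ← ENNReal.ofReal_pow (sobolevWeight_pos _ _).le,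
    ← ENNReal.ofReal_mul (by positivity), ← ENNReal.ofReal_mul (by positivity), sobolevWeight_sq,
    sobolevWeight_sq]
  refine ENNReal.ofReal_le_ofReal ?_
  have hJ : 0 < 1 + ‖η‖ ^ 2 := by positivity
  rw [show s = (s - r) + r by ring, Real.rpow_add hJ, ← mul_assoc]
  gcongr ?_ * _
  rw [le_inv_mul_iff₀ hy0, ← pow_succ', hy, ← four_pow_rpow]
  exact Real.rpow_le_rpow_of_nonpos hJ hN2.le (by linarith)

/-! ### Sobolev norms of integer order and derivatives -/

/-- The `i`-th coordinate direction. -/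
def coordVec (i : Fin d) : Rd d := EuclideanSpace.single i 1

theorem norm_derivSymbol_coordVec (i : Fin d) (η : Rd d) :
    ‖derivSymbol (coordVec i) η‖ = 2 * Real.pi * |η i| := by
  rw [derivSymbol, coordVec, EuclideanSpace.inner_single_right]
  simp [abs_of_pos Real.pi_pos]

/-- Each |η_i|² is at most S^{1/r}, where S is the sum on the right, so 1 + |η|² ≤ (d + 1) S^{1/r}.
Consequently the pure derivatives of order r control H^r, and one direction can be treated at a
time. -/
theorem sobolevWeight_natCast_sq_le (r : ℕ) (η : Rd d) :
    sobolevWeight r η ^ 2 ≤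
      (d + 1) ^ r * (1 + ∑ i : Fin d, (‖derivSymbol (coordVec i) η‖ ^ r) ^ 2) := by
  rw [sobolevWeight_sq, Real.rpow_natCast]
  set a : Fin d → ℝ := fun i => ‖derivSymbol (coordVec i) η‖ with ha
  have h1 : ∀ i, ‖η i‖ ^ 2 ≤ a i ^ 2 := by
    intro i
    simp only [ha, norm_derivSymbol_coordVec]
    gcongr
    rw [Real.norm_eq_abs]
    exact le_mul_of_one_le_left (abs_nonneg _) (by nlinarith [Real.pi_gt_three])
  set S := 1 + ∑ i : Fin d, (a i ^ r) ^ 2 with hS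
  have hS1 : 1 ≤ S := by
    rw [hS]
    exact le_add_of_nonneg_right (Finset.sum_nonneg fun i _ => by positivity)
  rcases Nat.eq_zero_or_pos r with rfl | hr
  · simpa using hS1
  have h2 : ∀ i, a i ^ 2 ≤ S ^ (r⁻¹ : ℝ) := by
    intro i
    have h3 : (a i ^ 2) ^ r ≤ S := by
      rw [← pow_mul, mul_comm, pow_mul]
      have : (a i ^ r) ^ 2 ≤ ∑ i : Fin d, (a i ^ r) ^ 2 :=
        Finset.single_le_sum (f := fun i => (a i ^ r) ^ 2) (fun i _ => by positivity)
          (Finset.mem_univ i)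
      linarith
    calc a i ^ 2 = ((a i ^ 2) ^ r) ^ (r⁻¹ : ℝ) :=
          (Real.pow_rpow_inv_natCast (by positivity) hr.ne').symm
      _ ≤ _ := Real.rpow_le_rpow (by positivity) h3 (by positivity)
  have h4 : 1 ≤ S ^ (r⁻¹ : ℝ) := Real.one_le_rpow hS1 (by positivity)
  have h5 : 1 + ‖η‖ ^ 2 ≤ (d + 1) * S ^ (r⁻¹ : ℝ) := by
    rw [EuclideanSpace.norm_sq_eq]
    have : ∑ i : Fin d, ‖η i‖ ^ 2 ≤ ∑ _i : Fin d, S ^ (r⁻¹ : ℝ) :=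
      Finset.sum_le_sum fun i _ => (h1 i).trans (h2 i)
    rw [Finset.sum_const, Finset.card_univ, Fintype.card_fin, nsmul_eq_mul] at this
    linarith
  calc (1 + ‖η‖ ^ 2) ^ r ≤ ((d + 1) * S ^ (r⁻¹ : ℝ)) ^ r := by gcongr
    _ = (d + 1) ^ r * S := by
      rw [mul_pow, Real.rpow_inv_natCast_pow (by linarith) hr.ne']

theorem sobolevNorm_natCast_sq_le (r : ℕ) (G : L2 d) (g : Fin d → L2 d)
    (hg : ∀ i, (𝓕 (g i) : L2 d) =ᵐ[volume] fun η => derivSymbol (coordVec i) η ^ r * (𝓕 G : L2 d) η) :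
    sobolevNorm r G ^ 2 ≤ ENNReal.ofReal ((d + 1) ^ r) * (‖G‖ₑ ^ 2 + ∑ i, ‖g i‖ₑ ^ 2) := by
  simp_rw [sobolevNorm_sq, enorm_sq_eq_lintegral_fourier]
  rw [← lintegral_finsetSum' _ fun i _ => aemeasurable_enorm_fourier_sq (g i),
    ← lintegral_add_left' (aemeasurable_enorm_fourier_sq G),
    ← lintegral_const_mul' _ _ ENNReal.ofReal_ne_top]
  refine lintegral_mono_ae ?_
  filter_upwards [ae_all_iff.2 hg] with η h
  have h1 := ENNReal.ofReal_le_ofReal (sobolevWeight_natCast_sq_le r η)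
  rw [ENNReal.ofReal_pow (sobolevWeight_pos _ _).le, ENNReal.ofReal_mul (by positivity),
    ENNReal.ofReal_add zero_le_one (Finset.sum_nonneg fun i _ => by positivity),
    ENNReal.ofReal_sum_of_nonneg fun i _ => by positivity, ENNReal.ofReal_one] at h1
  refine (mul_le_mul_left h1 _).trans (le_of_eq ?_)
  rw [mul_assoc, add_mul, one_mul, Finset.sum_mul]
  congr 2
  refine Finset.sum_congr rfl fun i _ => ?_
  rw [h i, enorm_mul, enorm_pow, mul_pow, ENNReal.ofReal_pow (by positivity),
    ENNReal.ofReal_pow (by positivity), ofReal_norm]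

theorem lintegral_lowFreqDeriv_sq_le (n r : ℕ) (i : Fin d) (u : L2 d) :
    ∫⁻ x, ‖lowFreqDeriv n (coordVec i) u r x‖ₑ ^ 2 ≤
      ENNReal.ofReal ((2 * Real.pi) ^ r) ^ 2 * sobolevNorm r (lowFreq n u) ^ 2 := by
  have h1 : ∀ f : Rd d → ℂ, ∫⁻ x, ‖f x‖ₑ ^ 2 = eLpNorm f 2 volume ^ 2 := by
    intro f
    have := eLpNorm_nnreal_pow_eq_lintegral (p := 2) (f := f) (μ := volume) two_ne_zero
    simpa using this.symm
  rw [h1, eLpNorm_lowFreqDeriv, ← h1, sobolevNorm_sq,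
    ← lintegral_const_mul' _ _ (ENNReal.pow_ne_top ENNReal.ofReal_ne_top)]
  refine lintegral_mono_ae ?_
  filter_upwards [fourier_lowFreq n u] with η h
  rw [h, lowFreqSymbol, enorm_mul, mul_pow, ← mul_assoc]
  refine mul_le_mul_left ?_ _
  rw [← mul_pow]
  refine pow_le_pow_left' ?_ 2
  rw [← ENNReal.ofReal_mul (by positivity), ← ofReal_norm, norm_pow, norm_derivSymbol_coordVec,
    mul_pow]
  refine ENNReal.ofReal_le_ofReal (mul_le_mul_of_nonneg_left ?_ (by positivity))
  refine le_of_sq_le_sq ?_ (sobolevWeight_pos _ _).le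
  rw [sobolevWeight_sq, Real.rpow_natCast,
    show (|η i| ^ r) ^ 2 = (|η i| ^ 2) ^ r by rw [← pow_mul, ← pow_mul, mul_comm]]
  gcongr
  have h2 : ‖η i‖ ^ 2 ≤ ‖η‖ ^ 2 := by
    gcongr
    exact PiLp.norm_apply_le η i
  rw [Real.norm_eq_abs] at h2
  linarith

theorem sobolevNorm_le_of_tendsto {a : ℝ} {B : ℕ → L2 d} {G : L2 d} {c : ℝ≥0∞}
    (h : Tendsto B atTop (𝓝 G)) (hc : ∀ n, sobolevNorm a (B n) ≤ c) : sobolevNorm a G ≤ c := by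
  have hF : Tendsto (fun n => (𝓕 (B n) : L2 d)) atTop (𝓝 (𝓕 G)) :=
    ((Lp.fourierTransformₗᵢ (Rd d) ℂ).continuous.tendsto G).comp h
  obtain ⟨ns, -, hns⟩ := (tendstoInMeasure_of_tendsto_Lp hF).exists_seq_tendsto_ae
  refine (Lp.eLpNorm_lim_le_liminf_eLpNorm
    (f := fun n η => (sobolevWeight a η : ℂ) * (𝓕 (B (ns n)) : L2 d) η)
    (fun n => aestronglyMeasurable_weight_mul a _) _ ?_).trans ?_
  · filter_upwards [hns] with η hη
    exact hη.const_mul _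
  · refine liminf_le_of_le (by isBoundedDefault) fun b hb => ?_
    obtain ⟨n, hn⟩ := hb.exists
    exact hn.trans (hc (ns n))

/-! ### Differences of nonlinear functions in Sobolev spaces -/

/-- The low frequency parts are bounded uniformly in the frequency. -/
theorem exists_norm_lowFreqDeriv_zero_le (d : ℕ) : ∃ κ : ℝ, 1 ≤ κ ∧
    ∀ (n : ℕ) (e : Rd d) (f : L2 d) (M : ℝ), (∀ᵐ x, ‖f x‖ ≤ M) →
      ∀ x, ‖lowFreqDeriv n e f 0 x‖ ≤ κ * M := by
  set K := eLpNorm (cutoffKernel d 0) 1 volume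
  have hK : K ≠ ∞ := (memLp_cutoffKernel d 0 1).2.ne
  refine ⟨max 1 K.toReal, le_max_left _ _, fun n e f M hM x => ?_⟩
  have hM0 : 0 ≤ M := by
    obtain ⟨y, hy⟩ := hM.exists
    exact (norm_nonneg _).trans hy
  -- The L¹ norm of the kernel is invariant under scaling, which gives a constant independent of n.
  have h1 := enorm_lowFreqDeriv_zero_le n e f x (q := ∞) (q' := 1)
  rw [eLpNorm_cutoffKernel d n ENNReal.one_ne_top] at h1
  simp only [ENNReal.toReal_one, inv_one, sub_self, mul_zero, Real.rpow_zero, ENNReal.ofReal_one,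
    one_mul] at h1
  have h2 : eLpNorm f ∞ volume ≤ ENNReal.ofReal M := by
    rw [eLpNorm_exponent_top]
    refine eLpNormEssSup_le_of_ae_enorm_bound ?_
    filter_upwards [hM] with y hy
    rw [← ofReal_norm]
    exact ENNReal.ofReal_le_ofReal hy
  have h3 : ‖lowFreqDeriv n e f 0 x‖ₑ ≤ ENNReal.ofReal (K.toReal * M) := by
    rw [ENNReal.ofReal_mul ENNReal.toReal_nonneg, ENNReal.ofReal_toReal hK]
    exact h1.trans (by gcongr)
  rw [← ofReal_norm, ENNReal.ofReal_le_ofReal_iff (by positivity)] at h3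
  refine h3.trans ?_
  gcongr
  exact le_max_right _ _

theorem LocallyHolder.exists_lipschitz {r : ℕ} {θ : ℝ} {F : ℂ → ℂ} (hF : LocallyHolder r θ F)
    (hr : 1 ≤ r) (κ : ℝ) : ∃ C, 0 ≤ C ∧ ∀ x y, ‖x‖ ≤ κ → ‖y‖ ≤ κ →
      ‖F x - F y‖ ≤ C * ‖x - y‖ := by
  obtain ⟨C, hC, h⟩ := hF.exists_bound κ
  refine ⟨C, hC, fun x y hx hy => ?_⟩
  refine (convex_closedBall (0 : ℂ) κ).norm_image_sub_le_of_norm_fderiv_le (𝕜 := ℝ)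
      (fun z _ => hF.contDiff.differentiable (by exact_mod_cast (by omega : r ≠ 0)) z)
      (fun z hz => ?_) (by simpa using hy) (by simpa using hx)
  have h3 := (h 1 hr z z (by simpa using hz) (by simpa using hz)).1
  rwa [norm_iteratedFDeriv_one] at h3

theorem memLp_comp_of_bounded {r : ℕ} {θ : ℝ} {F : ℂ → ℂ} (hF : LocallyHolder r θ F)
    (hr : 1 ≤ r) (hF0 : F 0 = 0) {κ : ℝ} {u : L2 d} (hu : ∀ᵐ x, ‖u x‖ ≤ κ) :
    MemLp (fun x => F (u x)) 2 volume := by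
  obtain ⟨C, -, h⟩ := hF.exists_lipschitz hr κ
  refine (Lp.memLp u).of_le_mul (c := C)
    (hF.contDiff.continuous.comp_aestronglyMeasurable (Lp.aestronglyMeasurable u)) ?_
  filter_upwards [hu] with x hx
  have := h (u x) 0 hx (by simpa using (norm_nonneg _).trans hx)
  simpa [hF0] using this

/-- A pointwise bound by two `L²` functions. -/
theorem enorm_sq_le_of_ae_le {f g h : L2 d} {C D : ℝ}
    (hle : ∀ᵐ x, ‖f x‖ ≤ C * (‖g x‖ + D * ‖h x‖)) :
    ‖f‖ₑ ^ 2 ≤ ENNReal.ofReal (2 * C ^ 2) * (‖g‖ₑ ^ 2 + ENNReal.ofReal (D ^ 2) * ‖h‖ₑ ^ 2) := by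
  have h1 : ∀ f : L2 d, ‖f‖ₑ ^ 2 = ∫⁻ x, ‖f x‖ₑ ^ 2 := by
    intro f
    have := eLpNorm_nnreal_pow_eq_lintegral (p := 2) (f := f) (μ := volume) two_ne_zero
    rw [Lp.enorm_def]
    simpa using this
  rw [h1, h1, h1, ← lintegral_const_mul' _ _ ENNReal.ofReal_ne_top,
    ← lintegral_add_left' ((Lp.aestronglyMeasurable g).enorm.pow_const 2),
    ← lintegral_const_mul' _ _ ENNReal.ofReal_ne_top]
  refine lintegral_mono_ae ?_
  filter_upwards [hle] with x hx
  rw [← ofReal_norm, ← ofReal_norm, ← ofReal_norm, ← ENNReal.ofReal_pow (norm_nonneg _),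
    ← ENNReal.ofReal_pow (norm_nonneg _), ← ENNReal.ofReal_pow (norm_nonneg _),
    ← ENNReal.ofReal_mul (by positivity), ← ENNReal.ofReal_add (by positivity) (by positivity),
    ← ENNReal.ofReal_mul (by positivity)]
  refine ENNReal.ofReal_le_ofReal ?_
  calc ‖f x‖ ^ 2 ≤ (C * (‖g x‖ + D * ‖h x‖)) ^ 2 := by gcongr
    _ = C ^ 2 * (‖g x‖ + D * ‖h x‖) ^ 2 := by ring
    _ ≤ C ^ 2 * (2 * (‖g x‖ ^ 2 + (D * ‖h x‖) ^ 2)) := by gcongr; exact add_sq_le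
    _ = _ := by ring

/-- The `H^r` estimate for differences, `r` an integer, for the low frequency parts. -/
theorem exists_sobolevNorm_comp_lowFreq_sub_le (d : ℕ) {r : ℕ} {θ : ℝ} {F : ℂ → ℂ}
    (hF : LocallyHolder r θ F) (hr : 1 ≤ r) (hF0 : F 0 = 0) :
    ∃ C : ℝ≥0∞, C ≠ ∞ ∧ ∀ (n : ℕ) (u v G : L2 d) (δ : ℝ), 0 < δ → δ ≤ 2 →
      (∀ᵐ x, ‖u x‖ ≤ 1) → (∀ᵐ x, ‖v x‖ ≤ 1) → (∀ᵐ x, ‖(u - v) x‖ ≤ δ) →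
      (G =ᵐ[volume] fun x => F (lowFreq n u x) - F (lowFreq n v x)) →
      sobolevNorm r G ^ 2 ≤ C * (sobolevNorm r (lowFreq n (u - v)) ^ 2 +
        ENNReal.ofReal (δ ^ (2 * θ)) *
          (sobolevNorm r (lowFreq n u) ^ 2 + sobolevNorm r (lowFreq n v) ^ 2)) := by
  obtain ⟨κ, hκ1, hκ⟩ := exists_norm_lowFreqDeriv_zero_le d
  have hκ0 : 0 ≤ κ := zero_le_one.trans hκ1
  obtain ⟨C₁, hC₁, hcomp⟩ := exists_lintegral_compDeriv_sub_le d hF hr κ hκ0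
  obtain ⟨C₂, hC₂, hlip⟩ := hF.exists_lipschitz hr κ
  set c : ℝ≥0∞ := ENNReal.ofReal ((2 * Real.pi) ^ r) ^ 2
  have hc : c ≠ ∞ := ENNReal.pow_ne_top ENNReal.ofReal_ne_top
  refine ⟨ENNReal.ofReal ((d + 1) ^ r) * (ENNReal.ofReal (2 * C₂ ^ 2) + d * (C₁ * c)), ?_,
    fun n u v G δ hδ hδ2 hu hv huv hG => ?_⟩
  · exact ENNReal.mul_ne_top ENNReal.ofReal_ne_top (ENNReal.add_ne_top.2 ⟨ENNReal.ofReal_ne_top,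
      ENNReal.mul_ne_top (ENNReal.natCast_ne_top d) (ENNReal.mul_ne_top hC₁ hc)⟩)
  set R := sobolevNorm r (lowFreq n (u - v)) ^ 2 + ENNReal.ofReal (δ ^ (2 * θ)) *
          (sobolevNorm r (lowFreq n u) ^ 2 + sobolevNorm r (lowFreq n v) ^ 2) with hR
  have hchain : ∀ i : Fin d, ∃ g : L2 d, ((𝓕 g : L2 d) =ᵐ[volume]
      fun η => derivSymbol (coordVec i) η ^ r * (𝓕 G : L2 d) η) ∧ ‖g‖ₑ ^ 2 ≤ C₁ * c * R := by
    intro i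
    set e := coordVec i
    set U := lowFreqDeriv n e u with hUdef
    set V := lowFreqDeriv n e v with hVdef
    have hU : SmoothAlong e U := smoothAlong_lowFreqDeriv n e u
    have hV : SmoothAlong e V := smoothAlong_lowFreqDeriv n e v
    have hmem : ∀ m ≤ r, MemLp (fun x => compDeriv F U m x - compDeriv F V m x) 2 volume :=
      fun m hm => (memLp_compDeriv hU hF hr hF0 hm).sub (memLp_compDeriv hV hF hr hF0 hm)
    have h0 : (hmem 0 (Nat.zero_le r)).toLp = G := by
      refine Lp.ext ((hmem 0 (Nat.zero_le r)).coeFn_toLp.trans ?_)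
      filter_upwards [hG, lowFreq_ae_eq n e u, lowFreq_ae_eq n e v] with x h1 h2 h3
      rw [h1, h2, h3, compDeriv_zero hU hF.contDiff, compDeriv_zero hV hF.contDiff]
    -- The composition is differentiable only up to order r, so the factors of the Fourier
    -- multiplier are collected one derivative at a time.
    have hfour : ∀ m (hm : m ≤ r), (𝓕 (hmem m hm).toLp : L2 d) =ᵐ[volume]
        fun η => derivSymbol e η ^ m * (𝓕 G : L2 d) η := by
      intro m
      induction m with
      | zero => intro hm; rw [h0]; simp only [pow_zero, one_mul]; exact EventuallyEq.rfl
      | succ m ih =>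
        intro hm
        have h1 := fourier_toLp_of_hasLineDerivAt (e := e) (hmem m (by omega)) (hmem (m + 1) hm)
          fun x => (compDeriv_hasLineDerivAt hU hF.contDiff hm x).sub
            (compDeriv_hasLineDerivAt hV hF.contDiff hm x)
        filter_upwards [h1, ih (by omega)] with η h2 h3
        rw [h2, h3, pow_succ]
        ring
    refine ⟨(hmem r le_rfl).toLp, hfour r le_rfl, ?_⟩
    have h2 : ‖(hmem r le_rfl).toLp‖ₑ ^ 2 =
        ∫⁻ x, ‖compDeriv F U r x - compDeriv F V r x‖ₑ ^ 2 := by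
      rw [Lp.enorm_toLp]
      have := eLpNorm_nnreal_pow_eq_lintegral (p := 2) (μ := volume)
        (f := fun x => compDeriv F U r x - compDeriv F V r x) two_ne_zero
      simpa using this
    have hsub : ∀ j x, U j x - V j x = lowFreqDeriv n e (u - v) j x :=
      fun j x => (lowFreqDeriv_sub n e u v j x).symm
    rw [h2]
    refine (hcomp hU hV hδ hδ2 (fun x => by simpa using hκ n e u 1 hu x)
      (fun x => by simpa using hκ n e v 1 hv x)
      (fun x => by rw [hsub]; exact hκ n e (u - v) δ huv x)).trans ?_
    simp only [hsub]
    rw [mul_assoc, hR]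
    gcongr
    calc _ ≤ c * sobolevNorm r (lowFreq n (u - v)) ^ 2 + ENNReal.ofReal (δ ^ (2 * θ)) *
          (c * sobolevNorm r (lowFreq n u) ^ 2 + c * sobolevNorm r (lowFreq n v) ^ 2) := by
          gcongr
          · exact lintegral_lowFreqDeriv_sq_le n r i (u - v)
          · exact lintegral_lowFreqDeriv_sq_le n r i u
          · exact lintegral_lowFreqDeriv_sq_le n r i v
      _ = _ := by ring
  choose g hg hgle using hchain
  have hG2 : ‖G‖ₑ ^ 2 ≤ ENNReal.ofReal (2 * C₂ ^ 2) * R := by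
    have h1 : ‖G‖ₑ ^ 2 ≤ ENNReal.ofReal (2 * C₂ ^ 2) *
        (‖lowFreq n (u - v)‖ₑ ^ 2 + ENNReal.ofReal (0 ^ 2) * ‖(0 : L2 d)‖ₑ ^ 2) := by
      refine enorm_sq_le_of_ae_le ?_
      rw [lowFreq_sub]
      filter_upwards [hG, Lp.coeFn_sub (lowFreq n u) (lowFreq n v), lowFreq_ae_eq n 0 u,
        lowFreq_ae_eq n 0 v] with x h1 h2 h3 h4
      rw [h1, h2, zero_mul, add_zero, Pi.sub_apply]
      refine hlip _ _ ?_ ?_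
      · rw [h3]; simpa using hκ n 0 u 1 hu x
      · rw [h4]; simpa using hκ n 0 v 1 hv x
    refine h1.trans ?_
    gcongr
    simp only [ne_eq, OfNat.ofNat_ne_zero, not_false_eq_true, zero_pow, ENNReal.ofReal_zero, zero_mul,
      add_zero, hR]
    refine le_trans ?_ le_self_add
    gcongr
    rw [← sobolevNorm_zero]
    exact sobolevNorm_mono (by positivity) _
  refine (sobolevNorm_natCast_sq_le r G g hg).trans ?_
  rw [mul_assoc]
  gcongr
  calc _ ≤ ENNReal.ofReal (2 * C₂ ^ 2) * R + ∑ _i : Fin d, C₁ * c * R :=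
        add_le_add hG2 (Finset.sum_le_sum fun i _ => hgle i)
    _ = _ := by
        rw [Finset.sum_const, Finset.card_univ, Fintype.card_fin, nsmul_eq_mul]
        ring

/-- The `H^s` estimate for differences of nonlinear functions of bounded functions. -/
theorem exists_sobolevNorm_comp_sub_sq_le (d : ℕ) {r : ℕ} {θ : ℝ} {F : ℂ → ℂ}
    (hF : LocallyHolder r θ F) (hr : 1 ≤ r) (hF0 : F 0 = 0) {s : ℝ} (hs : 0 ≤ s) (hsr : s ≤ r) :
    ∃ C : ℝ≥0∞, C ≠ ∞ ∧ ∀ (u v G : L2 d) (δ : ℝ), 0 < δ → δ ≤ 2 →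
      (∀ᵐ x, ‖u x‖ ≤ 1) → (∀ᵐ x, ‖v x‖ ≤ 1) → (∀ᵐ x, ‖(u - v) x‖ ≤ δ) →
      (G =ᵐ[volume] fun x => F (u x) - F (v x)) →
      sobolevNorm s G ^ 2 ≤ C * (sobolevNorm s (u - v) ^ 2 +
        ENNReal.ofReal (δ ^ (2 * θ)) * (sobolevNorm s u ^ 2 + sobolevNorm s v ^ 2)) := by
  rcases hs.eq_or_lt with rfl | hs0
  · obtain ⟨C, hC, hlip⟩ := hF.exists_lipschitz hr 1
    refine ⟨ENNReal.ofReal (2 * C ^ 2), ENNReal.ofReal_ne_top,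
      fun u v G δ hδ hδ2 hu hv huv hG => ?_⟩
    have h1 : ‖G‖ₑ ^ 2 ≤ ENNReal.ofReal (2 * C ^ 2) *
        (‖u - v‖ₑ ^ 2 + ENNReal.ofReal (0 ^ 2) * ‖(0 : L2 d)‖ₑ ^ 2) := by
      refine enorm_sq_le_of_ae_le ?_
      filter_upwards [hG, Lp.coeFn_sub u v, hu, hv] with x h1 h2 h3 h4
      rw [h1, h2, zero_mul, add_zero, Pi.sub_apply]
      exact hlip _ _ h3 h4
    simp only [sobolevNorm_zero]
    refine h1.trans (mul_le_mul_right (add_le_add_right ?_ _) _)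
    simp
  obtain ⟨κ, hκ1, hκ⟩ := exists_norm_lowFreqDeriv_zero_le d
  have hκ0 : 0 ≤ κ := zero_le_one.trans hκ1
  obtain ⟨C₁, hC₁, hlow⟩ := exists_sobolevNorm_comp_lowFreq_sub_le d hF hr hF0
  obtain ⟨C₂, hC₂, hsec⟩ := hF.exists_second_difference_le hr κ
  have hbd : ∀ {n : ℕ} {u : L2 d}, (∀ᵐ x, ‖u x‖ ≤ 1) → ∀ᵐ x, ‖lowFreq n u x‖ ≤ κ := by
    intro n u hu
    filter_upwards [lowFreq_ae_eq n 0 u] with x hx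
    rw [hx]
    simpa using hκ n 0 u 1 hu x
  have hGn : ∀ (u v : L2 d), (∀ᵐ x, ‖u x‖ ≤ 1) → (∀ᵐ x, ‖v x‖ ≤ 1) → ∀ n : ℕ, ∃ B : L2 d,
      B =ᵐ[volume] fun x => F (lowFreq n u x) - F (lowFreq n v x) := fun u v hu hv n =>
    ⟨((memLp_comp_of_bounded hF hr hF0 (hbd hu)).sub
      (memLp_comp_of_bounded hF hr hF0 (hbd hv))).toLp, MemLp.coeFn_toLp _⟩
  -- G - B is a second difference of F, between (u, v) and their low frequency parts. Its L² norm is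
  -- thus controlled by the high frequencies of u - v, and by those of v with the factor δ^θ.
  have hdiff : ∀ (u v G B : L2 d) (δ : ℝ) (n : ℕ), 0 < δ →
      (∀ᵐ x, ‖u x‖ ≤ 1) → (∀ᵐ x, ‖v x‖ ≤ 1) → (∀ᵐ x, ‖(u - v) x‖ ≤ δ) →
      (G =ᵐ[volume] fun x => F (u x) - F (v x)) →
      (B =ᵐ[volume] fun x => F (lowFreq n u x) - F (lowFreq n v x)) →
      ‖G - B‖ₑ ^ 2 ≤ ENNReal.ofReal (2 * C₂ ^ 2) * (‖(u - v) - lowFreq n (u - v)‖ₑ ^ 2 +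
        ENNReal.ofReal (δ ^ (2 * θ)) * ‖v - lowFreq n v‖ₑ ^ 2) := by
    intro u v G B δ n hδ hu hv huv hG hB
    have hδsq : (δ ^ θ) ^ 2 = δ ^ (2 * θ) := by
      rw [mul_comm, Real.rpow_mul hδ.le]; norm_num
    rw [← hδsq]
    refine enorm_sq_le_of_ae_le ?_
    rw [lowFreq_sub]
    filter_upwards [hu, hv, huv, hG, hB, Lp.coeFn_sub G B, Lp.coeFn_sub u v,
      Lp.coeFn_sub v (lowFreq n v), Lp.coeFn_sub (lowFreq n u) (lowFreq n v),
      Lp.coeFn_sub (u - v) (lowFreq n u - lowFreq n v), hbd (n := n) hu, hbd (n := n) hv] with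
      x h1 h2 h3 h4 h5 h6 h7 h8 h9 h10 h11 h12
    rw [h6, h10, Pi.sub_apply, Pi.sub_apply, h7, h9, h8, h4, h5, Pi.sub_apply, Pi.sub_apply,
      Pi.sub_apply]
    refine (hsec (u x) (v x) (lowFreq n u x) (lowFreq n v x) (h1.trans hκ1) (h2.trans hκ1)
      h11 h12).trans ?_
    rw [h7, Pi.sub_apply] at h3
    gcongr
    exact hF.pos.le
  -- For s = r the approximations are bounded in H^r and converge in L², so the bound passes to the
  -- limit. For s < r the L² smallness of G - B_n and the H^r size of B_n are balanced at each scale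
  -- by `sobolevNorm_sq_le_tsum`.
  rcases hsr.eq_or_lt with rfl | hsr'
  · refine ⟨C₁, hC₁, fun u v G δ hδ hδ2 hu hv huv hG => ?_⟩
    choose B hB using hGn u v hu hv
    have hlim : Tendsto B atTop (𝓝 G) := by
      rw [tendsto_iff_edist_tendsto_0]
      have h1 : ∀ w : L2 d, Tendsto (fun n => ‖w - lowFreq n w‖ₑ ^ 2) atTop (𝓝 0) := by
        intro w
        have h2 := (tendsto_iff_edist_tendsto_0.1 (tendsto_lowFreq w))
        have h3 : (fun n => ‖w - lowFreq n w‖ₑ ^ 2) = fun n => edist (lowFreq n w) w ^ 2 := by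
          ext n; rw [edist_comm, edist_eq_enorm_sub]
        rw [h3]
        simpa using ENNReal.Tendsto.pow (n := 2) h2
      have h4 : Tendsto (fun n => ‖G - B n‖ₑ ^ 2) atTop (𝓝 0) := by
        refine tendsto_of_tendsto_of_tendsto_of_le_of_le tendsto_const_nhds ?_ (fun n => zero_le)
          fun n => hdiff u v G (B n) δ n hδ hu hv huv hG (hB n)
        have h5 := ENNReal.Tendsto.const_mul (a := ENNReal.ofReal (δ ^ (2 * θ))) (h1 v)
          (Or.inr ENNReal.ofReal_ne_top)
        have h6 := ENNReal.Tendsto.const_mul (a := ENNReal.ofReal (2 * C₂ ^ 2))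
          ((h1 (u - v)).add h5) (Or.inr ENNReal.ofReal_ne_top)
        simpa using h6
      have h7 : (fun n => edist (B n) G) = fun n => (‖G - B n‖ₑ ^ 2) ^ (1 / 2 : ℝ) := by
        ext n
        rw [edist_comm, edist_eq_enorm_sub, ← ENNReal.rpow_natCast, ← ENNReal.rpow_mul]
        norm_num
      rw [h7]
      simpa using h4.ennrpow_const (1 / 2)
    have hle : ∀ n, sobolevNorm r (B n) ≤ (C₁ * (sobolevNorm r (u - v) ^ 2 +
        ENNReal.ofReal (δ ^ (2 * θ)) * (sobolevNorm r u ^ 2 + sobolevNorm r v ^ 2))) ^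
          (1 / 2 : ℝ) := by
      intro n
      have h1 := hlow n u v (B n) δ hδ hδ2 hu hv huv (hB n)
      have h2 : sobolevNorm r (B n) = (sobolevNorm r (B n) ^ 2) ^ (1 / 2 : ℝ) := by
        rw [← ENNReal.rpow_natCast, ← ENNReal.rpow_mul]; norm_num
      rw [h2]
      gcongr
      refine h1.trans ?_
      gcongr <;> exact sobolevNorm_lowFreq_le _ _ _
    have h3 := sobolevNorm_le_of_tendsto hlim hle
    refine (pow_le_pow_left' h3 2).trans (le_of_eq ?_)
    rw [← ENNReal.rpow_natCast, ← ENNReal.rpow_mul]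
    norm_num
  · obtain ⟨C₃, hC₃, hsum⟩ := exists_tsum_lowFreq_le (d := d) hsr'
    set c₁ := ENNReal.ofReal (4 ^ s / (4 ^ s - 1))
    set c₂ := ENNReal.ofReal (2 * C₂ ^ 2)
    refine ⟨ENNReal.ofReal (2 * 4 ^ s) * (c₂ * c₁ + C₁ * C₃), ?_,
      fun u v G δ hδ hδ2 hu hv huv hG => ?_⟩
    · exact ENNReal.mul_ne_top ENNReal.ofReal_ne_top (ENNReal.add_ne_top.2
        ⟨ENNReal.mul_ne_top ENNReal.ofReal_ne_top ENNReal.ofReal_ne_top,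
          ENNReal.mul_ne_top hC₁ hC₃⟩)
    choose B hB using hGn u v hu hv
    set D := ENNReal.ofReal (δ ^ (2 * θ))
    refine (sobolevNorm_sq_le_tsum hs hsr G B).trans ?_
    rw [mul_assoc]
    gcongr
    calc _ ≤ ∑' n, (c₂ * (ENNReal.ofReal ((4 ^ s) ^ n) * ‖(u - v) - lowFreq n (u - v)‖ₑ ^ 2 +
          D * (ENNReal.ofReal ((4 ^ s) ^ n) * ‖v - lowFreq n v‖ₑ ^ 2)) +
          C₁ * (ENNReal.ofReal ((4 ^ (s - r)) ^ n) * sobolevNorm r (lowFreq n (u - v)) ^ 2 +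
            D * (ENNReal.ofReal ((4 ^ (s - r)) ^ n) * sobolevNorm r (lowFreq n u) ^ 2 +
              ENNReal.ofReal ((4 ^ (s - r)) ^ n) * sobolevNorm r (lowFreq n v) ^ 2))) := by
          refine ENNReal.tsum_le_tsum fun n => ?_
          have h1 := hdiff u v G (B n) δ n hδ hu hv huv hG (hB n)
          have h2 := hlow n u v (B n) δ hδ hδ2 hu hv huv (hB n)
          refine (add_le_add (mul_le_mul_right h1 _) (mul_le_mul_right h2 _)).trans (le_of_eq ?_)
          ring
      _ ≤ c₂ * (c₁ * sobolevNorm s (u - v) ^ 2 + D * (c₁ * sobolevNorm s v ^ 2)) +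
          C₁ * (C₃ * sobolevNorm s (u - v) ^ 2 +
            D * (C₃ * sobolevNorm s u ^ 2 + C₃ * sobolevNorm s v ^ 2)) := by
          rw [ENNReal.tsum_add, ENNReal.tsum_mul_left, ENNReal.tsum_mul_left, ENNReal.tsum_add,
            ENNReal.tsum_mul_left, ENNReal.tsum_add, ENNReal.tsum_mul_left, ENNReal.tsum_add]
          gcongr
          · exact tsum_highFreq_le hs0 _
          · exact tsum_highFreq_le hs0 _
          · exact hsum _
          · exact hsum _
          · exact hsum _
      _ ≤ c₂ * (c₁ * sobolevNorm s (u - v) ^ 2 + D * (c₁ * (sobolevNorm s u ^ 2 +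
            sobolevNorm s v ^ 2))) + C₁ * (C₃ * sobolevNorm s (u - v) ^ 2 +
            D * (C₃ * sobolevNorm s u ^ 2 + C₃ * sobolevNorm s v ^ 2)) := by
          gcongr
          exact le_add_self
      _ = _ := by ring

theorem exists_sobolevNorm_comp_sub_le (d : ℕ) {r : ℕ} {θ : ℝ} {F : ℂ → ℂ}
    (hF : LocallyHolder r θ F) (hr : 1 ≤ r) (hF0 : F 0 = 0) {s : ℝ} (hs : 0 ≤ s) (hsr : s ≤ r) :
    ∃ C : ℝ≥0∞, C ≠ ∞ ∧ ∀ (u v G : L2 d) (δ : ℝ), 0 < δ → δ ≤ 2 →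
      (∀ᵐ x, ‖u x‖ ≤ 1) → (∀ᵐ x, ‖v x‖ ≤ 1) → (∀ᵐ x, ‖(u - v) x‖ ≤ δ) →
      (G =ᵐ[volume] fun x => F (u x) - F (v x)) →
      sobolevNorm s G ≤ C * (sobolevNorm s (u - v) +
        ENNReal.ofReal δ ^ θ * (sobolevNorm s u + sobolevNorm s v)) := by
  obtain ⟨C, hC, hmain⟩ := exists_sobolevNorm_comp_sub_sq_le d hF hr hF0 hs hsr
  refine ⟨C ^ (1 / 2 : ℝ), ENNReal.rpow_ne_top_of_nonneg (by norm_num) hC,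
    fun u v G δ hδ hδ2 hu hv huv hG => ?_⟩
  have h1 := hmain u v G δ hδ hδ2 hu hv huv hG
  have h2 : ENNReal.ofReal (δ ^ (2 * θ)) = (ENNReal.ofReal δ ^ θ) ^ 2 := by
    rw [ENNReal.ofReal_rpow_of_pos hδ, ← ENNReal.ofReal_pow (by positivity), mul_comm,
      Real.rpow_mul hδ.le]
    norm_num
  rw [h2] at h1
  have h3 : sobolevNorm s (u - v) ^ 2 + (ENNReal.ofReal δ ^ θ) ^ 2 *
      (sobolevNorm s u ^ 2 + sobolevNorm s v ^ 2) ≤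
      (sobolevNorm s (u - v) + ENNReal.ofReal δ ^ θ * (sobolevNorm s u + sobolevNorm s v)) ^ 2 := by
    have e1 : ∀ a b c D : ℝ≥0∞, a ^ 2 + D ^ 2 * (b ^ 2 + c ^ 2) ≤ (a + D * (b + c)) ^ 2 := by
      intro a b c D
      calc _ ≤ (a ^ 2 + D ^ 2 * (b ^ 2 + c ^ 2)) + (2 * D ^ 2 * b * c + 2 * a * D * (b + c)) :=
            le_self_add
        _ = _ := by ring
    exact e1 _ _ _ _
  have h4 : ∀ x : ℝ≥0∞, (x ^ 2) ^ (1 / 2 : ℝ) = x := by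
    intro x
    rw [← ENNReal.rpow_natCast, ← ENNReal.rpow_mul]; norm_num
  rw [← h4 (sobolevNorm s G)]
  calc _ ≤ (C * (sobolevNorm s (u - v) + ENNReal.ofReal δ ^ θ *
        (sobolevNorm s u + sobolevNorm s v)) ^ 2) ^ (1 / 2 : ℝ) := by
        gcongr
        exact h1.trans (by gcongr)
    _ = _ := by rw [ENNReal.mul_rpow_of_nonneg _ _ (by norm_num), h4]

/-- Differences of the power nonlinearity in `H^s`. -/
theorem exists_sobolevNorm_powNonlin_sub_le (d : ℕ) {b s : ℝ} (hb : 0 < b) (hs : 0 ≤ s)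
    (h : (∃ n : ℕ, b = 2 * n) ∨ ∃ r : ℕ, s ≤ r ∧ r < b + 1) :
    ∃ θ, 0 < θ ∧ θ ≤ 1 ∧ θ ≤ b ∧ ∃ C : ℝ≥0∞, C ≠ ∞ ∧ ∀ (u v G : L2 d) (M : ℝ≥0∞), M ≠ ∞ →
      eLpNorm u ∞ volume ≤ M → eLpNorm v ∞ volume ≤ M →
      (G =ᵐ[volume] fun x => powNonlin b (u x) - powNonlin b (v x)) →
      sobolevNorm s G ≤ C * (M ^ b * sobolevNorm s (u - v) +
        eLpNorm (u - v : L2 d) ∞ volume ^ θ * M ^ (b - θ) * (sobolevNorm s u + sobolevNorm s v)) := by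
  -- The order r must be at least 1 for F to be C¹. Raising it to 1 is harmless because 1 < b + 1,
  -- and for an even integer b every order is allowed.
  obtain ⟨r, hr, hsr, hr'⟩ : ∃ r : ℕ, 1 ≤ r ∧ s ≤ r ∧ ((∃ n : ℕ, b = 2 * n) ∨ r < b + 1) := by
    rcases h with h | ⟨r, hsr, hrb⟩
    · exact ⟨⌈s⌉₊ + 1, by omega, (Nat.le_ceil s).trans (by push_cast; linarith), Or.inl h⟩
    · refine ⟨max r 1, le_max_right _ _, hsr.trans (by exact_mod_cast le_max_left _ _), Or.inr ?_⟩
      rcases max_choice r 1 with h | h <;> rw [h]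
      · exact hrb
      · push_cast; linarith
  obtain ⟨θ, hθb, hF⟩ := exists_locallyHolder_powNonlin hb hr'
  have hF0 : powNonlin b 0 = 0 := by simp [powNonlin]
  obtain ⟨C, hC, hunit⟩ := exists_sobolevNorm_comp_sub_le d hF hr hF0 hs hsr
  refine ⟨θ, hF.pos, hF.le_one, hθb, C, hC, fun u v G M hM hu hv hG => ?_⟩
  set δ := eLpNorm (u - v : L2 d) ∞ volume with hδdef
  have hae : ∀ w : L2 d, ∀ᵐ x, ‖w x‖ₑ ≤ eLpNorm w ∞ volume := by
    intro w
    rw [eLpNorm_exponent_top]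
    exact enorm_ae_le_eLpNormEssSup _ _
  rcases eq_or_ne δ 0 with hδ0 | hδ0
  · have h1 : G = 0 := by
      refine Lp.ext ?_
      filter_upwards [hG, hae (u - v), Lp.coeFn_sub u v, Lp.coeFn_zero ℂ 2 volume] with x h1 h2 h3 h4
      rw [h3, ← hδdef, hδ0, nonpos_iff_eq_zero, enorm_eq_zero, Pi.sub_apply, sub_eq_zero] at h2
      rw [h1, h4, h2, sub_self, Pi.zero_apply]
    rw [h1, sobolevNorm_zero_right]
    exact zero_le
  have hδM : δ ≤ 2 * M := by
    rw [two_mul]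
    exact (eLpNorm_L2_sub_le ∞ (by simp) u v).trans (add_le_add hu hv)
  have hδt : δ ≠ ∞ := ne_top_of_le_ne_top (ENNReal.mul_ne_top (by simp) hM) hδM
  have hM0 : M ≠ 0 := by
    rintro rfl
    exact hδ0 (by simpa using hδM)
  set m : ℝ := M.toReal with hm
  have hm0 : 0 < m := ENNReal.toReal_pos hM0 hM
  have hMm : M = ENNReal.ofReal m := (ENNReal.ofReal_toReal hM).symm
  -- Rescaling by 1/M reduces to functions bounded by 1, where the uniform norm of the difference is
  -- δ/M ≤ 2. Homogeneity of degree b + 1 restores the powers of M.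
  set c : ℂ := ((m⁻¹ : ℝ) : ℂ) with hc
  have hcn : ‖c‖ = m⁻¹ := by rw [hc, Complex.norm_real, Real.norm_of_nonneg (by positivity)]
  have hcne : ‖c‖ₑ = M⁻¹ := by
    rw [← ofReal_norm, hcn, ENNReal.ofReal_inv_of_pos hm0, ← hMm]
  set cG : ℂ := ((m⁻¹ ^ (b + 1) : ℝ) : ℂ) with hcG
  have hcGne : ‖cG‖ₑ = M⁻¹ ^ (b + 1) := by
    rw [← ofReal_norm, hcG, Complex.norm_real, Real.norm_of_nonneg (by positivity),
      ← ENNReal.ofReal_rpow_of_pos (by positivity), ENNReal.ofReal_inv_of_pos hm0, ← hMm]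
  have hbnd : ∀ w : L2 d, ∀ K : ℝ≥0∞, K ≠ ∞ → eLpNorm w ∞ volume ≤ K →
      ∀ᵐ x, ‖(c • w) x‖ ≤ (K / M).toReal := by
    intro w K hK hw
    filter_upwards [hae w, Lp.coeFn_smul c w] with x h1 h2
    rw [h2, Pi.smul_apply, norm_smul, hcn, ENNReal.toReal_div, div_eq_inv_mul, ← hm]
    gcongr
    have := ENNReal.toReal_mono hK (h1.trans hw)
    simpa using this
  have h1 := hunit (c • u) (c • v) (cG • G) (δ / M).toReal
    (ENNReal.toReal_pos (ENNReal.div_ne_zero.2 ⟨hδ0, hM⟩) (ENNReal.div_ne_top hδt hM0))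
    (by
      have : δ / M ≤ 2 := ENNReal.div_le_of_le_mul hδM
      simpa using ENNReal.toReal_mono (by simp) this)
    (by simpa [ENNReal.div_self hM0 hM] using hbnd u M hM hu)
    (by simpa [ENNReal.div_self hM0 hM] using hbnd v M hM hv)
    (by rw [← smul_sub]; exact hbnd (u - v) δ hδt le_rfl)
    (by
      filter_upwards [hG, Lp.coeFn_smul c u, Lp.coeFn_smul c v, Lp.coeFn_smul cG G] with x h1 h2 h3 h4
      have e1 : ∀ z : ℂ, powNonlin b (c • z) = cG • powNonlin b z := by
        intro z
        have := (smoothHomogeneous_powNonlin b).map_smul m⁻¹ (by positivity) z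
        rw [Complex.real_smul, Complex.real_smul] at this
        exact this
      rw [h2, h3, h4, Pi.smul_apply, Pi.smul_apply, Pi.smul_apply, h1, e1, e1, smul_sub])
  rw [← smul_sub, sobolevNorm_smul, sobolevNorm_smul, sobolevNorm_smul, sobolevNorm_smul, hcne, hcGne,
    ENNReal.ofReal_toReal (ENNReal.div_ne_top hδt hM0), ENNReal.inv_rpow,
    ENNReal.inv_mul_le_iff (by simp [hM0, hM]) (ENNReal.rpow_ne_top_of_nonneg (by linarith) hM)] at h1
  refine h1.trans (le_of_eq ?_)
  have e1 : M ^ (b + 1) = M ^ b * M := by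
    rw [ENNReal.rpow_add_of_nonneg _ _ hb.le zero_le_one, ENNReal.rpow_one]
  have e2 : M * M⁻¹ = 1 := ENNReal.mul_inv_cancel hM0 hM
  have e3 : (δ / M) ^ θ = δ ^ θ * (M ^ θ)⁻¹ := by
    rw [ENNReal.div_eq_inv_mul, ENNReal.mul_rpow_of_nonneg _ _ hF.pos.le, ENNReal.inv_rpow, mul_comm]
  have e4 : M ^ b * (M ^ θ)⁻¹ = M ^ (b - θ) := by
    rw [ENNReal.rpow_sub _ _ hM0 hM, div_eq_mul_inv]
  rw [e1, e3, ← e4]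
  calc _ = C * (M ^ b * (M * M⁻¹) * sobolevNorm s (u - v) + δ ^ θ *
        (M ^ b * (M ^ θ)⁻¹) * ((M * M⁻¹) * (sobolevNorm s u + sobolevNorm s v))) := by ring
    _ = _ := by rw [e2, mul_one, one_mul]

/-! ### The inhomogeneous linear equation -/

section evolution

variable {P : Rd d → ℝ} (hP : Measurable P) {s : ℝ}

/-- The solution `S(-t) u₀ + ∫₀ᵗ S(-(t-τ)) H(τ) dτ` of the inhomogeneous linear equation. -/
def evolution (u₀ : Hs d s) (H : ℝ → Hs d s) (t : ℝ) : Hs d s :=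
  propagator hP (-t) u₀ + ∫ τ in (0 : ℝ)..t, propagator hP (-(t - τ)) (H τ)

theorem integrableOn_propagator {H : ℝ → Hs d s} {S : Set ℝ} (hH : IntegrableOn H S) {φ : ℝ → ℝ}
    (hφ : Continuous φ) : IntegrableOn (fun τ => propagator hP (φ τ) (H τ)) S := by
  have hm : AEStronglyMeasurable (fun τ => propagator hP (φ τ) (H τ)) (volume.restrict S) :=
    Continuous.comp_aestronglyMeasurable (g := fun x : ℝ × Hs d s => propagator hP x.1 x.2)
      (f := fun τ => (φ τ, H τ)) (Hs.continuous_propagator hP)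
      (hφ.aestronglyMeasurable.prodMk hH.aestronglyMeasurable)
  exact Integrable.congr' hH hm (Eventually.of_forall fun τ => (Hs.norm_propagator hP _ _).symm)

theorem intervalIntegrable_of_integrableOn_Icc {E : Type*} [NormedAddCommGroup E] {f : ℝ → E}
    {T t : ℝ} (hf : IntegrableOn f (Icc 0 T)) (ht : t ∈ Icc 0 T) :
    IntervalIntegrable f volume 0 t := by
  rw [intervalIntegrable_iff_integrableOn_Icc_of_le ht.1]
  exact hf.mono_set (Icc_subset_Icc_right ht.2)

/-- Taking S(-t) out of the integral leaves an integrand independent of t. Continuity in t then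
follows from that of a primitive and the joint continuity of the propagator. -/
theorem evolution_eq {T : ℝ} (u₀ : Hs d s) {H : ℝ → Hs d s} (hH : IntegrableOn H (Icc 0 T)) {t : ℝ}
    (ht : t ∈ Icc 0 T) : evolution hP u₀ H t =
      propagator hP (-t) (u₀ + ∫ τ in (0 : ℝ)..t, propagator hP τ (H τ)) := by
  rw [← Hs.propagatorₗᵢ_apply, map_add, Hs.propagatorₗᵢ_apply, evolution]
  congr 1
  have h := (Hs.propagatorₗᵢ hP s (-t)).toContinuousLinearMap.intervalIntegral_comp_comm
    (intervalIntegrable_of_integrableOn_Icc (integrableOn_propagator hP hH continuous_id) ht)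
  refine Eq.trans ?_ h
  refine intervalIntegral.integral_congr fun τ _ => ?_
  change _ = propagator hP (-t) (propagator hP τ (H τ))
  rw [Hs.propagator_propagator]
  congr 1
  ring

theorem continuousOn_evolution {T : ℝ} (u₀ : Hs d s) {H : ℝ → Hs d s}
    (hH : IntegrableOn H (Icc 0 T)) : ContinuousOn (evolution hP u₀ H) (Icc 0 T) := by
  have h1 : ContinuousOn (fun t => ∫ τ in (0 : ℝ)..t, propagator hP τ (H τ)) (Icc 0 T) := by
    rcases le_total 0 T with hT | hT
    · have := intervalIntegral.continuousOn_primitive_interval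
        (f := fun τ => propagator hP τ (H τ)) (μ := volume) (a := 0) (b := T) (by
          rw [uIcc_of_le hT]; exact integrableOn_propagator hP hH continuous_id)
      rwa [uIcc_of_le hT] at this
    · rcases hT.eq_or_lt with rfl | hT
      · simp
      · simp [Icc_eq_empty hT.not_ge]
  have h2 : ContinuousOn (fun t => propagator hP (-t)
      (u₀ + ∫ τ in (0 : ℝ)..t, propagator hP τ (H τ))) (Icc 0 T) :=
    Continuous.comp_continuousOn (g := fun x : ℝ × Hs d s => propagator hP x.1 x.2)
      (f := fun t => (-t, u₀ + ∫ τ in (0 : ℝ)..t, propagator hP τ (H τ)))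
      (Hs.continuous_propagator hP) (continuousOn_id.neg.prodMk (continuousOn_const.add h1))
  exact h2.congr fun t ht => evolution_eq hP u₀ hH ht

theorem evolution_sub {T : ℝ} (u₀ v₀ : Hs d s) {H H' : ℝ → Hs d s} (hH : IntegrableOn H (Icc 0 T))
    (hH' : IntegrableOn H' (Icc 0 T)) {t : ℝ} (ht : t ∈ Icc 0 T) :
    evolution hP (u₀ - v₀) (fun τ => H τ - H' τ) t = evolution hP u₀ H t - evolution hP v₀ H' t := by
  have hsub : ∀ (τ : ℝ) (u v : Hs d s),
      propagator hP τ (u - v) = propagator hP τ u - propagator hP τ v := fun τ u v =>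
    (Hs.propagatorₗᵢ hP s τ).map_sub u v
  simp only [evolution, hsub]
  rw [intervalIntegral.integral_sub
    (intervalIntegrable_of_integrableOn_Icc (integrableOn_propagator hP hH (by fun_prop)) ht)
    (intervalIntegrable_of_integrableOn_Icc (integrableOn_propagator hP hH' (by fun_prop)) ht)]
  abel

theorem evolution_congr {T : ℝ} (u₀ : Hs d s) {H H' : ℝ → Hs d s}
    (h : ∀ᵐ τ ∂(volume.restrict (Icc 0 T)), H τ = H' τ) {t : ℝ} (ht : t ∈ Icc 0 T) :
    evolution hP u₀ H t = evolution hP u₀ H' t := by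
  unfold evolution
  congr 1
  refine intervalIntegral.integral_congr_ae ?_
  rw [ae_restrict_iff' measurableSet_Icc] at h
  filter_upwards [h] with τ hτ hmem
  rw [uIoc_of_le ht.1] at hmem
  rw [hτ ⟨hmem.1.le, hmem.2.trans ht.2⟩]

variable (hs : 0 ≤ s)

theorem toL2_evolution {T : ℝ} (u₀ : Hs d s) {H : ℝ → Hs d s} (hH : IntegrableOn H (Icc 0 T))
    {t : ℝ} (ht : t ∈ Icc 0 T) : Hs.toL2 hs (evolution hP u₀ H t) =
      propagatorL2 hP (-t) (Hs.toL2 hs u₀) +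
        ∫ τ in (0 : ℝ)..t, propagatorL2 hP (-(t - τ)) (Hs.toL2 hs (H τ)) := by
  rw [evolution, map_add, Hs.toL2_propagator]
  congr 1
  have h := (Hs.toL2 hs).intervalIntegral_comp_comm (intervalIntegrable_of_integrableOn_Icc
    (integrableOn_propagator hP hH (φ := fun τ => -(t - τ)) (by fun_prop)) ht)
  rw [← h]
  exact intervalIntegral.integral_congr fun τ _ => Hs.toL2_propagator hP hs _ _

theorem enorm_propagatorL2 (t : ℝ) (f : L2 d) : ‖propagatorL2 hP t f‖ₑ = ‖f‖ₑ := by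
  rw [← ofReal_norm, norm_propagatorL2, ofReal_norm]

theorem enorm_intervalIntegral_le {E : Type*} [NormedAddCommGroup E] [NormedSpace ℝ E] (f : ℝ → E)
    {t : ℝ} (ht : 0 ≤ t) : ‖∫ τ in (0 : ℝ)..t, f τ‖ₑ ≤ ∫⁻ τ in Icc 0 t, ‖f τ‖ₑ := by
  rw [intervalIntegral.integral_of_le ht]
  exact (enorm_integral_le_lintegral_enorm _).trans
    (lintegral_mono_set Ioc_subset_Icc_self)

theorem enorm_evolution_le (u₀ : Hs d s) (H : ℝ → Hs d s) {t : ℝ} (ht : 0 ≤ t) :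
    ‖evolution hP u₀ H t‖ₑ ≤ ‖u₀‖ₑ + ∫⁻ τ in Icc 0 t, ‖H τ‖ₑ := by
  have hn : ∀ (τ : ℝ) (u : Hs d s), ‖propagator hP τ u‖ₑ = ‖u‖ₑ := fun τ u => by
    rw [← ofReal_norm, Hs.norm_propagator, ofReal_norm]
  refine (enorm_add_le _ _).trans ?_
  rw [hn]
  gcongr
  refine (enorm_intervalIntegral_le _ ht).trans (le_of_eq ?_)
  simp only [hn]

theorem enorm_toL2_evolution_le {T : ℝ} (u₀ : Hs d s) {H : ℝ → Hs d s}
    (hH : IntegrableOn H (Icc 0 T)) {t : ℝ} (ht : t ∈ Icc 0 T) :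
    ‖Hs.toL2 hs (evolution hP u₀ H t)‖ₑ ≤
      ‖Hs.toL2 hs u₀‖ₑ + ∫⁻ τ in Icc 0 t, ‖Hs.toL2 hs (H τ)‖ₑ := by
  rw [toL2_evolution hP hs u₀ hH ht]
  refine (enorm_add_le _ _).trans ?_
  rw [enorm_propagatorL2]
  gcongr
  refine (enorm_intervalIntegral_le _ ht.1).trans (le_of_eq ?_)
  simp only [enorm_propagatorL2]

theorem aemeasurable_eLpNorm_evolution {T : ℝ} (u₀ : Hs d s) {H : ℝ → Hs d s}
    (hH : IntegrableOn H (Icc 0 T)) : AEMeasurable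
      (fun t => eLpNorm (Hs.toL2 hs (evolution hP u₀ H t)) ∞ volume) (volume.restrict (Icc 0 T)) := by
  have h1 : AEMeasurable (evolution hP u₀ H) (volume.restrict (Icc 0 T)) :=
    ((continuousOn_evolution hP u₀ hH).aestronglyMeasurable measurableSet_Icc).aemeasurable
  exact ((measurable_eLpNorm_L2 ∞).comp (Hs.toL2 hs).continuous.measurable).comp_aemeasurable h1

/-- The space-time estimate for the inhomogeneous equation. -/
theorem lintegral_eLpNorm_evolution_le {a p₁ T₀ T : ℝ} {C' : ℝ≥0∞} (hC' : C' ≠ ∞) (hp₁ : 1 ≤ p₁)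
    (hmain : ∀ f : L2 d, sobolevNorm a f ≠ ∞ →
      ∫⁻ t in Icc 0 T₀, eLpNorm (propagatorL2 hP (-t) f) ∞ volume ^ p₁ ≤
        (C' * sobolevNorm a f) ^ p₁)
    (hT : T ≤ T₀) (has : a ≤ s) (u₀ : Hs d s) {H : ℝ → Hs d s} (hH : StronglyMeasurable H)
    (hHi : IntegrableOn H (Icc 0 T)) {h : ℝ → ℝ≥0∞} (hh : Measurable h)
    (hle : ∀ τ, sobolevNorm a (Hs.toL2 hs (H τ)) ≤ h τ) (hfin : ∫⁻ τ in Icc 0 T, h τ ≠ ∞) :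
    ∫⁻ t in Icc 0 T, eLpNorm (Hs.toL2 hs (evolution hP u₀ H t)) ∞ volume ^ p₁ ≤
      (C' * (sobolevNorm a (Hs.toL2 hs u₀) + ∫⁻ τ in Icc 0 T, h τ)) ^ p₁ := by
  have hp0 : 0 < p₁ := by linarith
  set f : ℝ → ℝ≥0∞ := fun t => eLpNorm (propagatorL2 hP (-t) (Hs.toL2 hs u₀)) ∞ volume with hf
  set g : ℝ → ℝ≥0∞ := fun t => eLpNorm (Hs.toL2 hs (evolution hP 0 H t)) ∞ volume with hg
  have hu₀ : sobolevNorm a (Hs.toL2 hs u₀) ≠ ∞ :=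
    ne_top_of_le_ne_top (b := ‖u₀‖ₑ) (by simp) ((sobolevNorm_mono has _).trans_eq
      (Hs.sobolevNorm_toL2 hs u₀))
  have h0 : ∀ t ∈ Icc 0 T, Hs.toL2 hs (evolution hP 0 H t) =
      ∫ τ in (0 : ℝ)..t, propagatorL2 hP (-(t - τ)) (Hs.toL2 hs (H τ)) := by
    intro t ht
    rw [toL2_evolution hP hs 0 hHi ht, map_zero]
    have : propagatorL2 hP (-t) (0 : L2 d) = 0 := (propagatorL2ₗᵢ hP (-t)).map_zero
    rw [this, zero_add]
  have hsplit : ∀ t ∈ Icc 0 T, eLpNorm (Hs.toL2 hs (evolution hP u₀ H t)) ∞ volume ≤ f t + g t := by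
    intro t ht
    rw [toL2_evolution hP hs u₀ hHi ht, ← h0 t ht]
    exact eLpNorm_L2_add_le ∞ (by simp) _ _
  have hfm : AEMeasurable f (volume.restrict (Icc 0 T)) :=
    ((measurable_eLpNorm_propagatorL2 hP ∞ (Hs.toL2 hs u₀)).comp measurable_neg).aemeasurable
  have hgm : AEMeasurable g (volume.restrict (Icc 0 T)) :=
    aemeasurable_eLpNorm_evolution hP hs 0 hHi
  have hf1 : ∫⁻ t in Icc 0 T, f t ^ p₁ ≤ (C' * sobolevNorm a (Hs.toL2 hs u₀)) ^ p₁ :=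
    (lintegral_mono_set (Icc_subset_Icc_right hT)).trans (hmain _ hu₀)
  have hg1 : ∫⁻ t in Icc 0 T, g t ^ p₁ ≤ (C' * ∫⁻ τ in Icc 0 T, h τ) ^ p₁ := by
    have h1 := duhamel_lintegral_top_le hP hC' hp₁ hmain hT
      (H := fun τ => Hs.toL2 hs (H τ)) ((Hs.toL2 hs).continuous.comp_stronglyMeasurable hH) hh
      (Eventually.of_forall fun τ _ => hle τ) hfin
    refine le_trans (le_of_eq (setLIntegral_congr_fun measurableSet_Icc fun t ht => ?_)) h1
    simp only [hg]
    rw [h0 t ht]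
  have hroot : ∀ {x y : ℝ≥0∞}, x ≤ y ^ p₁ → x ^ (1 / p₁) ≤ y := by
    intro x y hxy
    calc x ^ (1 / p₁) ≤ (y ^ p₁) ^ (1 / p₁) := by gcongr
      _ = y := by rw [← ENNReal.rpow_mul, mul_one_div_cancel hp0.ne', ENNReal.rpow_one]
  have hmink := ENNReal.lintegral_Lp_add_le hfm hgm hp₁
  have htot : (∫⁻ t in Icc 0 T, (f t + g t) ^ p₁) ^ (1 / p₁) ≤
      C' * (sobolevNorm a (Hs.toL2 hs u₀) + ∫⁻ τ in Icc 0 T, h τ) := by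
    rw [mul_add]
    exact hmink.trans (add_le_add (hroot hf1) (hroot hg1))
  calc _ ≤ ∫⁻ t in Icc 0 T, (f t + g t) ^ p₁ :=
        setLIntegral_mono_ae' measurableSet_Icc
          (Eventually.of_forall fun t ht => ENNReal.rpow_le_rpow (hsplit t ht) hp0.le)
    _ = ((∫⁻ t in Icc 0 T, (f t + g t) ^ p₁) ^ (1 / p₁)) ^ p₁ := by
        rw [← ENNReal.rpow_mul, one_div_mul_cancel hp0.ne', ENNReal.rpow_one]
    _ ≤ _ := by gcongr

end evolution

/-! ### Interpolation of Sobolev norms and Gronwall's inequality -/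

/-- Interpolation between `L²` and `H^s`. -/
theorem sobolevNorm_mul_le {μ s : ℝ} (hμ0 : 0 ≤ μ) (hμ1 : μ ≤ 1) (f : L2 d) :
    sobolevNorm (μ * s) f ≤ ‖f‖ₑ ^ (1 - μ) * sobolevNorm s f ^ μ := by
  have h1 : sobolevNorm (μ * s) f ^ 2 ≤ (‖f‖ₑ ^ 2) ^ (1 - μ) * (sobolevNorm s f ^ 2) ^ μ := by
    rw [sobolevNorm_sq, sobolevNorm_sq, enorm_sq_eq_lintegral_fourier]
    refine le_trans (lintegral_mono fun η => ?_) (ENNReal.lintegral_mul_norm_pow_le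
      (aemeasurable_enorm_fourier_sq f) ((measurable_ofReal_weight_sq s).aemeasurable.mul
        (aemeasurable_enorm_fourier_sq f)) (by linarith) hμ0 (by ring))
    simp only [Pi.mul_apply]
    have hw : ENNReal.ofReal (sobolevWeight (μ * s) η) ^ 2 =
        (ENNReal.ofReal (sobolevWeight s η) ^ 2) ^ μ := by
      rw [← ENNReal.ofReal_pow (sobolevWeight_pos _ _).le,
        ← ENNReal.ofReal_pow (sobolevWeight_pos _ _).le,
        ENNReal.ofReal_rpow_of_pos (by have := sobolevWeight_pos s η; positivity),
        sobolevWeight_sq, sobolevWeight_sq, ← Real.rpow_mul (by positivity), mul_comm]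
    rw [hw, ENNReal.mul_rpow_of_nonneg _ _ hμ0]
    set x := ‖(𝓕 f : L2 d) η‖ₑ ^ 2
    refine le_of_eq ?_
    calc _ = (ENNReal.ofReal (sobolevWeight s η) ^ 2) ^ μ * (x ^ (1 - μ) * x ^ μ) := by
          rw [← ENNReal.rpow_add_of_nonneg _ _ (by linarith) hμ0, sub_add_cancel, ENNReal.rpow_one]
      _ = _ := by ring
  have h2 : ∀ x : ℝ≥0∞, (x ^ 2) ^ (1 / 2 : ℝ) = x := by
    intro x
    rw [← ENNReal.rpow_natCast, ← ENNReal.rpow_mul]; norm_num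
  have h3 : ∀ (x : ℝ≥0∞) (y : ℝ), (x ^ 2) ^ y = (x ^ y) ^ 2 := by
    intro x y
    rw [← ENNReal.rpow_natCast, ← ENNReal.rpow_natCast, ← ENNReal.rpow_mul, ← ENNReal.rpow_mul,
      mul_comm]
  rw [h3, h3, ← mul_pow] at h1
  rw [← h2 (sobolevNorm (μ * s) f), ← h2 (‖f‖ₑ ^ (1 - μ) * sobolevNorm s f ^ μ)]
  gcongr

/-- Gronwall's inequality with an integrable coefficient. -/
theorem setLIntegral_eq_zero_of_le_mul {f m : ℝ → ℝ≥0∞} {T : ℝ} (hT : 0 < T)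
    (hf : ∫⁻ τ in Icc 0 T, f τ ≠ ∞) (hm : ∫⁻ τ in Icc 0 T, m τ ≠ ∞)
    (hle : ∀ᵐ τ ∂(volume.restrict (Icc 0 T)), f τ ≤ m τ * ∫⁻ σ in Icc 0 τ, f σ) :
    ∫⁻ τ in Icc 0 T, f τ = 0 := by
  -- By absolute continuity, [0,T] splits into equal pieces on which ∫ m < 1. If f vanishes up to
  -- the left end of a piece, its integral I up to the right end satisfies I ≤ (∫ m) I, hence I = 0.
  obtain ⟨δ, hδ, hsmall⟩ := exists_pos_setLIntegral_lt_of_measure_lt hm one_ne_zero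
  obtain ⟨N, hN⟩ : ∃ N : ℕ, ENNReal.ofReal (T / (N + 1)) < δ := by
    have h1 : Tendsto (fun N : ℕ => ENNReal.ofReal (T / (N + 1))) atTop (𝓝 0) := by
      have := (tendsto_const_div_atTop_nhds_zero_nat T).comp (tendsto_add_atTop_nat 1)
      have h2 := (ENNReal.continuous_ofReal.tendsto 0).comp this
      rw [ENNReal.ofReal_zero] at h2
      refine h2.congr fun N => ?_
      simp
    exact (h1.eventually (gt_mem_nhds hδ)).exists
  set h : ℝ := T / (N + 1) with hh
  have hh0 : 0 < h := by positivity
  have key : ∀ n : ℕ, n ≤ N + 1 → ∫⁻ τ in Icc 0 (n * h), f τ = 0 := by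
    intro n
    induction n with
    | zero => intro _; simp
    | succ n ih =>
      intro hn
      have hle1 : ((n + 1 : ℕ) : ℝ) * h ≤ T := by
        have : ((n + 1 : ℕ) : ℝ) ≤ N + 1 := by exact_mod_cast hn
        calc ((n + 1 : ℕ) : ℝ) * h ≤ (N + 1) * h := by gcongr
          _ = T := by rw [hh]; field_simp
      set t₀ : ℝ := n * h
      set t₁ : ℝ := ((n + 1 : ℕ) : ℝ) * h
      have ht₀ : 0 ≤ t₀ := by positivity
      have ht : t₀ ≤ t₁ := by simp only [t₀, t₁]; gcongr; omega
      set I := ∫⁻ τ in Icc 0 t₁, f τ with hI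
      have hIfin : I ≠ ∞ := ne_top_of_le_ne_top hf (lintegral_mono_set (Icc_subset_Icc_right hle1))
      have hunion : Icc 0 t₁ = Icc 0 t₀ ∪ Ioc t₀ t₁ := (Icc_union_Ioc_eq_Icc ht₀ ht).symm
      have hI1 : I ≤ ∫⁻ τ in Ioc t₀ t₁, f τ := by
        rw [hI, hunion]
        refine (lintegral_union_le _ _ _).trans ?_
        rw [ih (by omega), zero_add]
      have hsub : Ioc t₀ t₁ ⊆ Icc 0 T := fun τ hτ => ⟨ht₀.trans hτ.1.le, hτ.2.trans hle1⟩
      have hI2 : ∫⁻ τ in Ioc t₀ t₁, f τ ≤ ∫⁻ τ in Ioc t₀ t₁, m τ * I := by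
        refine lintegral_mono_ae ?_
        have hle' := ae_restrict_of_ae_restrict_of_subset hsub hle
        filter_upwards [hle', ae_restrict_mem measurableSet_Ioc] with τ h1 h2
        refine h1.trans ?_
        gcongr
        exact lintegral_mono_set (Icc_subset_Icc_right h2.2)
      have hm1 : ∫⁻ τ in Ioc t₀ t₁, m τ < 1 := by
        have h1 : volume.restrict (Icc 0 T) (Ioc t₀ t₁) < δ := by
          rw [Measure.restrict_apply measurableSet_Ioc, inter_eq_self_of_subset_left hsub,
            Real.volume_Ioc]
          refine lt_of_eq_of_lt ?_ hN
          congr 1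
          simp only [t₀, t₁]
          push_cast
          ring
        have h2 := hsmall _ h1
        rwa [Measure.restrict_restrict measurableSet_Ioc, inter_eq_self_of_subset_left hsub] at h2
      rw [lintegral_mul_const' _ _ hIfin] at hI2
      by_contra hne
      have h3 : (∫⁻ τ in Ioc t₀ t₁, m τ) * I < 1 * I :=
        ENNReal.mul_lt_mul_left hne hIfin hm1
      rw [one_mul] at h3
      exact absurd (hI1.trans hI2) h3.not_ge
  have := key (N + 1) le_rfl
  rwa [show ((N + 1 : ℕ) : ℝ) * h = T by rw [hh]; push_cast; field_simp] at this

/-! ### The nonlinearity on `H^s` -/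

/-- The essential supremum of `|u|`, for `u ∈ H^s` with `s ≥ 0`. -/
def Hs.supNorm {s : ℝ} (hs : 0 ≤ s) (u : Hs d s) : ℝ≥0∞ := eLpNorm (Hs.toL2 hs u) ∞ volume

theorem Hs.supNorm_zero {s : ℝ} (hs : 0 ≤ s) : Hs.supNorm (d := d) hs 0 = 0 := by
  rw [supNorm, map_zero, eLpNorm_congr_ae (Lp.coeFn_zero ℂ 2 volume)]
  exact eLpNorm_zero

theorem Hs.enorm_toL2_le {s : ℝ} (hs : 0 ≤ s) (u : Hs d s) : ‖Hs.toL2 hs u‖ₑ ≤ ‖u‖ₑ := by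
  rw [← ofReal_norm, ← ofReal_norm]
  exact ENNReal.ofReal_le_ofReal (Hs.norm_toL2_le hs u)

open Classical in
/-- `|u|^b u` as an element of `H^s`; the value is `0` where this function is not in `H^s`. -/
def Hs.powNonlin {s : ℝ} (hs : 0 ≤ s) (b : ℝ) (u : Hs d s) : Hs d s :=
  if h : ∃ G : Hs d s, Hs.toL2 hs G =ᵐ[volume] fun x => _root_.powNonlin b (Hs.toL2 hs u x) then
    h.choose else 0

theorem powNonlin_apply_zero (b : ℝ) : powNonlin b 0 = 0 := by simp [powNonlin]

/-- A map of `H^s` into itself that is controlled, with differences, like `|u|^b u`: on bounded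
functions it is Lipschitz in `L²`, and in `H^s` up to a Hölder term in the uniform norm. -/
structure IsTame {s : ℝ} (hs : 0 ≤ s) (b θ : ℝ) (C : ℝ≥0∞) (F : Hs d s → Hs d s) : Prop where
  map_zero : F 0 = 0
  enorm_sub_le : ∀ (u v : Hs d s) (M : ℝ≥0∞), M ≠ ∞ → Hs.supNorm hs u ≤ M → Hs.supNorm hs v ≤ M →
    ‖F u - F v‖ₑ ≤ C * (M ^ b * ‖u - v‖ₑ +
      Hs.supNorm hs (u - v) ^ θ * M ^ (b - θ) * (‖u‖ₑ + ‖v‖ₑ))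
  enorm_toL2_sub_le : ∀ (u v : Hs d s) (M : ℝ≥0∞), M ≠ ∞ → Hs.supNorm hs u ≤ M →
    Hs.supNorm hs v ≤ M →
    ‖Hs.toL2 hs (F u - F v)‖ₑ ≤ C * (M ^ b * ‖Hs.toL2 hs (u - v)‖ₑ)
  aestronglyMeasurable : ∀ {ν : Measure ℝ} {w : ℝ → Hs d s}, AEStronglyMeasurable w ν →
    (∀ᵐ t ∂ν, Hs.supNorm hs (w t) ≠ ∞) → AEStronglyMeasurable (fun t => F (w t)) ν

theorem ae_norm_le_of_eLpNorm_top_le {f : L2 d} {M : ℝ≥0∞} (hM : M ≠ ∞)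
    (hf : eLpNorm f ∞ volume ≤ M) : ∀ᵐ x, ‖f x‖ ≤ M.toReal := by
  filter_upwards [enorm_ae_le_eLpNormEssSup f volume] with x hx
  rw [← eLpNorm_exponent_top] at hx
  simpa using ENNReal.toReal_mono hM (hx.trans hf)

theorem memLp_powNonlin {b : ℝ} (hb : 0 < b) {f : L2 d} (hf : eLpNorm f ∞ volume ≠ ∞) :
    MemLp (fun x => powNonlin b (f x)) 2 volume := by
  refine (Lp.memLp f).of_le_mul (c := (eLpNorm f ∞ volume).toReal ^ b)
    ((continuous_powNonlin hb).comp_aestronglyMeasurable (Lp.aestronglyMeasurable f)) ?_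
  filter_upwards [ae_norm_le_of_eLpNorm_top_le hf le_rfl] with x hx
  rw [norm_powNonlin]
  gcongr

section nonlinearity

variable {s : ℝ} {hs : 0 ≤ s} {b θ : ℝ} {C : ℝ≥0∞}

/-- The conclusion of `exists_sobolevNorm_powNonlin_sub_le`. -/
def SobolevDifferenceEstimate (d : ℕ) (s b θ : ℝ) (C : ℝ≥0∞) : Prop :=
  ∀ (u v G : L2 d) (M : ℝ≥0∞), M ≠ ∞ → eLpNorm u ∞ volume ≤ M → eLpNorm v ∞ volume ≤ M →
    G =ᵐ[volume] (fun x => powNonlin b (u x) - powNonlin b (v x)) →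
    sobolevNorm s G ≤ C * (M ^ b * sobolevNorm s (u - v) +
      eLpNorm (u - v : L2 d) ∞ volume ^ θ * M ^ (b - θ) * (sobolevNorm s u + sobolevNorm s v))

/-- The difference estimate with v = 0 shows that |u|^b u lies in H^s for bounded u, so the default
value 0 of `Hs.powNonlin` does not interfere. -/
theorem SobolevDifferenceEstimate.toL2_powNonlin (h : SobolevDifferenceEstimate d s b θ C)
    (hC : C ≠ ∞) (hb : 0 < b) (hθ : 0 ≤ θ) (hθb : θ ≤ b) {u : Hs d s} (hu : Hs.supNorm hs u ≠ ∞) :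
    Hs.toL2 hs (Hs.powNonlin hs b u) =ᵐ[volume] fun x => powNonlin b (Hs.toL2 hs u x) := by
  have hex : ∃ G : Hs d s, Hs.toL2 hs G =ᵐ[volume] fun x => powNonlin b (Hs.toL2 hs u x) := by
    have hm := memLp_powNonlin hb hu
    have hfin : sobolevNorm s hm.toLp ≠ ∞ := by
      have h1 := h (Hs.toL2 hs u) 0 hm.toLp (Hs.supNorm hs u) hu le_rfl
        (by rw [eLpNorm_congr_ae (Lp.coeFn_zero ℂ 2 volume)]; simp) (by
          filter_upwards [hm.coeFn_toLp, Lp.coeFn_zero ℂ 2 (volume : Measure (Rd d))] with x h1 h2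
          rw [h1, h2]
          simp [powNonlin_apply_zero])
      refine ne_top_of_le_ne_top ?_ h1
      rw [sub_zero, sobolevNorm_zero_right, Hs.sobolevNorm_toL2, add_zero]
      have e1 : Hs.supNorm hs u ^ b ≠ ∞ := ENNReal.rpow_ne_top_of_nonneg hb.le hu
      have e2 : eLpNorm (Hs.toL2 hs u) ∞ volume ^ θ ≠ ∞ := ENNReal.rpow_ne_top_of_nonneg hθ hu
      have e3 : Hs.supNorm hs u ^ (b - θ) ≠ ∞ := ENNReal.rpow_ne_top_of_nonneg (by linarith) hu
      finiteness
    obtain ⟨G, hG⟩ := Hs.exists_toL2_eq hs hfin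
    exact ⟨G, by rw [hG]; exact hm.coeFn_toLp⟩
  rw [Hs.powNonlin, dif_pos hex]
  exact hex.choose_spec

/-- A cut-off of `|z|^b z` at `|z| ∼ m`. -/
def truncPowNonlin (b : ℝ) (m : ℕ) (z : ℂ) : ℂ :=
  (⟨m + 1, m + 2, by positivity, by linarith⟩ : ContDiffBump (0 : ℂ)) z • powNonlin b z

theorem exists_lipschitzWith_truncPowNonlin (hb : 0 < b) (m : ℕ) :
    ∃ K, LipschitzWith K (truncPowNonlin b m) := by
  refine ContDiff.lipschitzWith_of_hasCompactSupport (𝕂 := ℝ) (n := 1) ?_ ?_ one_ne_zero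
  · exact (ContDiffBump.hasCompactSupport _).smul_right
  · exact (ContDiffBump.contDiff _).smul (contDiff_powNonlin hb)

theorem truncPowNonlin_eq {m : ℕ} {z : ℂ} (hz : ‖z‖ ≤ m + 1) :
    truncPowNonlin b m z = powNonlin b z := by
  rw [truncPowNonlin, ContDiffBump.one_of_mem_closedBall, one_smul]
  simpa using hz

/-- The power itself need not act continuously on L², but its truncations are Lipschitz and do. For
almost every t the function w(t) is bounded, so the truncations are eventually exact, and
measurability passes to the limit in L². -/
theorem SobolevDifferenceEstimate.aestronglyMeasurable_powNonlin
    (h : SobolevDifferenceEstimate d s b θ C)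
    (hC : C ≠ ∞) (hb : 0 < b) (hθ : 0 ≤ θ) (hθb : θ ≤ b) {ν : Measure ℝ} {w : ℝ → Hs d s}
    (hw : AEStronglyMeasurable w ν) (hsup : ∀ᵐ t ∂ν, Hs.supNorm hs (w t) ≠ ∞) :
    AEStronglyMeasurable (fun t => Hs.powNonlin hs b (w t)) ν := by
  refine Hs.aestronglyMeasurable_of_toL2 hs ?_
  choose K hK using fun m => exists_lipschitzWith_truncPowNonlin (b := b) hb m
  have h0 : ∀ m, truncPowNonlin b m 0 = 0 := fun m => by
    rw [truncPowNonlin, powNonlin_apply_zero, smul_zero]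
  refine aestronglyMeasurable_of_tendsto_ae (ι := ℕ) atTop
    (f := fun m t => (hK m).compLp (h0 m) (Hs.toL2 hs (w t))) (fun m => ?_) ?_
  · exact (((hK m).continuous_compLp (h0 m)).comp
      (Hs.toL2 hs).continuous).comp_aestronglyMeasurable hw
  · filter_upwards [hsup] with t ht
    refine tendsto_const_nhds.congr' ?_
    obtain ⟨m₀, hm₀⟩ := exists_nat_ge (Hs.supNorm hs (w t)).toReal
    filter_upwards [eventually_ge_atTop m₀] with m hm
    refine Lp.ext ?_
    filter_upwards [h.toL2_powNonlin hC hb hθ hθb ht, (hK m).coeFn_compLp (h0 m) (Hs.toL2 hs (w t)),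
      ae_norm_le_of_eLpNorm_top_le ht le_rfl] with x h1 h2 h3
    rw [h1, h2, Function.comp_apply, truncPowNonlin_eq]
    have : (m₀ : ℝ) ≤ m := by exact_mod_cast hm
    linarith

end nonlinearity

/-- The nonlinearity `u ↦ c |u|^b u` is tame. -/
theorem exists_isTame_powNonlin (d : ℕ) {b s : ℝ} (hb : 0 < b) (hs : 0 ≤ s)
    (h : (∃ n : ℕ, b = 2 * n) ∨ ∃ r : ℕ, s ≤ r ∧ r < b + 1) (c : ℂ) :
    ∃ θ, 0 < θ ∧ θ ≤ 1 ∧ θ ≤ b ∧ ∃ C : ℝ≥0∞, C ≠ ∞ ∧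
      IsTame (d := d) hs b θ C (fun u => c • Hs.powNonlin hs b u) ∧
      ∀ u : Hs d s, Hs.supNorm hs u ≠ ∞ →
        Hs.toL2 hs (Hs.powNonlin hs b u) =ᵐ[volume] fun x => powNonlin b (Hs.toL2 hs u x) := by
  obtain ⟨θ, hθ, hθ1, hθb, C₁, hC₁, hest⟩ := exists_sobolevNorm_powNonlin_sub_le d hb hs h
  obtain ⟨C₂, hC₂, hlip⟩ := exists_norm_powNonlin_sub_le hb
  have hest' : SobolevDifferenceEstimate d s b θ C₁ := hest
  have htoL2 : ∀ u : Hs d s, Hs.supNorm hs u ≠ ∞ →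
      Hs.toL2 hs (Hs.powNonlin hs b u) =ᵐ[volume] fun x => powNonlin b (Hs.toL2 hs u x) :=
    fun u hu => hest'.toL2_powNonlin hC₁ hb hθ.le hθb hu
  have hdiff : ∀ u v : Hs d s, Hs.supNorm hs u ≠ ∞ → Hs.supNorm hs v ≠ ∞ →
      Hs.toL2 hs (Hs.powNonlin hs b u - Hs.powNonlin hs b v) =ᵐ[volume]
        fun x => powNonlin b (Hs.toL2 hs u x) - powNonlin b (Hs.toL2 hs v x) := by
    intro u v hu hv
    rw [map_sub]
    filter_upwards [htoL2 u hu, htoL2 v hv, Lp.coeFn_sub (Hs.toL2 hs (Hs.powNonlin hs b u))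
      (Hs.toL2 hs (Hs.powNonlin hs b v))] with x h1 h2 h3
    rw [h3, Pi.sub_apply, h1, h2]
  refine ⟨θ, hθ, hθ1, hθb, ‖c‖ₑ * max C₁ (ENNReal.ofReal C₂), by finiteness, ⟨?_, ?_, ?_, ?_⟩, htoL2⟩
  · have h0 : Hs.toL2 hs (Hs.powNonlin (d := d) hs b 0) = 0 := by
      refine Lp.ext ?_
      filter_upwards [htoL2 0 (by simp [Hs.supNorm_zero]),
        Lp.coeFn_zero ℂ 2 (volume : Measure (Rd d))] with x h1 h2
      rw [h1, map_zero, h2]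
      exact powNonlin_apply_zero b
    rw [(map_eq_zero_iff _ (Hs.toL2_injective hs)).1 h0, smul_zero]
  · intro u v M hM hu hv
    rw [← smul_sub, enorm_smul, mul_assoc]
    refine mul_le_mul_right ?_ _
    have h1 := hest _ _ _ M hM hu hv
      (hdiff u v (ne_top_of_le_ne_top hM hu) (ne_top_of_le_ne_top hM hv))
    rw [← map_sub, Hs.sobolevNorm_toL2, Hs.sobolevNorm_toL2, Hs.sobolevNorm_toL2,
      Hs.sobolevNorm_toL2] at h1
    exact h1.trans (mul_le_mul_left (le_max_left _ _) _)
  · intro u v M hM hu hv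
    rw [← smul_sub, _root_.map_smul, enorm_smul, mul_assoc]
    refine mul_le_mul_right ?_ _
    refine le_trans ?_ (mul_le_mul_left (le_max_right C₁ (ENNReal.ofReal C₂)) _)
    have hbd : ‖Hs.toL2 hs (Hs.powNonlin hs b u - Hs.powNonlin hs b v)‖ ≤
        C₂ * M.toReal ^ b * ‖Hs.toL2 hs (u - v)‖ := by
      refine Lp.norm_le_mul_norm_of_ae_le_mul ?_
      rw [map_sub _ u v]
      filter_upwards [hdiff u v (ne_top_of_le_ne_top hM hu) (ne_top_of_le_ne_top hM hv),
        ae_norm_le_of_eLpNorm_top_le hM hu, ae_norm_le_of_eLpNorm_top_le hM hv,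
        Lp.coeFn_sub (Hs.toL2 hs u) (Hs.toL2 hs v)] with x h1 h2 h3 h4
      rw [h1, h4]
      exact hlip _ _ _ h2 h3
    rw [← ofReal_norm, ← ofReal_norm]
    refine (ENNReal.ofReal_le_ofReal hbd).trans (le_of_eq ?_)
    rw [ENNReal.ofReal_mul (by positivity), ENNReal.ofReal_mul hC₂, mul_assoc,
      ← ENNReal.ofReal_rpow_of_nonneg (by positivity) hb.le, ENNReal.ofReal_toReal hM]
  · intro ν w hw hsup
    exact (hest'.aestronglyMeasurable_powNonlin hC₁ hb hθ.le hθb hw hsup).const_smul c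

/-! ### Estimates for the nonlinear term -/

/-- Forcing terms in `L¹([0,T]; H^s)`. -/
abbrev Forcing (d : ℕ) (s T : ℝ) : Type := Lp (Hs d s) 1 (volume.restrict (Icc (0 : ℝ) T))

namespace Forcing

variable {s T : ℝ} (hs : 0 ≤ s)

/-- The norm in `L¹([0,T]; L²)`. -/
def weak (H : Forcing d s T) : ℝ≥0∞ := ∫⁻ τ in Icc 0 T, ‖Hs.toL2 hs (H τ)‖ₑ

theorem enorm_eq (H : Forcing d s T) : ‖H‖ₑ = ∫⁻ τ in Icc 0 T, ‖H τ‖ₑ := by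
  rw [Lp.enorm_def, eLpNorm_one_eq_lintegral_enorm]

theorem weak_le (H : Forcing d s T) : weak hs H ≤ ‖H‖ₑ := by
  rw [enorm_eq]
  exact lintegral_mono fun τ => Hs.enorm_toL2_le hs _

theorem integrableOn (H : Forcing d s T) : IntegrableOn H (Icc 0 T) := L1.integrable_coeFn H

end Forcing

theorem evolution_forcing_sub {P : Rd d → ℝ} (hP : Measurable P) {s T : ℝ} (u₀ v₀ : Hs d s)
    (H H' : Forcing d s T) {t : ℝ} (ht : t ∈ Icc 0 T) :
    evolution hP (u₀ - v₀) (H - H' : Forcing d s T) t =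
      evolution hP u₀ H t - evolution hP v₀ H' t := by
  rw [← evolution_sub hP u₀ v₀ H.integrableOn H'.integrableOn ht]
  exact evolution_congr hP _ (Lp.coeFn_sub H H') ht

theorem evolution_forcing_zero {P : Rd d → ℝ} (hP : Measurable P) {s T t : ℝ} (ht : t ∈ Icc 0 T) :
    evolution hP 0 (0 : Forcing d s T) t = 0 := by
  have := evolution_forcing_sub hP (0 : Hs d s) 0 (0 : Forcing d s T) 0 ht
  rwa [sub_self, sub_self, sub_self] at this

/-- Hölder's inequality in time on an interval of length `T`. -/
theorem lintegral_rpow_mul_rpow_le {A B : ℝ → ℝ≥0∞} {α β : ℝ≥0∞} {p θ b T : ℝ}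
    (hA : AEMeasurable A (volume.restrict (Icc 0 T))) (hB : AEMeasurable B (volume.restrict (Icc 0 T)))
    (hp : 0 < p) (hθ : 0 ≤ θ) (hθb : θ ≤ b) (hbp : b ≤ p)
    (hAα : ∫⁻ t in Icc 0 T, A t ^ p ≤ α ^ p) (hBβ : ∫⁻ t in Icc 0 T, B t ^ p ≤ β ^ p) :
    ∫⁻ t in Icc 0 T, A t ^ θ * B t ^ (b - θ) ≤
      ENNReal.ofReal T ^ (1 - b / p) * (α ^ θ * β ^ (b - θ)) := by
  -- The third factor is the constant 1 with the remaining weight 1 - b/p. It produces the power of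
  -- T, positive when b < p, that makes the map contract.
  have h := lintegral_mul_three_le (μ := volume.restrict (Icc 0 T)) (hA.pow_const p) (hB.pow_const p)
    (aemeasurable_const (b := (1 : ℝ≥0∞))) (w₁ := θ / p) (w₂ := (b - θ) / p) (w₃ := 1 - b / p)
    (by positivity) (div_nonneg (by linarith) hp.le) (by rw [sub_nonneg, div_le_one hp]; exact hbp)
    (by field_simp; ring)
  have e : ∀ (x : ℝ≥0∞) (r : ℝ), (x ^ p) ^ (r / p) = x ^ r := fun x r => by
    rw [← ENNReal.rpow_mul, mul_div_cancel₀ _ hp.ne']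
  simp only [e, ENNReal.one_rpow, mul_one, lintegral_one, Measure.restrict_apply_univ,
    Real.volume_Icc, sub_zero] at h
  refine h.trans ?_
  rw [mul_comm]
  refine mul_le_mul_right ?_ _
  rw [← e α, ← e β]
  have h1 : 0 ≤ θ / p := by positivity
  have h2 : 0 ≤ (b - θ) / p := div_nonneg (by linarith) hp.le
  gcongr

/-- The hypotheses under which the equation with nonlinearity `F` is solved: `F` is tame of
order `b`, and `S(-t)` maps `H^{μs}` into `L^p([0,T₀]; L^∞)` with `b < p`. -/
structure IsSubcritical {P : Rd d → ℝ} (hP : Measurable P) {s : ℝ} (hs : 0 ≤ s) (b θ μ p T₀ : ℝ)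
    (C C' : ℝ≥0∞) (F : Hs d s → Hs d s) : Prop where
  tame : IsTame hs b θ C F
  smoothing : ∀ f : L2 d, sobolevNorm (μ * s) f ≠ ∞ →
    ∫⁻ t in Icc 0 T₀, eLpNorm (propagatorL2 hP (-t) f) ∞ volume ^ p ≤
      (C' * sobolevNorm (μ * s) f) ^ p
  ne_top : C ≠ ∞
  ne_top' : C' ≠ ∞
  b_pos : 0 < b
  θ_pos : 0 < θ
  θ_le : θ ≤ b
  b_lt : b < p
  one_le : 1 ≤ p
  μ_nonneg : 0 ≤ μ
  μ_lt : μ < 1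

namespace IsSubcritical

variable {P : Rd d → ℝ} {hP : Measurable P} {s : ℝ} {hs : 0 ≤ s} {b θ μ p T₀ T : ℝ}
  {C C' : ℝ≥0∞} {F : Hs d s → Hs d s}

theorem lintegral_supNorm_le (h : IsSubcritical hP hs b θ μ p T₀ C C' F) (hT : T ≤ T₀) (u₀ : Hs d s)
    (H : Forcing d s T) :
    ∫⁻ t in Icc 0 T, Hs.supNorm hs (evolution hP u₀ H t) ^ p ≤ (C' * (‖u₀‖ₑ + ‖H‖ₑ)) ^ p := by
  have hle : ∀ u : Hs d s, sobolevNorm (μ * s) (Hs.toL2 hs u) ≤ ‖u‖ₑ := fun u =>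
    (sobolevNorm_mono (mul_le_of_le_one_left hs h.μ_lt.le) _).trans_eq (Hs.sobolevNorm_toL2 hs u)
  have hp0 : 0 ≤ p := by linarith [h.one_le]
  refine (lintegral_eLpNorm_evolution_le hP hs h.ne_top' h.one_le h.smoothing hT
    (mul_le_of_le_one_left hs h.μ_lt.le) u₀ (Lp.stronglyMeasurable H) H.integrableOn
    (h := fun τ => ‖H τ‖ₑ) (Lp.stronglyMeasurable H).enorm (fun τ => hle _)
    (by rw [← H.enorm_eq]; simp)).trans ?_
  rw [← H.enorm_eq]
  have := hle u₀
  gcongr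

/-- Smoothing needs only H^{μs} with μ < 1. Interpolating the forcing between L² and H^s leaves a
positive power of the weak norm, which later controls the Hölder term by the weak contraction. -/
theorem lintegral_supNorm_le_weak (h : IsSubcritical hP hs b θ μ p T₀ C C' F) (hT : T ≤ T₀)
    (u₀ : Hs d s) (H : Forcing d s T) :
    ∫⁻ t in Icc 0 T, Hs.supNorm hs (evolution hP u₀ H t) ^ p ≤
      (C' * (‖u₀‖ₑ + H.weak hs ^ (1 - μ) * ‖H‖ₑ ^ μ)) ^ p := by
  have hle : ∀ u : Hs d s, sobolevNorm (μ * s) (Hs.toL2 hs u) ≤ ‖u‖ₑ := fun u =>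
    (sobolevNorm_mono (mul_le_of_le_one_left hs h.μ_lt.le) _).trans_eq (Hs.sobolevNorm_toL2 hs u)
  have hp0 : 0 ≤ p := by linarith [h.one_le]
  have hμ1 : 0 ≤ 1 - μ := by linarith [h.μ_lt]
  have hm1 : Measurable fun τ => ‖Hs.toL2 hs (H τ)‖ₑ :=
    ((Hs.toL2 hs).continuous.comp_stronglyMeasurable (Lp.stronglyMeasurable H)).enorm
  have hm2 : Measurable fun τ => ‖H τ‖ₑ := (Lp.stronglyMeasurable H).enorm
  have h_integral : ∫⁻ τ in Icc 0 T, ‖Hs.toL2 hs (H τ)‖ₑ ^ (1 - μ) * ‖H τ‖ₑ ^ μ ≤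
      H.weak hs ^ (1 - μ) * ‖H‖ₑ ^ μ := by
    rw [H.enorm_eq]
    exact ENNReal.lintegral_mul_norm_pow_le hm1.aemeasurable hm2.aemeasurable hμ1 h.μ_nonneg
      (by ring)
  have hfin : H.weak hs ^ (1 - μ) * ‖H‖ₑ ^ μ ≠ ∞ :=
    ENNReal.mul_ne_top (ENNReal.rpow_ne_top_of_nonneg hμ1
      (ne_top_of_le_ne_top (by simp) (H.weak_le hs))) (ENNReal.rpow_ne_top_of_nonneg h.μ_nonneg
      (by simp))
  refine (lintegral_eLpNorm_evolution_le hP hs h.ne_top' h.one_le h.smoothing hT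
    (mul_le_of_le_one_left hs h.μ_lt.le) u₀ (Lp.stronglyMeasurable H) H.integrableOn
    (h := fun τ => ‖Hs.toL2 hs (H τ)‖ₑ ^ (1 - μ) * ‖H τ‖ₑ ^ μ)
    ((hm1.pow_const _).mul (hm2.pow_const _)) (fun τ => ?_)
    (ne_top_of_le_ne_top hfin h_integral)).trans ?_
  · refine (sobolevNorm_mul_le h.μ_nonneg h.μ_lt.le _).trans_eq ?_
    rw [Hs.sobolevNorm_toL2]
  · have := hle u₀
    gcongr

theorem aemeasurable_supNorm (u₀ : Hs d s) (H : Forcing d s T) :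
    AEMeasurable (fun t => Hs.supNorm hs (evolution hP u₀ H t)) (volume.restrict (Icc 0 T)) :=
  aemeasurable_eLpNorm_evolution hP hs u₀ H.integrableOn

theorem ae_supNorm_ne_top (h : IsSubcritical hP hs b θ μ p T₀ C C' F) (hT : T ≤ T₀)
    (u₀ : Hs d s) (H : Forcing d s T) :
    ∀ᵐ t ∂(volume.restrict (Icc 0 T)), Hs.supNorm hs (evolution hP u₀ H t) ≠ ∞ := by
  have hp0 : 0 < p := by linarith [h.one_le]
  have hfin : ∫⁻ t in Icc 0 T, Hs.supNorm hs (evolution hP u₀ H t) ^ p ≠ ∞ :=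
    ne_top_of_le_ne_top (ENNReal.rpow_ne_top_of_nonneg hp0.le
      (ENNReal.mul_ne_top h.ne_top' (by simp))) (h.lintegral_supNorm_le hT u₀ H)
  filter_upwards [ae_lt_top' ((aemeasurable_supNorm u₀ H).pow_const p) hfin] with t ht htop
  rw [htop, ENNReal.top_rpow_of_pos hp0] at ht
  exact absurd ht (lt_irrefl _)

theorem aestronglyMeasurable_nonlinearity (h : IsSubcritical hP hs b θ μ p T₀ C C' F) (hT : T ≤ T₀)
    (u₀ : Hs d s) (H : Forcing d s T) :
    AEStronglyMeasurable (fun t => F (evolution hP u₀ H t)) (volume.restrict (Icc 0 T)) :=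
  h.tame.aestronglyMeasurable
    ((continuousOn_evolution hP u₀ H.integrableOn).aestronglyMeasurable measurableSet_Icc)
    (h.ae_supNorm_ne_top hT u₀ H)

/-- The sum of the uniform norms of two solutions of the linear equation. -/
theorem lintegral_supNorm_add_le (h : IsSubcritical hP hs b θ μ p T₀ C C' F) (hT : T ≤ T₀)
    (u₀ v₀ : Hs d s) (H H' : Forcing d s T) :
    ∫⁻ t in Icc 0 T, (Hs.supNorm hs (evolution hP u₀ H t) +
      Hs.supNorm hs (evolution hP v₀ H' t)) ^ p ≤
        (C' * (‖u₀‖ₑ + ‖H‖ₑ + (‖v₀‖ₑ + ‖H'‖ₑ))) ^ p := by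
  have hp0 : 0 < p := by linarith [h.one_le]
  have hroot : ∀ {x y : ℝ≥0∞}, x ≤ y ^ p → x ^ (1 / p) ≤ y := by
    intro x y hxy
    calc x ^ (1 / p) ≤ (y ^ p) ^ (1 / p) := by gcongr
      _ = y := by rw [← ENNReal.rpow_mul, mul_one_div_cancel hp0.ne', ENNReal.rpow_one]
  have hmink := ENNReal.lintegral_Lp_add_le (aemeasurable_supNorm (hP := hP) (hs := hs) u₀ H)
    (aemeasurable_supNorm (hP := hP) (hs := hs) v₀ H') h.one_le
  have htot := hmink.trans (add_le_add (hroot (h.lintegral_supNorm_le hT u₀ H))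
    (hroot (h.lintegral_supNorm_le hT v₀ H')))
  rw [← mul_add] at htot
  have := ENNReal.rpow_le_rpow htot hp0.le
  rwa [← ENNReal.rpow_mul, one_div_mul_cancel hp0.ne', ENNReal.rpow_one] at this

theorem lintegral_mul_rpow_le (h : IsSubcritical hP hs b θ μ p T₀ C C' F) (hT : T ≤ T₀)
    (u₀ v₀ : Hs d s) (H H' : Forcing d s T) :
    ∫⁻ t in Icc 0 T, (Hs.supNorm hs (evolution hP u₀ H t) +
      Hs.supNorm hs (evolution hP v₀ H' t)) ^ b ≤ ENNReal.ofReal T ^ (1 - b / p) * C' ^ b *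
        (‖u₀‖ₑ + ‖H‖ₑ + (‖v₀‖ₑ + ‖H'‖ₑ)) ^ b := by
  have hM := h.lintegral_supNorm_add_le hT u₀ v₀ H H'
  have hm := (aemeasurable_supNorm (hP := hP) (hs := hs) u₀ H).add
    (aemeasurable_supNorm (hP := hP) (hs := hs) v₀ H')
  have := lintegral_rpow_mul_rpow_le (θ := 0) hm hm (by linarith [h.one_le]) le_rfl h.b_pos.le
    h.b_lt.le hM hM
  simp only [ENNReal.rpow_zero, one_mul, sub_zero, Pi.add_apply] at this
  rwa [ENNReal.mul_rpow_of_nonneg _ _ h.b_pos.le, ← mul_assoc] at this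

/-- The size of the nonlinear term on a time interval of length `T`. -/
def gain (b p T : ℝ) (C C' : ℝ≥0∞) : ℝ≥0∞ := C * (ENNReal.ofReal T ^ (1 - b / p) * C' ^ b)

/-- In L² the nonlinearity is Lipschitz with no Hölder term. This is why the weak norm is the one in
which the map contracts. -/
theorem lintegral_toL2_sub_le (h : IsSubcritical hP hs b θ μ p T₀ C C' F) (hT : T ≤ T₀)
    (u₀ v₀ : Hs d s) (H H' : Forcing d s T) :
    ∫⁻ t in Icc 0 T, ‖Hs.toL2 hs (F (evolution hP u₀ H t) - F (evolution hP v₀ H' t))‖ₑ ≤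
      gain b p T C C' * (‖u₀‖ₑ + ‖H‖ₑ + (‖v₀‖ₑ + ‖H'‖ₑ)) ^ b *
        (‖u₀ - v₀‖ₑ + (H - H').weak hs) := by
  set M : ℝ → ℝ≥0∞ := fun t => Hs.supNorm hs (evolution hP u₀ H t) +
      Hs.supNorm hs (evolution hP v₀ H' t)
  have hbound : ∀ᵐ t ∂(volume.restrict (Icc 0 T)),
      ‖Hs.toL2 hs (F (evolution hP u₀ H t) - F (evolution hP v₀ H' t))‖ₑ ≤
        C * (M t ^ b * (‖u₀ - v₀‖ₑ + (H - H').weak hs)) := by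
    filter_upwards [h.ae_supNorm_ne_top hT u₀ H, h.ae_supNorm_ne_top hT v₀ H',
      ae_restrict_mem measurableSet_Icc] with t h1 h2 ht
    refine (h.tame.enorm_toL2_sub_le _ _ (M t) (ENNReal.add_ne_top.2 ⟨h1, h2⟩)
      le_self_add le_add_self).trans ?_
    refine mul_le_mul_right (mul_le_mul_right ?_ _) _
    rw [← evolution_forcing_sub hP u₀ v₀ H H' ht]
    refine (enorm_toL2_evolution_le hP hs _ (Forcing.integrableOn _) ht).trans ?_
    exact add_le_add (Hs.enorm_toL2_le hs _) (lintegral_mono_set (Icc_subset_Icc_right ht.2))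
  have hfin : ‖u₀ - v₀‖ₑ + (H - H').weak hs ≠ ∞ :=
    ENNReal.add_ne_top.2 ⟨by simp, ne_top_of_le_ne_top (by simp) ((H - H').weak_le hs)⟩
  refine (lintegral_mono_ae hbound).trans ?_
  rw [lintegral_const_mul' _ _ h.ne_top, lintegral_mul_const' _ _ hfin, gain, mul_assoc C,
    mul_assoc C]
  exact mul_le_mul_right (mul_le_mul_left (h.lintegral_mul_rpow_le hT u₀ v₀ H H') _) _

/-- The uniform norm D of the difference enters only with the power θ, so this is not a Lipschitz
bound. Hölder's inequality in time separates D^θ from M^{b-θ}, and D is estimated through the weak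
norm. -/
theorem lintegral_enorm_sub_le (h : IsSubcritical hP hs b θ μ p T₀ C C' F) (hT : T ≤ T₀)
    (u₀ v₀ : Hs d s) (H H' : Forcing d s T) {ρ : ℝ≥0∞}
    (hρ : ρ = ‖u₀‖ₑ + ‖H‖ₑ + (‖v₀‖ₑ + ‖H'‖ₑ)) :
    ∫⁻ t in Icc 0 T, ‖F (evolution hP u₀ H t) - F (evolution hP v₀ H' t)‖ₑ ≤
      gain b p T C C' * (ρ ^ b * (‖u₀ - v₀‖ₑ + ‖H - H'‖ₑ) +
        (‖u₀ - v₀‖ₑ + (H - H').weak hs ^ (1 - μ) * ‖H - H'‖ₑ ^ μ) ^ θ * ρ ^ (b - θ) * ρ) := by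
  have hp0 : 0 < p := by linarith [h.one_le]
  have hρt : ρ ≠ ∞ := by rw [hρ]; finiteness
  set Δ := ‖u₀ - v₀‖ₑ + (H - H').weak hs ^ (1 - μ) * ‖H - H'‖ₑ ^ μ
  set M : ℝ → ℝ≥0∞ := fun t => Hs.supNorm hs (evolution hP u₀ H t) +
      Hs.supNorm hs (evolution hP v₀ H' t) with hMdef
  set D : ℝ → ℝ≥0∞ := fun t => Hs.supNorm hs (evolution hP (u₀ - v₀) (H - H' : Forcing d s T) t)
  have hbound : ∀ᵐ t ∂(volume.restrict (Icc 0 T)),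
      ‖F (evolution hP u₀ H t) - F (evolution hP v₀ H' t)‖ₑ ≤
        C * (M t ^ b * (‖u₀ - v₀‖ₑ + ‖H - H'‖ₑ) + D t ^ θ * M t ^ (b - θ) * ρ) := by
    filter_upwards [h.ae_supNorm_ne_top hT u₀ H, h.ae_supNorm_ne_top hT v₀ H',
      ae_restrict_mem measurableSet_Icc] with t h1 h2 ht
    refine (h.tame.enorm_sub_le _ _ (M t) (ENNReal.add_ne_top.2 ⟨h1, h2⟩)
      le_self_add le_add_self).trans ?_
    have hev : ∀ (w₀ : Hs d s) (K : Forcing d s T),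
        ‖evolution hP w₀ K t‖ₑ ≤ ‖w₀‖ₑ + ‖K‖ₑ := by
      intro w₀ K
      refine (enorm_evolution_le hP w₀ K ht.1).trans ?_
      rw [K.enorm_eq]
      exact add_le_add le_rfl (lintegral_mono_set (Icc_subset_Icc_right ht.2))
    rw [← evolution_forcing_sub hP u₀ v₀ H H' ht]
    refine mul_le_mul_right (add_le_add (mul_le_mul_right (hev _ _) _) (mul_le_mul_right ?_ _)) _
    rw [hρ]
    exact add_le_add (hev _ _) (hev _ _)
  have hMm : AEMeasurable M (volume.restrict (Icc 0 T)) :=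
    (aemeasurable_supNorm (hP := hP) (hs := hs) u₀ H).add
      (aemeasurable_supNorm (hP := hP) (hs := hs) v₀ H')
  have hDm : AEMeasurable D (volume.restrict (Icc 0 T)) := aemeasurable_supNorm _ _
  have hmix := lintegral_rpow_mul_rpow_le hDm hMm hp0 h.θ_pos.le h.θ_le h.b_lt.le
    (h.lintegral_supNorm_le_weak hT (u₀ - v₀) (H - H')) (h.lintegral_supNorm_add_le hT u₀ v₀ H H')
  have hpow : (C' * Δ) ^ θ * (C' * ρ) ^ (b - θ) = C' ^ b * (Δ ^ θ * ρ ^ (b - θ)) := by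
    have h0 : 0 ≤ b - θ := by linarith [h.θ_le]
    rw [ENNReal.mul_rpow_of_nonneg _ _ h.θ_pos.le, ENNReal.mul_rpow_of_nonneg _ _ h0,
      show b = θ + (b - θ) by ring, ENNReal.rpow_add_of_nonneg _ _ h.θ_pos.le (by linarith)]
    rw [add_sub_cancel_left]
    ring
  rw [← hρ, hpow] at hmix
  have hmain := h.lintegral_mul_rpow_le hT u₀ v₀ H H'
  rw [← hρ] at hmain
  refine (lintegral_mono_ae hbound).trans ?_
  rw [lintegral_const_mul' _ _ h.ne_top, gain, mul_assoc C]
  refine mul_le_mul_right ?_ _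
  rw [lintegral_add_left' ((hMm.pow_const b).mul_const _),
    lintegral_mul_const' _ _ (by finiteness), lintegral_mul_const' _ _ hρt]
  refine (add_le_add (mul_le_mul_left hmain _) (mul_le_mul_left hmix _)).trans (le_of_eq ?_)
  ring

/-- The nonlinear term of a solution of the linear equation is integrable in time. -/
theorem lintegral_enorm_le (h : IsSubcritical hP hs b θ μ p T₀ C C' F) (hT : T ≤ T₀)
    (u₀ : Hs d s) (H : Forcing d s T) :
    ∫⁻ t in Icc 0 T, ‖F (evolution hP u₀ H t)‖ₑ ≤
      2 * gain b p T C C' * (‖u₀‖ₑ + ‖H‖ₑ) ^ b * (‖u₀‖ₑ + ‖H‖ₑ) := by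
  set ρ := ‖u₀‖ₑ + ‖H‖ₑ with hρ
  -- Comparison with the zero solution, for which F vanishes.
  have h1 := h.lintegral_enorm_sub_le hT u₀ 0 H 0 (ρ := ρ) (by simp [hρ])
  have h2 : ∫⁻ t in Icc 0 T, ‖F (evolution hP u₀ H t)‖ₑ =
      ∫⁻ t in Icc 0 T, ‖F (evolution hP u₀ H t) - F (evolution hP 0 (0 : Forcing d s T) t)‖ₑ :=
    setLIntegral_congr_fun measurableSet_Icc fun t ht => by
      simp only [evolution_forcing_zero hP ht, h.tame.map_zero, sub_zero]
  rw [h2]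
  refine h1.trans ?_
  simp only [sub_zero]
  have hμ1 : 0 ≤ 1 - μ := by linarith [h.μ_lt]
  have h3 : ‖u₀‖ₑ + H.weak hs ^ (1 - μ) * ‖H‖ₑ ^ μ ≤ ρ := by
    rw [hρ]
    refine add_le_add le_rfl ?_
    calc H.weak hs ^ (1 - μ) * ‖H‖ₑ ^ μ ≤ ‖H‖ₑ ^ (1 - μ) * ‖H‖ₑ ^ μ :=
          mul_le_mul_left (ENNReal.rpow_le_rpow (H.weak_le hs) hμ1) _
      _ = ‖H‖ₑ := by
          rw [← ENNReal.rpow_add_of_nonneg _ _ hμ1 h.μ_nonneg, sub_add_cancel, ENNReal.rpow_one]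
  have h4 : ρ ^ θ * ρ ^ (b - θ) = ρ ^ b := by
    rw [← ENNReal.rpow_add_of_nonneg _ _ h.θ_pos.le (by linarith [h.θ_le]), add_sub_cancel]
  calc _ ≤ gain b p T C C' * (ρ ^ b * ρ + ρ ^ θ * ρ ^ (b - θ) * ρ) :=
        mul_le_mul_right (add_le_add le_rfl (mul_le_mul_left (mul_le_mul_left
          (ENNReal.rpow_le_rpow h3 h.θ_pos.le) _) _)) _
    _ = _ := by rw [h4]; ring

end IsSubcritical

/-! ### The fixed point problem -/

/-- A self-map of a ball that contracts with respect to a weaker size `w`, and contracts in norm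
up to a power of `w`, has a fixed point. -/
theorem exists_fixedPoint_of_weak_contraction {E : Type*} [NormedAddCommGroup E] [CompleteSpace E]
    {f : E → E} {w : E → ℝ} {R K γ : ℝ} (hR : 0 ≤ R) (hK : 0 ≤ K) (hγ : 0 < γ)
    (hw0 : ∀ x, 0 ≤ w x) (hw : ∀ x, w x ≤ ‖x‖) (hmaps : ∀ x, ‖x‖ ≤ R → ‖f x‖ ≤ R)
    (hweak : ∀ x y, ‖x‖ ≤ R → ‖y‖ ≤ R → w (f x - f y) ≤ 1 / 4 * w (x - y))
    (hstrong : ∀ x y, ‖x‖ ≤ R → ‖y‖ ≤ R →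
      ‖f x - f y‖ ≤ 1 / 4 * ‖x - y‖ + K * w (x - y) ^ γ) :
    ∃ x, ‖x‖ ≤ R ∧ f x = x := by
  set x : ℕ → E := fun n => f^[n] 0 with hx
  have hsucc : ∀ n, x (n + 1) = f (x n) := fun n => Function.iterate_succ_apply' f n 0
  have hball : ∀ n, ‖x n‖ ≤ R := by
    intro n
    induction n with
    | zero => simpa [hx] using hR
    | succ n ih => rw [hsucc]; exact hmaps _ ih
  have hwn : ∀ n, w (x (n + 1) - x n) ≤ R * (1 / 4) ^ n := by
    intro n
    induction n with
    | zero =>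
      refine (hw _).trans ?_
      simpa [hx] using hball 1
    | succ n ih =>
      have := hweak _ _ (hball (n + 1)) (hball n)
      rw [← hsucc, ← hsucc] at this
      rw [pow_succ]
      linarith
  -- The rate must dominate (1/4)^γ, the decay of the error term, and 1/2, which leaves room for the
  -- contraction factor 1/4.
  set r : ℝ := max ((1 / 4 : ℝ) ^ γ) (1 / 2)
  have hr0 : 0 < r := lt_max_of_lt_right (by norm_num)
  have hr1 : r < 1 := max_lt (Real.rpow_lt_one (by norm_num) (by norm_num) hγ) (by norm_num)
  have hr2 : 1 / 2 ≤ r := le_max_right _ _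
  have hRγ : 0 ≤ R ^ γ := Real.rpow_nonneg hR _
  -- With this A the error K R^γ r^n is at most A r^n / 4. Together with the contracted part it
  -- gives A r^n / 2 ≤ A r^{n+1}, which closes the induction.
  set A : ℝ := R + 4 * (K * R ^ γ) with hA
  have hA0 : 0 ≤ A := by positivity
  have hwpow : ∀ n, w (x (n + 1) - x n) ^ γ ≤ R ^ γ * r ^ n := by
    intro n
    calc w (x (n + 1) - x n) ^ γ ≤ (R * (1 / 4) ^ n) ^ γ :=
          Real.rpow_le_rpow (hw0 _) (hwn n) hγ.le
      _ = R ^ γ * ((1 / 4 : ℝ) ^ γ) ^ n := by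
          rw [Real.mul_rpow hR (by positivity), ← Real.rpow_natCast, ← Real.rpow_mul (by norm_num),
            mul_comm (n : ℝ), Real.rpow_mul (by norm_num), Real.rpow_natCast]
      _ ≤ R ^ γ * r ^ n := by
          gcongr
          exact le_max_left _ _
  have hzn : ∀ n, ‖x (n + 1) - x n‖ ≤ A * r ^ n := by
    intro n
    induction n with
    | zero =>
      have h1 := hball 1
      have h2 : (0 : ℝ) ≤ K * R ^ γ := by positivity
      have h3 : x 0 = 0 := rfl
      rw [h3, sub_zero, pow_zero, mul_one]
      linarith
    | succ n ih =>
      have h1 := hstrong _ _ (hball (n + 1)) (hball n)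
      rw [← hsucc, ← hsucc] at h1
      have h2 : K * w (x (n + 1) - x n) ^ γ ≤ K * (R ^ γ * r ^ n) := by
        gcongr
        exact hwpow n
      have h3 : 0 ≤ r ^ n := by positivity
      have h4 : A * r ^ n * (1 / 2) ≤ A * r ^ n * r := by gcongr
      rw [pow_succ]
      have h5 : 4 * (K * (R ^ γ * r ^ n)) ≤ A * r ^ n := by
        rw [hA]
        nlinarith [mul_nonneg hR h3]
      linarith
  obtain ⟨y, hy⟩ := cauchySeq_tendsto_of_complete (cauchySeq_of_le_geometric r A hr1
    (f := x) fun n => by rw [dist_eq_norm, norm_sub_rev]; exact hzn n)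
  have hyR : ‖y‖ ≤ R := le_of_tendsto hy.norm (Eventually.of_forall hball)
  refine ⟨y, hyR, ?_⟩
  have h0 : Tendsto (fun n => ‖x n - y‖) atTop (𝓝 0) := by
    simpa using (hy.sub_const y).norm
  have h1 : Tendsto (fun n => 1 / 4 * ‖x n - y‖ + K * ‖x n - y‖ ^ γ) atTop (𝓝 0) := by
    have := (h0.const_mul (1 / 4)).add ((h0.rpow_const (Or.inr hγ.le)).const_mul K)
    simpa [Real.zero_rpow hγ.ne'] using this
  -- As w is bounded by the norm, the strong estimate also yields continuity of f at the limit.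
  have h2 : Tendsto (fun n => f (x n)) atTop (𝓝 (f y)) := by
    rw [tendsto_iff_norm_sub_tendsto_zero]
    refine squeeze_zero (fun n => norm_nonneg _) (fun n => ?_) h1
    refine (hstrong _ _ (hball n) hyR).trans ?_
    gcongr
    · exact hw0 _
    · exact hw _
  have h3 : Tendsto (fun n => f (x n)) atTop (𝓝 y) := by
    exact (hy.comp (tendsto_add_atTop_nat 1)).congr hsucc
  exact tendsto_nhds_unique h2 h3

open Classical in
/-- The map whose fixed points are the nonlinear terms of the solutions. -/
def nextForcing {P : Rd d → ℝ} (hP : Measurable P) {s T : ℝ} (F : Hs d s → Hs d s) (u₀ : Hs d s)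
    (H : Forcing d s T) : Forcing d s T :=
  if h : MemLp (fun t => F (evolution hP u₀ H t)) 1 (volume.restrict (Icc 0 T)) then h.toLp else 0

namespace IsSubcritical

variable {P : Rd d → ℝ} {hP : Measurable P} {s : ℝ} {hs : 0 ≤ s} {b θ μ p T₀ T : ℝ}
  {C C' : ℝ≥0∞} {F : Hs d s → Hs d s}

theorem gain_ne_top (h : IsSubcritical hP hs b θ μ p T₀ C C' F) : gain b p T C C' ≠ ∞ := by
  have hp0 : 0 < p := by linarith [h.one_le]
  have h1 : 0 ≤ 1 - b / p := by rw [sub_nonneg, div_le_one hp0]; exact h.b_lt.le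
  exact ENNReal.mul_ne_top h.ne_top (ENNReal.mul_ne_top
    (ENNReal.rpow_ne_top_of_nonneg h1 (by simp)) (ENNReal.rpow_ne_top_of_nonneg h.b_pos.le h.ne_top'))

theorem memLp (h : IsSubcritical hP hs b θ μ p T₀ C C' F) (hT : T ≤ T₀) (u₀ : Hs d s)
    (H : Forcing d s T) :
    MemLp (fun t => F (evolution hP u₀ H t)) 1 (volume.restrict (Icc 0 T)) := by
  refine ⟨h.aestronglyMeasurable_nonlinearity hT u₀ H, ?_⟩
  rw [eLpNorm_one_eq_lintegral_enorm]
  refine (h.lintegral_enorm_le hT u₀ H).trans_lt (lt_top_iff_ne_top.2 ?_)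
  have h1 := h.gain_ne_top (T := T)
  have h2 : (‖u₀‖ₑ + ‖H‖ₑ) ^ b ≠ ∞ := ENNReal.rpow_ne_top_of_nonneg h.b_pos.le (by finiteness)
  finiteness

theorem coeFn_nextForcing (h : IsSubcritical hP hs b θ μ p T₀ C C' F) (hT : T ≤ T₀) (u₀ : Hs d s)
    (H : Forcing d s T) : nextForcing hP F u₀ H =ᵐ[volume.restrict (Icc 0 T)]
      fun t => F (evolution hP u₀ H t) := by
  rw [nextForcing, dif_pos (h.memLp hT u₀ H)]
  exact MemLp.coeFn_toLp _

theorem nextForcing_sub_ae (h : IsSubcritical hP hs b θ μ p T₀ C C' F) (hT : T ≤ T₀) (u₀ v₀ : Hs d s)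
    (H H' : Forcing d s T) :
    (nextForcing hP F u₀ H - nextForcing hP F v₀ H' : Forcing d s T) =ᵐ[volume.restrict (Icc 0 T)]
      fun t => F (evolution hP u₀ H t) - F (evolution hP v₀ H' t) := by
  filter_upwards [Lp.coeFn_sub (nextForcing hP F u₀ H) (nextForcing hP F v₀ H'),
    h.coeFn_nextForcing hT u₀ H, h.coeFn_nextForcing hT v₀ H'] with t h1 h2 h3
  rw [h1, Pi.sub_apply, h2, h3]

/-! ### Estimates on a ball when the time interval is short -/

section small

variable {R : ℝ}

theorem ofReal_quarter : (1 / 4 : ℝ≥0∞) = ENNReal.ofReal (1 / 4) := by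
  rw [ENNReal.ofReal_div_of_pos (by norm_num)]
  simp

theorem four_mul_bound {u₀ v₀ : Hs d s} {H H' : Forcing d s T} (hu : ‖u₀‖ ≤ R) (hv : ‖v₀‖ ≤ R)
    (hH : ‖H‖ ≤ R) (hH' : ‖H'‖ ≤ R) :
    ‖u₀‖ₑ + ‖H‖ₑ + (‖v₀‖ₑ + ‖H'‖ₑ) ≤ ENNReal.ofReal (4 * R) := by
  have hR : 0 ≤ R := (norm_nonneg _).trans hu
  rw [show 4 * R = R + R + (R + R) by ring, ENNReal.ofReal_add (by positivity) (by positivity),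
    ENNReal.ofReal_add hR hR]
  simp only [← ofReal_norm]
  gcongr

theorem weak_nextForcing_sub_le (h : IsSubcritical hP hs b θ μ p T₀ C C' F) (hT : T ≤ T₀)
    (hsmall : gain b p T C C' * ENNReal.ofReal (4 * R) ^ b ≤ 1 / 4)
    {u₀ v₀ : Hs d s} {H H' : Forcing d s T} (hu : ‖u₀‖ ≤ R) (hv : ‖v₀‖ ≤ R)
    (hH : ‖H‖ ≤ R) (hH' : ‖H'‖ ≤ R) :
    (nextForcing hP F u₀ H - nextForcing hP F v₀ H').weak hs ≤
      1 / 4 * (‖u₀ - v₀‖ₑ + (H - H').weak hs) := by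
  have h1 : (nextForcing hP F u₀ H - nextForcing hP F v₀ H').weak hs =
      ∫⁻ t in Icc 0 T, ‖Hs.toL2 hs (F (evolution hP u₀ H t) - F (evolution hP v₀ H' t))‖ₑ :=
    lintegral_congr_ae ((h.nextForcing_sub_ae hT u₀ v₀ H H').mono fun t ht => by simp only [ht])
  rw [h1]
  refine (h.lintegral_toL2_sub_le hT u₀ v₀ H H').trans (mul_le_mul_left ?_ _)
  refine le_trans (mul_le_mul_right ?_ _) hsmall
  exact ENNReal.rpow_le_rpow (four_mul_bound hu hv hH hH') h.b_pos.le

theorem enorm_nextForcing_sub_le (h : IsSubcritical hP hs b θ μ p T₀ C C' F) (hT : T ≤ T₀)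
    (hR : 1 ≤ R) (hsmall : gain b p T C C' * ENNReal.ofReal (4 * R) ^ b ≤ 1 / 4)
    {u₀ v₀ : Hs d s} {H H' : Forcing d s T} (hu : ‖u₀‖ ≤ R) (hv : ‖v₀‖ ≤ R)
    (hH : ‖H‖ ≤ R) (hH' : ‖H'‖ ≤ R) :
    ‖nextForcing hP F u₀ H - nextForcing hP F v₀ H'‖ₑ ≤
      1 / 4 * (‖u₀ - v₀‖ₑ + ‖H - H'‖ₑ) + ENNReal.ofReal R *
        (‖u₀ - v₀‖ₑ + (H - H').weak hs ^ (1 - μ) * ‖H - H'‖ₑ ^ μ) ^ θ := by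
  have h1 : ‖nextForcing hP F u₀ H - nextForcing hP F v₀ H'‖ₑ =
      ∫⁻ t in Icc 0 T, ‖F (evolution hP u₀ H t) - F (evolution hP v₀ H' t)‖ₑ := by
    rw [Forcing.enorm_eq]
    exact lintegral_congr_ae
      ((h.nextForcing_sub_ae hT u₀ v₀ H H').mono fun t ht => by simp only [ht])
  rw [h1]
  refine (h.lintegral_enorm_sub_le hT u₀ v₀ H H' rfl).trans ?_
  have hρ := four_mul_bound hu hv hH hH'
  set ρ := ‖u₀‖ₑ + ‖H‖ₑ + (‖v₀‖ₑ + ‖H'‖ₑ)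
  set g := gain b p T C C'
  set Δ := ‖u₀ - v₀‖ₑ + (H - H').weak hs ^ (1 - μ) * ‖H - H'‖ₑ ^ μ
  -- Since 4R ≥ 1, the exponent b - θ may be raised to b, and the same smallness condition covers
  -- both terms.
  have h4R : 1 ≤ ENNReal.ofReal (4 * R) := by
    rw [← ENNReal.ofReal_one]
    exact ENNReal.ofReal_le_ofReal (by linarith)
  have hb1 : g * ρ ^ b ≤ 1 / 4 :=
    le_trans (mul_le_mul_right (ENNReal.rpow_le_rpow hρ h.b_pos.le) _) hsmall
  have hb2 : g * ρ ^ (b - θ) ≤ 1 / 4 := by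
    refine le_trans (mul_le_mul_right ?_ _) hsmall
    refine (ENNReal.rpow_le_rpow hρ (by linarith [h.θ_le])).trans ?_
    exact ENNReal.rpow_le_rpow_of_exponent_le h4R (by linarith [h.θ_pos])
  have hb3 : 1 / 4 * ρ ≤ ENNReal.ofReal R := by
    refine (mul_le_mul_right hρ _).trans (le_of_eq ?_)
    rw [ENNReal.ofReal_mul (by norm_num), ← mul_assoc]
    have : (1 / 4 : ℝ≥0∞) * ENNReal.ofReal 4 = 1 := by
      rw [show ENNReal.ofReal 4 = 4 by simp, one_div]
      exact ENNReal.inv_mul_cancel (by norm_num) (by norm_num)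
    rw [this, one_mul]
  calc g * (ρ ^ b * (‖u₀ - v₀‖ₑ + ‖H - H'‖ₑ) + Δ ^ θ * ρ ^ (b - θ) * ρ)
      = g * ρ ^ b * (‖u₀ - v₀‖ₑ + ‖H - H'‖ₑ) + g * ρ ^ (b - θ) * ρ * Δ ^ θ := by ring
    _ ≤ 1 / 4 * (‖u₀ - v₀‖ₑ + ‖H - H'‖ₑ) + 1 / 4 * ρ * Δ ^ θ :=
        add_le_add (mul_le_mul_left hb1 _) (mul_le_mul_left (mul_le_mul_left hb2 _) _)
    _ ≤ _ := add_le_add le_rfl (mul_le_mul_left hb3 _)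

theorem norm_nextForcing_le (h : IsSubcritical hP hs b θ μ p T₀ C C' F) (hT : T ≤ T₀) (hR : 1 ≤ R)
    (hsmall : gain b p T C C' * ENNReal.ofReal (4 * R) ^ b ≤ 1 / 4)
    {u₀ : Hs d s} {H : Forcing d s T} (hu : ‖u₀‖ ≤ R) (hH : ‖H‖ ≤ R) :
    ‖nextForcing hP F u₀ H‖ ≤ R := by
  have h1 : ‖nextForcing hP F u₀ H‖ₑ = ∫⁻ t in Icc 0 T, ‖F (evolution hP u₀ H t)‖ₑ := by
    rw [Forcing.enorm_eq]
    exact lintegral_congr_ae ((h.coeFn_nextForcing hT u₀ H).mono fun t ht => by simp only [ht])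
  have hR0 : 0 ≤ R := by linarith
  have hρ : ‖u₀‖ₑ + ‖H‖ₑ ≤ ENNReal.ofReal (2 * R) := by
    rw [two_mul, ENNReal.ofReal_add hR0 hR0]
    simp only [← ofReal_norm]
    gcongr
  have h2 : ‖nextForcing hP F u₀ H‖ₑ ≤ ENNReal.ofReal R := by
    rw [h1]
    refine (h.lintegral_enorm_le hT u₀ H).trans ?_
    calc 2 * gain b p T C C' * (‖u₀‖ₑ + ‖H‖ₑ) ^ b * (‖u₀‖ₑ + ‖H‖ₑ)
        ≤ 2 * gain b p T C C' * ENNReal.ofReal (4 * R) ^ b * ENNReal.ofReal (2 * R) := by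
          refine mul_le_mul' (mul_le_mul_right (ENNReal.rpow_le_rpow (hρ.trans
            (ENNReal.ofReal_le_ofReal (by linarith))) h.b_pos.le) _) hρ
      _ = 2 * (gain b p T C C' * ENNReal.ofReal (4 * R) ^ b) * ENNReal.ofReal (2 * R) := by ring
      _ ≤ 2 * (1 / 4) * ENNReal.ofReal (2 * R) :=
          mul_le_mul_left (mul_le_mul_right hsmall _) _
      _ = ENNReal.ofReal R := by
          have : (2 * (1 / 4) : ℝ≥0∞) = ENNReal.ofReal (1 / 2) := by
            rw [show (2 : ℝ≥0∞) = ENNReal.ofReal 2 by simp, ofReal_quarter,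
              ← ENNReal.ofReal_mul (by norm_num)]
            norm_num
          rw [this, ← ENNReal.ofReal_mul (by norm_num)]
          congr 1
          ring
  rw [← ofReal_norm] at h2
  exact (ENNReal.ofReal_le_ofReal_iff hR0).1 h2

/-- The norm in `L¹([0,T]; L²)` as a real number. -/
def _root_.Forcing.weakNorm (hs : 0 ≤ s) (H : Forcing d s T) : ℝ := (H.weak hs).toReal

theorem _root_.Forcing.ofReal_weakNorm (hs : 0 ≤ s) (H : Forcing d s T) :
    ENNReal.ofReal (H.weakNorm hs) = H.weak hs :=
  ENNReal.ofReal_toReal (ne_top_of_le_ne_top (by simp) (H.weak_le hs))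

theorem _root_.Forcing.weakNorm_nonneg (hs : 0 ≤ s) (H : Forcing d s T) : 0 ≤ H.weakNorm hs :=
  ENNReal.toReal_nonneg

theorem _root_.Forcing.weakNorm_le (hs : 0 ≤ s) (H : Forcing d s T) : H.weakNorm hs ≤ ‖H‖ := by
  rw [← ENNReal.ofReal_le_ofReal_iff (norm_nonneg _), Forcing.ofReal_weakNorm, ofReal_norm]
  exact H.weak_le hs

theorem weakNorm_nextForcing_sub_le (h : IsSubcritical hP hs b θ μ p T₀ C C' F) (hT : T ≤ T₀)
    (hsmall : gain b p T C C' * ENNReal.ofReal (4 * R) ^ b ≤ 1 / 4)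
    {u₀ v₀ : Hs d s} {H H' : Forcing d s T} (hu : ‖u₀‖ ≤ R) (hv : ‖v₀‖ ≤ R)
    (hH : ‖H‖ ≤ R) (hH' : ‖H'‖ ≤ R) :
    (nextForcing hP F u₀ H - nextForcing hP F v₀ H').weakNorm hs ≤
      1 / 4 * (‖u₀ - v₀‖ + (H - H').weakNorm hs) := by
  have h0 := Forcing.weakNorm_nonneg hs (H - H')
  have h1 := h.weak_nextForcing_sub_le hT hsmall hu hv hH hH'
  rwa [← Forcing.ofReal_weakNorm, ← Forcing.ofReal_weakNorm, ← ofReal_norm,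
    ← ENNReal.ofReal_add (norm_nonneg _) h0, ofReal_quarter, ← ENNReal.ofReal_mul (by norm_num),
    ENNReal.ofReal_le_ofReal_iff (by positivity)] at h1

theorem norm_nextForcing_sub_le (h : IsSubcritical hP hs b θ μ p T₀ C C' F) (hT : T ≤ T₀)
    (hR : 1 ≤ R) (hsmall : gain b p T C C' * ENNReal.ofReal (4 * R) ^ b ≤ 1 / 4)
    {u₀ v₀ : Hs d s} {H H' : Forcing d s T} (hu : ‖u₀‖ ≤ R) (hv : ‖v₀‖ ≤ R)
    (hH : ‖H‖ ≤ R) (hH' : ‖H'‖ ≤ R) :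
    ‖nextForcing hP F u₀ H - nextForcing hP F v₀ H'‖ ≤
      1 / 4 * (‖u₀ - v₀‖ + ‖H - H'‖) + R *
        (‖u₀ - v₀‖ + (H - H').weakNorm hs ^ (1 - μ) * ‖H - H'‖ ^ μ) ^ θ := by
  have h0 := Forcing.weakNorm_nonneg hs (H - H')
  have h1 := h.enorm_nextForcing_sub_le hT hR hsmall hu hv hH hH'
  have hR0 : 0 ≤ R := by linarith
  rw [← Forcing.ofReal_weakNorm, ← ofReal_norm, ← ofReal_norm, ← ofReal_norm,
    ← ENNReal.ofReal_add (norm_nonneg _) (norm_nonneg _), ofReal_quarter,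
    ← ENNReal.ofReal_mul (by norm_num),
    ENNReal.ofReal_rpow_of_nonneg h0 (by linarith [h.μ_lt]),
    ENNReal.ofReal_rpow_of_nonneg (norm_nonneg _) h.μ_nonneg,
    ← ENNReal.ofReal_mul (by positivity),
    ← ENNReal.ofReal_add (norm_nonneg _) (by positivity),
    ENNReal.ofReal_rpow_of_nonneg (by positivity) h.θ_pos.le,
    ← ENNReal.ofReal_mul hR0, ← ENNReal.ofReal_add (by positivity) (by positivity),
    ENNReal.ofReal_le_ofReal_iff (by positivity)] at h1
  exact h1

theorem norm_forcing_sub_le {H H' : Forcing d s T} (hH : ‖H‖ ≤ R) (hH' : ‖H'‖ ≤ R) :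
    ‖H - H'‖ ≤ 2 * R := by
  linarith [norm_sub_le H H']

/-- Existence for the fixed point problem. -/
theorem exists_nextForcing_eq (h : IsSubcritical hP hs b θ μ p T₀ C C' F) (hT : T ≤ T₀)
    (hR : 1 ≤ R) (hsmall : gain b p T C C' * ENNReal.ofReal (4 * R) ^ b ≤ 1 / 4)
    {u₀ : Hs d s} (hu : ‖u₀‖ ≤ R) :
    ∃ H : Forcing d s T, ‖H‖ ≤ R ∧ nextForcing hP F u₀ H = H := by
  have hR0 : 0 ≤ R := by linarith
  have hμ1 : 0 < 1 - μ := by linarith [h.μ_lt]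
  -- For equal data the Hölder term is R (w^{1-μ} ‖H - H'‖^μ)^θ. Bounding ‖H - H'‖ by the diameter
  -- 2R gives K and the exponent (1 - μ)θ.
  refine exists_fixedPoint_of_weak_contraction (w := Forcing.weakNorm hs)
    (K := R * ((2 * R) ^ μ) ^ θ) (γ := (1 - μ) * θ) hR0 (by positivity)
    (mul_pos hμ1 h.θ_pos) (Forcing.weakNorm_nonneg hs) (Forcing.weakNorm_le hs)
    (fun H hH => h.norm_nextForcing_le hT hR hsmall hu hH) (fun H H' hH hH' => ?_)
    (fun H H' hH hH' => ?_)
  · simpa using h.weakNorm_nextForcing_sub_le hT hsmall hu hu hH hH'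
  · have h0 := Forcing.weakNorm_nonneg hs (H - H')
    refine (h.norm_nextForcing_sub_le hT hR hsmall hu hu hH hH').trans ?_
    rw [sub_self, norm_zero, zero_add, zero_add, mul_assoc]
    gcongr 1
    refine mul_le_mul_of_nonneg_left ?_ hR0
    rw [Real.mul_rpow (by positivity) (by positivity), ← Real.rpow_mul h0, mul_comm]
    refine mul_le_mul_of_nonneg_right ?_ (by positivity)
    refine Real.rpow_le_rpow (by positivity) ?_ h.θ_pos.le
    exact Real.rpow_le_rpow (norm_nonneg _) (norm_forcing_sub_le hH hH') h.μ_nonneg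

/-- The fixed point depends continuously on the initial value, with an explicit modulus. -/
theorem norm_sub_le_of_nextForcing_eq (h : IsSubcritical hP hs b θ μ p T₀ C C' F) (hT : T ≤ T₀)
    (hR : 1 ≤ R) (hsmall : gain b p T C C' * ENNReal.ofReal (4 * R) ^ b ≤ 1 / 4)
    {u₀ v₀ : Hs d s} {H H' : Forcing d s T} (hu : ‖u₀‖ ≤ R) (hv : ‖v₀‖ ≤ R)
    (hH : ‖H‖ ≤ R) (hH' : ‖H'‖ ≤ R) (hfix : nextForcing hP F u₀ H = H)
    (hfix' : nextForcing hP F v₀ H' = H') :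
    ‖H - H'‖ ≤ ‖u₀ - v₀‖ +
      2 * R * (‖u₀ - v₀‖ + ‖u₀ - v₀‖ ^ (1 - μ) * (2 * R) ^ μ) ^ θ := by
  have hR0 : 0 ≤ R := by linarith
  have hμ1 : 0 < 1 - μ := by linarith [h.μ_lt]
  have h0 := Forcing.weakNorm_nonneg hs (H - H')
  have h1 := h.weakNorm_nextForcing_sub_le hT hsmall hu hv hH hH'
  have h2 := h.norm_nextForcing_sub_le hT hR hsmall hu hv hH hH'
  rw [hfix, hfix'] at h1 h2
  -- The weak norm W of the difference satisfies W ≤ (‖u₀ - v₀‖ + W)/4, hence W ≤ ‖u₀ - v₀‖.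
  -- Inserting this in the strong estimate and absorbing ‖H - H'‖/4 gives the modulus.
  have hW : (H - H').weakNorm hs ≤ ‖u₀ - v₀‖ := by
    have := norm_nonneg (u₀ - v₀)
    linarith
  have h3 : (‖u₀ - v₀‖ + (H - H').weakNorm hs ^ (1 - μ) * ‖H - H'‖ ^ μ) ^ θ ≤
      (‖u₀ - v₀‖ + ‖u₀ - v₀‖ ^ (1 - μ) * (2 * R) ^ μ) ^ θ := by
    refine Real.rpow_le_rpow (by positivity) ?_ h.θ_pos.le
    have h4 := Real.rpow_le_rpow h0 hW hμ1.le
    have h5 := Real.rpow_le_rpow (norm_nonneg _) (norm_forcing_sub_le hH hH') h.μ_nonneg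
    gcongr
  set y := (‖u₀ - v₀‖ + ‖u₀ - v₀‖ ^ (1 - μ) * (2 * R) ^ μ) ^ θ
  have h6 := mul_le_mul_of_nonneg_left h3 hR0
  have h7 : 0 ≤ R * y := by positivity
  have := norm_nonneg (u₀ - v₀)
  linarith

end small

/-- Uniqueness for the fixed point problem, without restriction on size or time. -/
theorem nextForcing_unique (h : IsSubcritical hP hs b θ μ p T₀ C C' F) (hT0 : 0 < T) (hT : T ≤ T₀)
    {u₀ : Hs d s} {H H' : Forcing d s T} (hfix : nextForcing hP F u₀ H = H)
    (hfix' : nextForcing hP F u₀ H' = H') : H = H' := by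
  set M : ℝ → ℝ≥0∞ := fun t => Hs.supNorm hs (evolution hP u₀ H t) +
      Hs.supNorm hs (evolution hP u₀ H' t)
  have hae : (H - H' : Forcing d s T) =ᵐ[volume.restrict (Icc 0 T)]
      fun t => F (evolution hP u₀ H t) - F (evolution hP u₀ H' t) := by
    have := h.nextForcing_sub_ae hT u₀ u₀ H H'
    rwa [hfix, hfix'] at this
  -- Gronwall in L²: the coefficient C M^b is integrable in time because M is in L^p and b < p.
  -- Neither T nor the solutions need to be small.
  have hzero : ∫⁻ τ in Icc 0 T, ‖Hs.toL2 hs ((H - H' : Forcing d s T) τ)‖ₑ = 0 := by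
    refine setLIntegral_eq_zero_of_le_mul (m := fun t => C * M t ^ b) hT0
      (ne_top_of_le_ne_top (by simp) ((H - H').weak_le hs)) ?_ ?_
    · rw [lintegral_const_mul' _ _ h.ne_top]
      refine ENNReal.mul_ne_top h.ne_top (ne_top_of_le_ne_top ?_
        (h.lintegral_mul_rpow_le hT u₀ u₀ H H'))
      have hp0 : 0 < p := by linarith [h.one_le]
      have h1 : 0 ≤ 1 - b / p := by rw [sub_nonneg, div_le_one hp0]; exact h.b_lt.le
      exact ENNReal.mul_ne_top (ENNReal.mul_ne_top (ENNReal.rpow_ne_top_of_nonneg h1 (by simp))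
        (ENNReal.rpow_ne_top_of_nonneg h.b_pos.le h.ne_top'))
        (ENNReal.rpow_ne_top_of_nonneg h.b_pos.le (by finiteness))
    · filter_upwards [hae, h.ae_supNorm_ne_top hT u₀ H, h.ae_supNorm_ne_top hT u₀ H',
        ae_restrict_mem measurableSet_Icc] with t h1 h2 h3 ht
      rw [h1]
      refine (h.tame.enorm_toL2_sub_le _ _ (M t) (ENNReal.add_ne_top.2 ⟨h2, h3⟩)
        le_self_add le_add_self).trans ?_
      rw [mul_assoc]
      refine mul_le_mul_right (mul_le_mul_right ?_ _) _
      rw [← evolution_forcing_sub hP u₀ u₀ H H' ht]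
      refine (enorm_toL2_evolution_le hP hs _ (Forcing.integrableOn _) ht).trans (le_of_eq ?_)
      simp
  rw [lintegral_eq_zero_iff
    ((Hs.toL2 hs).continuous.comp_stronglyMeasurable (Lp.stronglyMeasurable (H - H'))).enorm] at hzero
  rw [← sub_eq_zero]
  refine Lp.ext ?_
  filter_upwards [hzero, Lp.coeFn_zero (Hs d s) 1 (volume.restrict (Icc (0 : ℝ) T))] with t h1 h2
  rw [h2]
  refine (map_eq_zero_iff _ (Hs.toL2_injective hs)).1 ?_
  simpa using h1

end IsSubcritical

/-! ### Solutions of the Cauchy problem -/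

section solutions

variable {P : Rd d → ℝ} (hP : Measurable P) {s T : ℝ}

/-- The solution of the linear equation as a continuous function on `[0,T]`. -/
def evolutionMap (u₀ : Hs d s) (H : Forcing d s T) : C(Icc (0 : ℝ) T, Hs d s) :=
  ⟨fun t => evolution hP u₀ H t,
    (continuousOn_evolution hP u₀ H.integrableOn).domRestrict⟩

theorem evolution_smul (u₀ : Hs d s) (G : ℝ → Hs d s) (c : ℂ) (t : ℝ) :
    evolution hP u₀ (fun τ => c • G τ) t =
      propagator hP (-t) u₀ + c • ∫ τ in (0 : ℝ)..t, propagator hP (-(t - τ)) (G τ) := by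
  have h : ∀ (τ : ℝ) (u : Hs d s), propagator hP τ (c • u) = c • propagator hP τ u := fun τ u =>
    (Hs.propagatorₗᵢ hP s τ).map_smul c u
  simp only [evolution, h, intervalIntegral.integral_smul]

theorem norm_evolutionMap_sub_le (u₀ v₀ : Hs d s) (H H' : Forcing d s T) :
    ‖evolutionMap hP u₀ H - evolutionMap hP v₀ H'‖ ≤ ‖u₀ - v₀‖ + ‖H - H'‖ := by
  rw [ContinuousMap.norm_le _ (by positivity)]
  intro t
  rw [ContinuousMap.sub_apply]
  change ‖evolution hP u₀ H t - evolution hP v₀ H' t‖ ≤ _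
  rw [← evolution_forcing_sub hP u₀ v₀ H H' t.2,
    ← ENNReal.ofReal_le_ofReal_iff (by positivity),
    ENNReal.ofReal_add (norm_nonneg _) (norm_nonneg _), ofReal_norm, ofReal_norm, ofReal_norm]
  refine (enorm_evolution_le hP _ _ t.2.1).trans ?_
  rw [Forcing.enorm_eq]
  exact add_le_add le_rfl (lintegral_mono_set (Icc_subset_Icc_right t.2.2))

end solutions

namespace IsSubcritical

variable {P : Rd d → ℝ} {hP : Measurable P} {s : ℝ} {hs : 0 ≤ s} {θ μ p T₀ T σ lam : ℝ}
  {C C' : ℝ≥0∞}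

/-- The nonlinear term of a solution, multiplied by `-i lam`, solves the fixed point problem. -/
theorem exists_nextForcing_eq_of_isSolution
    (h : IsSubcritical hP hs (2 * σ) θ μ p T₀ C C'
      (fun u => (-(Complex.I * lam)) • Hs.powNonlin hs (2 * σ) u))
    (hpow : ∀ u : Hs d s, Hs.supNorm hs u ≠ ∞ → Hs.toL2 hs (Hs.powNonlin hs (2 * σ) u) =ᵐ[volume]
      fun x => powNonlin (2 * σ) (Hs.toL2 hs u x))
    (hT : T ≤ T₀) {u₀ : Hs d s} {v : C(Icc (0 : ℝ) T, Hs d s)}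
    (hv : IsSolution hP lam σ u₀ v) :
    ∃ H : Forcing d s T, nextForcing hP
      (fun u => (-(Complex.I * lam)) • Hs.powNonlin hs (2 * σ) u) u₀ H = H ∧
        v = evolutionMap hP u₀ H := by
  obtain ⟨G, hG, hnl, hduh⟩ := hv
  set c : ℂ := -(Complex.I * lam) with hc
  have hcG : Integrable (fun τ => c • G τ) (volume.restrict (Icc 0 T)) := hG.smul c
  have hmem := memLp_one_iff_integrable.2 hcG
  set H : Forcing d s T := hmem.toLp with hH
  have hev : ∀ t : Icc (0 : ℝ) T, v t = evolution hP u₀ H t := by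
    intro t
    rw [evolution_congr hP u₀ hmem.coeFn_toLp t.2, evolution_smul, hduh t, hc, neg_smul, sub_eq_add_neg]
  refine ⟨H, ?_, ContinuousMap.ext hev⟩
  refine Lp.ext ?_
  filter_upwards [h.coeFn_nextForcing hT u₀ H, hmem.coeFn_toLp, h.ae_supNorm_ne_top hT u₀ H,
    ae_restrict_of_ae hnl, ae_restrict_mem measurableSet_Icc] with t h1 h2 h3 h4 ht
  rw [h1, h2]
  -- Equality is proved before multiplication by -iλ, so λ = 0 needs no separate treatment.
  congr 1
  obtain ⟨f, hf, hg⟩ := h4 ht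
  rw [hev ⟨t, ht⟩, Hs.toDistribution_eq_toL2 hs, isFunction_L2_iff] at hf
  rw [Hs.toDistribution_eq_toL2 hs, isFunction_L2_iff] at hg
  refine Hs.toL2_injective hs (Lp.ext ?_)
  filter_upwards [hf, hg, hpow _ h3] with x e1 e2 e3
  rw [e2, e3, e1]
  rfl

/-- The definition of a solution asks for integrability of |u|^{2σ}u itself. This cannot be read off
from the forcing -iλ|u|^{2σ}u when λ = 0, hence the second hypothesis, with constant 1. -/
theorem isSolution_of_nextForcing_eq {θ₁ μ₁ : ℝ} {C₁ : ℝ≥0∞}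
    (h : IsSubcritical hP hs (2 * σ) θ μ p T₀ C C'
      (fun u => (-(Complex.I * lam)) • Hs.powNonlin hs (2 * σ) u))
    (h₁ : IsSubcritical hP hs (2 * σ) θ₁ μ₁ p T₀ C₁ C'
      (fun u => (1 : ℂ) • Hs.powNonlin hs (2 * σ) u))
    (hpow : ∀ u : Hs d s, Hs.supNorm hs u ≠ ∞ → Hs.toL2 hs (Hs.powNonlin hs (2 * σ) u) =ᵐ[volume]
      fun x => powNonlin (2 * σ) (Hs.toL2 hs u x))
    (hT : T ≤ T₀) {u₀ : Hs d s} {H : Forcing d s T}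
    (hH : nextForcing hP (fun u => (-(Complex.I * lam)) • Hs.powNonlin hs (2 * σ) u) u₀ H = H) :
    IsSolution hP lam σ u₀ (evolutionMap hP u₀ H) := by
  refine ⟨fun τ => Hs.powNonlin hs (2 * σ) (evolution hP u₀ H τ), ?_, ?_, fun t => ?_⟩
  · have := memLp_one_iff_integrable.1 (h₁.memLp hT u₀ H)
    simp only [one_smul] at this
    exact this
  · have h2 := h.ae_supNorm_ne_top hT u₀ H
    rw [ae_restrict_iff' measurableSet_Icc] at h2
    filter_upwards [h2] with τ h3 hτ
    refine ⟨Hs.toL2 hs (evolution hP u₀ H τ), ?_, ?_⟩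
    · change IsFunction (evolution hP u₀ H τ).toDistribution _
      rw [Hs.toDistribution_eq_toL2 hs]
      exact IsFunction.of_L2 _
    · rw [Hs.toDistribution_eq_toL2 hs, isFunction_L2_iff]
      exact hpow _ (h3 hτ)
  · have h2 := h.coeFn_nextForcing hT u₀ H
    rw [hH] at h2
    change evolution hP u₀ H t = _
    rw [evolution_congr hP u₀ h2 t.2, evolution_smul, neg_smul, sub_eq_add_neg]

/-- The gain contains T^{1-2σ/p} with a positive exponent, so it tends to 0 with T. The time depends
on the data only through R. -/
theorem exists_time (h : IsSubcritical hP hs (2 * σ) θ μ p T₀ C C'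
      (fun u => (-(Complex.I * lam)) • Hs.powNonlin hs (2 * σ) u)) (hT₀ : 0 < T₀) (R : ℝ) :
    ∃ T, 0 < T ∧ T ≤ T₀ ∧ gain (2 * σ) p T C C' * ENNReal.ofReal (4 * R) ^ (2 * σ) ≤ 1 / 4 := by
  have hp0 : 0 < p := by linarith [h.one_le]
  have he : 0 < 1 - 2 * σ / p := by rw [sub_pos, div_lt_one hp0]; exact h.b_lt
  have hK : C' ^ (2 * σ) ≠ ∞ := ENNReal.rpow_ne_top_of_nonneg h.b_pos.le h.ne_top'
  have hR : ENNReal.ofReal (4 * R) ^ (2 * σ) ≠ ∞ :=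
    ENNReal.rpow_ne_top_of_nonneg h.b_pos.le ENNReal.ofReal_ne_top
  have h1 : Tendsto (fun T : ℝ => gain (2 * σ) p T C C' * ENNReal.ofReal (4 * R) ^ (2 * σ))
      (𝓝 0) (𝓝 0) := by
    have e1 : Tendsto (fun T : ℝ => ENNReal.ofReal T ^ (1 - 2 * σ / p)) (𝓝 0) (𝓝 0) := by
      have := ((ENNReal.continuous_rpow_const (y := 1 - 2 * σ / p)).comp
        ENNReal.continuous_ofReal).tendsto 0
      simpa [ENNReal.zero_rpow_of_pos he, Function.comp_def] using this
    have e2 := ENNReal.Tendsto.mul_const (ENNReal.Tendsto.const_mul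
      (ENNReal.Tendsto.mul_const e1 (Or.inr hK)) (Or.inr h.ne_top)) (Or.inr hR)
    simpa [gain] using e2
  have h2 : ∀ᶠ T : ℝ in 𝓝 0,
      gain (2 * σ) p T C C' * ENNReal.ofReal (4 * R) ^ (2 * σ) ≤ 1 / 4 :=
    (h1.eventually (gt_mem_nhds (show (0 : ℝ≥0∞) < 1 / 4 by simp))).mono fun T hT => le_of_lt hT
  have h3 : ∀ᶠ T : ℝ in 𝓝[>] 0, 0 < T ∧ T ≤ T₀ ∧
      gain (2 * σ) p T C C' * ENNReal.ofReal (4 * R) ^ (2 * σ) ≤ 1 / 4 := by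
    filter_upwards [self_mem_nhdsWithin, h2.filter_mono nhdsWithin_le_nhds,
      (gt_mem_nhds hT₀ : ∀ᶠ T in 𝓝 (0 : ℝ), T < T₀).filter_mono nhdsWithin_le_nhds] with T h1 h2 h3
    exact ⟨h1, h3.le, h2⟩
  exact h3.exists

/-- The expression bounds the distance of two solutions whose data are at distance x. It is
continuous in x and vanishes at 0 because 1 - μ and θ are positive. -/
theorem exists_modulus {R μ θ : ℝ} (hμ : μ < 1) (hθ : 0 < θ) {ε : ℝ}
    (hε : 0 < ε) : ∃ δ > 0, ∀ x : ℝ, 0 ≤ x → x < δ →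
      x + (x + 2 * R * (x + x ^ (1 - μ) * (2 * R) ^ μ) ^ θ) < ε := by
  have hc : Continuous fun x : ℝ => x + (x + 2 * R * (x + x ^ (1 - μ) * (2 * R) ^ μ) ^ θ) := by
    have h1 : Continuous fun x : ℝ => x ^ (1 - μ) :=
      continuous_id.rpow_const fun _ => Or.inr (by linarith)
    exact continuous_id.add (continuous_id.add (continuous_const.mul
      ((continuous_id.add (h1.mul continuous_const)).rpow_const fun _ => Or.inr hθ.le)))
  have h0 := hc.tendsto 0
  simp only [zero_add, Real.zero_rpow (show 1 - μ ≠ 0 by linarith), zero_mul,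
    Real.zero_rpow hθ.ne', mul_zero] at h0
  obtain ⟨δ, hδ, h⟩ := Metric.eventually_nhds_iff.1 (h0.eventually (gt_mem_nhds hε))
  exact ⟨δ, hδ, fun x hx0 hx => h (by rwa [Real.dist_eq, sub_zero, abs_of_nonneg hx0])⟩

/-- Well-posedness. Solutions are unique in all of `C([0,T]; H^s)`: by Duhamel's formula, each of
them belongs to `L^p([0,T]; L^∞)`, so that this space itself can serve as the solution space. -/
theorem wellPosed {θ₁ μ₁ : ℝ} {C₁ : ℝ≥0∞}
    (h : IsSubcritical hP hs (2 * σ) θ μ p T₀ C C'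
      (fun u => (-(Complex.I * lam)) • Hs.powNonlin hs (2 * σ) u))
    (h₁ : IsSubcritical hP hs (2 * σ) θ₁ μ₁ p T₀ C₁ C'
      (fun u => (1 : ℂ) • Hs.powNonlin hs (2 * σ) u))
    (hpow : ∀ u : Hs d s, Hs.supNorm hs u ≠ ∞ → Hs.toL2 hs (Hs.powNonlin hs (2 * σ) u) =ᵐ[volume]
      fun x => powNonlin (2 * σ) (Hs.toL2 hs u x))
    (hT₀ : 0 < T₀) : WellPosed hP lam σ s := by
  intro B hB
  obtain ⟨R₀, hR₀⟩ := hB.exists_norm_le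
  set R : ℝ := max R₀ 1
  have hR : 1 ≤ R := le_max_right _ _
  have hBR : ∀ u ∈ B, ‖u‖ ≤ R := fun u hu => (hR₀ u hu).trans (le_max_left _ _)
  obtain ⟨T, hT0, hT, hsmall⟩ := h.exists_time hT₀ R
  -- Data outside the ball receive the dummy forcing 0, so that the choice is a total function.
  have hex : ∀ u₀ : Hs d s, ∃ H : Forcing d s T, ‖u₀‖ ≤ R → ‖H‖ ≤ R ∧ nextForcing hP
      (fun u => (-(Complex.I * lam)) • Hs.powNonlin hs (2 * σ) u) u₀ H = H := by
    intro u₀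
    by_cases hu : ‖u₀‖ ≤ R
    · obtain ⟨H, hH⟩ := h.exists_nextForcing_eq hT hR hsmall hu
      exact ⟨H, fun _ => hH⟩
    · exact ⟨0, fun h => absurd h hu⟩
  choose Φ hΦ using hex
  refine ⟨T, hT0, C(Icc (0 : ℝ) T, Hs d s), inferInstance, inferInstance, inferInstance,
    ContinuousLinearMap.id ℂ _, fun u₀ => evolutionMap hP u₀ (Φ u₀), Function.injective_id,
    fun u₀ hu₀ => ⟨?_, fun v hv => ?_⟩, ?_⟩
  · exact h.isSolution_of_nextForcing_eq h₁ hpow hT (hΦ u₀ (hBR u₀ hu₀)).2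
  · obtain ⟨H, hH, rfl⟩ := h.exists_nextForcing_eq_of_isSolution hpow hT hv
    rw [h.nextForcing_unique hT0 hT hH (hΦ u₀ (hBR u₀ hu₀)).2]
  · rw [Metric.uniformContinuousOn_iff]
    intro ε hε
    obtain ⟨δ, hδ, hmod⟩ := exists_modulus (R := R) h.μ_lt h.θ_pos hε
    refine ⟨δ, hδ, fun u₀ hu₀ v₀ hv₀ hd => ?_⟩
    rw [dist_eq_norm] at hd ⊢
    have hu := hΦ u₀ (hBR u₀ hu₀)
    have hv := hΦ v₀ (hBR v₀ hv₀)
    refine lt_of_le_of_lt ((norm_evolutionMap_sub_le hP u₀ v₀ (Φ u₀) (Φ v₀)).trans ?_)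
      (hmod _ (norm_nonneg _) hd)
    exact add_le_add le_rfl (h.norm_sub_le_of_nextForcing_eq hT hR hsmall (hBR u₀ hu₀)
      (hBR v₀ hv₀) hu.1 hv.1 hu.2 hv.2)

end IsSubcritical

/-! ### From the Strichartz estimate to the subcritical setting -/

/-- A Strichartz estimate with a loss of `k` derivatives gives the subcritical smoothing. -/
theorem StrichartzEstimate.exists_smoothing {P : Rd d → ℝ} {hP : Measurable P} {p q : ℝ≥0∞}
    {k T₀ C : ℝ} (hS : StrichartzEstimate hP p q k T₀ C) (hC : 0 ≤ C) (hp : 2 ≤ p) (hq : 2 ≤ q)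
    {s σ : ℝ} (hs₀ : 0 ≤ s) (hs₁ : k + d * (q⁻¹).toReal < s) (hσ₀ : 0 < σ)
    (hσ₁ : ENNReal.ofReal σ < p / 2) :
    ∃ μ p₁ : ℝ, 0 ≤ μ ∧ μ < 1 ∧ 2 * σ < p₁ ∧ 1 ≤ p₁ ∧ ∃ C' : ℝ≥0∞, C' ≠ ∞ ∧
      ∀ f : L2 d, sobolevNorm (μ * s) f ≠ ∞ →
        ∫⁻ t in Icc 0 T₀, eLpNorm (propagatorL2 hP (-t) f) ∞ volume ^ p₁ ≤
          (C' * sobolevNorm (μ * s) f) ^ p₁ := by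
  -- For finite p take p₁ = p; for p = ∞ any finite exponent above 2σ and 1 will do.
  obtain ⟨p₁, hbp, hp1, hpp⟩ : ∃ p₁ : ℝ, 2 * σ < p₁ ∧ 1 ≤ p₁ ∧ ENNReal.ofReal p₁ ≤ p := by
    rcases eq_or_ne p ∞ with rfl | hpt
    · exact ⟨2 * σ + 1, by linarith, by linarith, le_top⟩
    · refine ⟨p.toReal, ?_, ?_, by rw [ENNReal.ofReal_toReal hpt]⟩
      · have h1 : σ < (p / 2).toReal := by
          rwa [← ENNReal.ofReal_lt_iff_lt_toReal hσ₀.le (ENNReal.div_ne_top hpt (by norm_num))]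
        rw [ENNReal.toReal_div] at h1
        simp only [ENNReal.toReal_ofNat] at h1
        linarith
      · have := ENNReal.toReal_mono hpt hp
        simp only [ENNReal.toReal_ofNat] at this
        linarith
  -- The strict inequality k + d/q < s leaves room for μ < 1. The maximum with 0 keeps μ nonnegative
  -- when k + d/q is negative, and s = 0 is treated apart because there μs = 0 for every μ.
  obtain ⟨μ, hμ0, hμ1, hμ⟩ : ∃ μ : ℝ, 0 ≤ μ ∧ μ < 1 ∧ k + d * (q⁻¹).toReal < μ * s := by
    set y := k + d * (q⁻¹).toReal
    rcases hs₀.eq_or_lt with rfl | hs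
    · exact ⟨0, le_rfl, one_pos, by simpa using hs₁⟩
    · obtain ⟨z, hz1, hz2⟩ := exists_between (max_lt hs₁ hs)
      refine ⟨z / s, div_nonneg ((le_max_right _ _).trans hz1.le) hs.le, (div_lt_one hs).2 hz2, ?_⟩
      rw [div_mul_cancel₀ _ hs.ne']
      exact (le_max_left _ _).trans_lt hz1
  obtain ⟨C', hC', hmain⟩ := hS.lintegral_top_le_neg hP (le_trans (by norm_num) hp)
    (lt_of_lt_of_le (by norm_num) hq) hC hμ hp1 hpp
  exact ⟨μ, p₁, hμ0, hμ1, hbp, hp1, C', hC', hmain⟩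

end

theorem proposition2 (d : ℕ) (hd : 1 ≤ d) (P : Rd d → ℝ) (hP : Measurable P)
    (p q : ℝ≥0∞) (hpq : Admissible d p q)
    (k : ℝ) (hk : k < 2 * (p⁻¹).toReal)
    (T₀ C : ℝ) (hT₀ : 0 < T₀) (hC : 0 < C)
    (hS : StrichartzEstimate hP p q k T₀ C)
    (lam s σ : ℝ) (hs₀ : 0 ≤ s) (hs₁ : k + d * (q⁻¹).toReal < s) (hs₂ : s < d / 2)
    (hσ₀ : 0 < σ) (hσ₁ : ENNReal.ofReal σ < p / 2)
    (hsmooth : (∃ n : ℕ, σ = n) ∨ ∃ r : ℕ, s ≤ r ∧ r < 2 * σ + 1) :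
    WellPosed hP lam σ s := by
  obtain ⟨-, hp, hq, -⟩ := hpq
  obtain ⟨μ, p₁, hμ0, hμ1, hbp, hp1, C', hC', hmain⟩ :=
    hS.exists_smoothing hC.le hp hq hs₀ hs₁ hσ₀ hσ₁
  have hreg : (∃ n : ℕ, 2 * σ = 2 * n) ∨ ∃ r : ℕ, s ≤ r ∧ r < 2 * σ + 1 :=
    hsmooth.imp_left fun ⟨n, hn⟩ => ⟨n, by rw [hn]⟩
  have hb : 0 < 2 * σ := by linarith
  obtain ⟨θ, hθ0, -, hθb, C₂, hC₂, htame, hpow⟩ :=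
    exists_isTame_powNonlin d hb hs₀ hreg (-(Complex.I * lam))
  -- The constant 1 serves for the integrability of |u|^{2σ}u, the constant -iλ for the fixed point
  -- problem.
  obtain ⟨θ₁, hθ₁0, -, hθ₁b, C₁, hC₁, htame₁, -⟩ := exists_isTame_powNonlin d hb hs₀ hreg 1
  have h : IsSubcritical hP hs₀ (2 * σ) θ μ p₁ T₀ C₂ C'
      (fun u => (-(Complex.I * lam)) • Hs.powNonlin hs₀ (2 * σ) u) :=
    ⟨htame, hmain, hC₂, hC', hb, hθ0, hθb, hbp, hp1, hμ0, hμ1⟩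
  have h₁ : IsSubcritical hP hs₀ (2 * σ) θ₁ μ p₁ T₀ C₁ C'
      (fun u => (1 : ℂ) • Hs.powNonlin hs₀ (2 * σ) u) :=
    ⟨htame₁, hmain, hC₁, hC', hb, hθ₁0, hθ₁b, hbp, hp1, hμ0, hμ1⟩
  exact h.wellPosed h₁ hpow hT₀
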